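/- **Conventions.** A $C^*$-category $\mathcal C$ (possibly large, with small hom-spaces, and not assumed to have identity morphisms) consists of Banach spaces $\mathcal C(X,Y)$, a bilinear associative composition with $\|gf\|\le\|g\|\,\|f\|$, and a conjugate-linear isometric involution $*:\mathcal C(X,Y)\to\mathcal C(Y,X)$ with $(gf)^*=f^*g^*$, such that $\|f\|^2=\|f^*f\|$ and $f^*f$ is a positive element of the $C^*$-algebra $\mathcal C(X):=\mathcal C(X,X)$ for all $f\in\mathcal C(X,Y)$. It is unital if all its objects have identity morphisms. A $*$-functor is a functor that is $\mathbb C$-linear on morphisms and preserves $*$; it is unital if it preserves identities. A morphism $t$ is unitary if $t^*t$ and $tt^*$ are identity morphisms. A $*$-functor is an equivalence of $C^*$-categories if it is bijective on hom-spaces and every object of the target is unitarily isomorphic to the image of an object. *Hilbert modules.* A Hilbert $\mathcal C$-module $H$ is a contravariant $\mathbb C$-linear functor $A\mapsto H(A)$ from $\mathcal C$ to vector spaces, with the action written $(a,f)\mapsto af\in H(B)$ for $a\in H(A)$, $f\in\mathcal C(B,A)$, together with elements $\langle b,a\rangle\in\mathcal C(A,B)$ for $a\in H(A)$, $b\in H(B)$,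 linear in $a$, such that $\langle b,a\rangle=\langle a,b\rangle^*$, $\langle b,af\rangle=\langle b,a\rangle f$, $\langle a,a\rangle\ge 0$, and each $H(A)$ is separated and complete for $\|a\|=\|\langle a,a\rangle\|^{1/2}$. It is small if there is a set of elements $e_x\in H(A_x)$ such that, for every $A$, the elements $e_xf$ ($f\in\mathcal C(A,A_x)$) span a dense subspace of $H(A)$. An operator $T:H\to H'$ is a uniformly bounded natural linear transformation that has an adjoint $T^*$, $\langle Th,h'\rangle=\langle h,T^*h'\rangle$. Small Hilbert $\mathcal C$-modules and operators form the unital $C^*$-category $\mathcal H\mathcal C$. The Yoneda embedding is $\mathbb Y:\mathcal C\to\mathcal H\mathcal C$, $\mathbb Y_A(X)=\mathcal C(X,A)$, $\langle u,v\rangle=u^*v$. Each $a\in H(A)$ defines an operator $\tilde a:\mathbb Y_A\to H$, $f\mapsto af$. A $*$-functor $f:\mathcal D\to\mathcal C$ induces a $*$-functor $\mathcal Hf:\mathcal H\mathcal D\to\mathcal H\mathcal C$: the module $(\mathcal Hf)M$ is generated by elements $\iota_a(m)\in((\mathcal Hf)M)(f(a))$ for $m\in M(a)$, linear in $m$, with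 $\langle\iota_b(m'),\iota_a(m)\rangle=f(\langle m',m\rangle)$. *Pre-complete categories.* A pre-complete $C^*$-category is a unital $C^*$-category $\mathcal C$ with a unital $*$-functor $L:\mathcal H\mathcal C\to\mathcal C$ and a natural unitary isomorphism $\eta:\mathrm{Id}_{\mathcal C}\simeq L\circ\mathbb Y$. A unital $*$-functor $F:(\mathcal C,L,\eta)\to(\mathcal C',L',\eta')$ is continuous if there is a natural unitary isomorphism $\theta: L'\circ\mathcal HF\simeq F\circ L$ which on each $\mathbb Y_X$ is the canonical one, that is, $\theta_{\mathbb Y_X}\,L'\bigl(\widetilde{\iota_X(1_X)}\bigr)\,\eta'_{F(X)}=F(\eta_X)$. *Hereditary subcategories.* A $*$-functor $i:\mathcal D\to\mathcal C$ embeds $\mathcal D$ in $\mathcal C$ as a hereditary subcategory if it is injective on hom-spaces and, for all objects $a,b,c,e$ of $\mathcal D$, $i(h)\,g\,i(f)\in i(\mathcal D(a,e))$ whenever $f\in\mathcal D(a,b)$, $g\in\mathcal C(i(b),i(c))$, $h\in\mathcal D(c,e)$. The restriction functor $R_{\mathcal D}:\mathcal C\to\mathcal H\mathcal D$ (for unital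 $\mathcal C$) is $R_{\mathcal D}(X)(a)=\{f\in\mathcal C(i(a),X): f^*f\in i(\mathcal D(a,a))\}$, where $\langle g,f\rangle$ is the morphism of $\mathcal D$ with image $g^*f$, and it acts on morphisms by composition. Every $\mathcal H\mathcal D$ is pre-complete for the functor $\mathcal H\mathcal H\mathcal D\to\mathcal H\mathcal D$ of restriction along $\mathcal D\xrightarrow{\mathbb Y}\mathcal H\mathcal D\xrightarrow{\mathbb Y}\mathcal H\mathcal H\mathcal D$ and the canonical isomorphisms $M\simeq\{T\in\mathcal H\mathcal D(\mathbb Y_{(-)},M):T^*T\in\mathbb Y(\mathcal D)\}$, $m\mapsto\tilde m$. Let $(\mathcal C,L,\eta)$ be pre-complete. The embedding $i$ is generating if there is a natural unitary isomorphism $\mu:\mathrm{Id}_{\mathcal C}\simeq L\circ\mathcal Hi\circ R_{\mathcal D}$ such that $\mu_Y f=L\bigl(\widetilde{\iota_a(f)}\bigr)\,\eta_{i(a)}$ for every object $Y$ of $\mathcal C$, every object $a$ of $\mathcal D$ and every $f\in R_{\mathcal D}(Y)(a)$. A hereditary subalgebra $B$ of $\mathcal C(X)$ is a closed self-adjoint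 subalgebra with $B\,\mathcal C(X)\,B\subseteq B$; let $BX\subseteq\mathbb Y_X$ be the submodule for which $(BX)(A)$ is the closed linear span of the $bh$, $b\in B$, $h\in\mathcal C(A,X)$. Then $B$ is weakly dense if there is a unitary $t:L(BX)\to X$ such that $t\,L(\tilde g)\,\eta_A=g$ for all $A$ and all $g\in(BX)(A)$. A morphism $k\in\mathcal C(X,Y)$ is absolutely compact if $h_2^*kh_1\in B$ for every object $Z$, all $h_1:Z\to X$ and $h_2:Z\to Y$, and every weakly dense hereditary subalgebra $B$ of $\mathcal C(Z)$. **Theorem.** Let $(\mathcal C,L,\eta)$ be a pre-complete $C^*$-category and let $\mathcal D$ be a (not necessarily unital) $C^*$-category. 1. $\mathcal C$ is equivalent to $\mathcal H\mathcal D$ as a pre-complete $C^*$-category, i.e. there is a continuous $*$-functor $\mathcal C\to\mathcal H\mathcal D$ which is an equivalence of $C^*$-categories, if and only if there is an embedding $i:\mathcal D\to\mathcal C$ of $\mathcal D$ as a generating hereditary subcategory such that all the morphisms $i(k)$ are absolutely compact in $\mathcal C$. 2. For every such embedding, the restriction functor $R_{\mathcal D}:\mathcal C\to\mathcal H\mathcal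 D$ is continuous and an equivalence of $C^*$-categories. -/

import Mathlib

universe w v u u₁ u₂ u₃

noncomputable section

open scoped ENNReal ComplexOrder

/-- A `C*`-category, not assumed to be unital (identity morphisms are not required to exist). -/
class CStarCat (C : Type u) where
  Hom : C → C → Type v
  [normedAddCommGroup : ∀ X Y, NormedAddCommGroup (Hom X Y)]
  [normedSpace : ∀ X Y, NormedSpace ℂ (Hom X Y)]
  [completeSpace : ∀ X Y, CompleteSpace (Hom X Y)]
  comp : ∀ {X Y Z : C}, Hom Y Z → Hom X Y → Hom X Z
  adj : ∀ {X Y : C}, Hom X Y → Hom Y X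
  comp_assoc : ∀ {W X Y Z : C} (h : Hom Y Z) (g : Hom X Y) (f : Hom W X),
    comp (comp h g) f = comp h (comp g f)
  add_comp : ∀ {X Y Z : C} (g g' : Hom Y Z) (f : Hom X Y),
    comp (g + g') f = comp g f + comp g' f
  comp_add : ∀ {X Y Z : C} (g : Hom Y Z) (f f' : Hom X Y),
    comp g (f + f') = comp g f + comp g f'
  smul_comp : ∀ {X Y Z : C} (c : ℂ) (g : Hom Y Z) (f : Hom X Y),
    comp (c • g) f = c • comp g f
  comp_smul : ∀ {X Y Z : C} (c : ℂ) (g : Hom Y Z) (f : Hom X Y),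
    comp g (c • f) = c • comp g f
  norm_comp_le : ∀ {X Y Z : C} (g : Hom Y Z) (f : Hom X Y), ‖comp g f‖ ≤ ‖g‖ * ‖f‖
  adj_adj : ∀ {X Y : C} (f : Hom X Y), adj (adj f) = f
  adj_comp : ∀ {X Y Z : C} (g : Hom Y Z) (f : Hom X Y), adj (comp g f) = comp (adj f) (adj g)
  adj_add : ∀ {X Y : C} (f g : Hom X Y), adj (f + g) = adj f + adj g
  adj_smul : ∀ {X Y : C} (c : ℂ) (f : Hom X Y), adj (c • f) = star c • adj f
  norm_adj : ∀ {X Y : C} (f : Hom X Y), ‖adj f‖ = ‖f‖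
  /-- The `C*`-identity. -/
  norm_sq : ∀ {X Y : C} (f : Hom X Y), ‖f‖ ^ 2 = ‖comp (adj f) f‖
  /-- `f* f` is a positive element of the `C*`-algebra of endomorphisms of the source of `f`. -/
  pos : ∀ {X Y : C} (f : Hom X Y), ∃ b : Hom X X, comp (adj f) f = comp (adj b) b

namespace CStarCat

infixr:80 " ⊚ " => CStarCat.comp
postfix:max "†" => CStarCat.adj

attribute [reducible, instance] normedAddCommGroup normedSpace
attribute [instance] completeSpace
attribute [simp] comp_assoc add_comp comp_add smul_comp comp_smul adj_adj adj_comp adj_add adj_smul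

section Basic

variable {C : Type u} [CStarCat.{v} C]

/-- Positive elements of the `C*`-algebra of endomorphisms of an object. -/
def IsPos {X : C} (a : Hom X X) : Prop := ∃ b : Hom X X, a = b† ⊚ b

/-- `e` is an identity morphism of `X`. -/
def IsId {X : C} (e : Hom X X) : Prop :=
  (∀ (Y : C) (f : Hom X Y), f ⊚ e = f) ∧ ∀ (Y : C) (f : Hom Y X), e ⊚ f = f

@[simp] lemma zero_comp {X Y Z : C} (f : Hom X Y) : (0 : Hom Y Z) ⊚ f = 0 := by
  simpa using smul_comp (0 : ℂ) (0 : Hom Y Z) f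

@[simp] lemma comp_zero {X Y Z : C} (g : Hom Y Z) : g ⊚ (0 : Hom X Y) = 0 := by
  simpa using comp_smul (0 : ℂ) g (0 : Hom X Y)

@[simp] lemma neg_comp {X Y Z : C} (g : Hom Y Z) (f : Hom X Y) : (-g) ⊚ f = -(g ⊚ f) := by
  simpa using smul_comp (-1 : ℂ) g f

@[simp] lemma comp_neg {X Y Z : C} (g : Hom Y Z) (f : Hom X Y) : g ⊚ (-f) = -(g ⊚ f) := by
  simpa using comp_smul (-1 : ℂ) g f

@[simp] lemma sub_comp {X Y Z : C} (g g' : Hom Y Z) (f : Hom X Y) :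
    (g - g') ⊚ f = g ⊚ f - g' ⊚ f := by simp [sub_eq_add_neg]

@[simp] lemma comp_sub {X Y Z : C} (g : Hom Y Z) (f f' : Hom X Y) :
    g ⊚ (f - f') = g ⊚ f - g ⊚ f' := by simp [sub_eq_add_neg]

@[simp] lemma adj_zero {X Y : C} : (0 : Hom X Y)† = 0 := by
  simpa using adj_smul (0 : ℂ) (0 : Hom X Y)

@[simp] lemma adj_neg {X Y : C} (f : Hom X Y) : (-f)† = -(f†) := by
  simpa using adj_smul (-1 : ℂ) f

@[simp] lemma adj_sub {X Y : C} (f g : Hom X Y) : (f - g)† = f† - g† := by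
  simp [sub_eq_add_neg]

lemma norm_sq' {X Y : C} (f : Hom X Y) : ‖f‖ ^ 2 = ‖f ⊚ f†‖ := by
  rw [← norm_adj f, norm_sq, adj_adj]

/-- Composition as a continuous bilinear map. -/
def compL (X Y Z : C) : Hom Y Z →L[ℂ] Hom X Y →L[ℂ] Hom X Z :=
  LinearMap.mkContinuous₂ (LinearMap.mk₂ ℂ comp add_comp smul_comp comp_add comp_smul) 1
    (fun g f => by simpa using norm_comp_le g f)

@[simp] lemma compL_apply {X Y Z : C} (g : Hom Y Z) (f : Hom X Y) : compL X Y Z g f = g ⊚ f := rfl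

@[fun_prop]
lemma continuous_comp {T : Type*} [TopologicalSpace T] {X Y Z : C} {g : T → Hom Y Z}
    {f : T → Hom X Y} (hg : Continuous g) (hf : Continuous f) :
    Continuous fun t => g t ⊚ f t := by
  have : Continuous fun t => compL X Y Z (g t) (f t) := by fun_prop
  exact this

/-- The adjoint as a conjugate-linear isometry. -/
def adjL (X Y : C) : Hom X Y →ₗᵢ⋆[ℂ] Hom Y X where
  toFun := adj
  map_add' := adj_add
  map_smul' := fun c f => by simp
  norm_map' := norm_adj

@[fun_prop]
lemma continuous_adj {T : Type*} [TopologicalSpace T] {X Y : C} {f : T → Hom X Y}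
    (hf : Continuous f) : Continuous fun t => (f t)† :=
  (adjL X Y).continuous.comp hf

instance instMul (X : C) : Mul (Hom X X) := ⟨comp⟩
instance instStar (X : C) : Star (Hom X X) := ⟨adj⟩

lemma mul_def {X : C} (f g : Hom X X) : f * g = f ⊚ g := rfl
lemma star_def {X : C} (f : Hom X X) : star f = f† := rfl

instance instNonUnitalNormedRing (X : C) : NonUnitalNormedRing (Hom X X) where
  __ := CStarCat.normedAddCommGroup X X
  mul := (· * ·)
  left_distrib := comp_add
  right_distrib := add_comp
  zero_mul := zero_comp
  mul_zero := comp_zero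
  mul_assoc := comp_assoc
  norm_mul_le := norm_comp_le

instance instStarRing (X : C) : StarRing (Hom X X) where
  star_involutive := adj_adj
  star_mul := adj_comp
  star_add := adj_add

/-- The endomorphisms of an object form a `C*`-algebra. -/
instance instNonUnitalCStarAlgebra (X : C) : NonUnitalCStarAlgebra (Hom X X) where
  __ := instNonUnitalNormedRing X
  __ := instStarRing X
  __ := CStarCat.normedSpace X X
  norm_mul_self_le f := by
    change ‖f‖ * ‖f‖ ≤ ‖f† ⊚ f‖
    rw [← norm_sq f, sq]
  complete := (CStarCat.completeSpace X X).complete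
  smul_assoc c f g := smul_comp c f g
  smul_comm c f g := (comp_smul c f g).symm
  star_smul c f := adj_smul c f

end Basic

/-! ### Hilbert modules -/

/-- A (right) Hilbert module over a `C*`-category: spaces `el A` indexed by the objects, a right
action of the morphisms and an inner product with values in the morphisms, linear in its second
variable; each `el A` is complete and separated for the norm `‖a‖ = ‖⟨a, a⟩‖ ^ (1/2)`.
Linearity and functoriality of the action follow from these axioms: see `act_add`, `add_act`,
`smul_act`, `act_smul`, `act_act` and `act_id` below. -/
structure HilbMod (C : Type u) [CStarCat.{v} C] where
  el : C → Type v
  [normedAddCommGroup : ∀ A, NormedAddCommGroup (el A)]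
  [normedSpace : ∀ A, NormedSpace ℂ (el A)]
  [completeSpace : ∀ A, CompleteSpace (el A)]
  act : ∀ {A B : C}, el A → Hom B A → el B
  inner : ∀ {A B : C}, el B → el A → Hom A B
  inner_add : ∀ {A B : C} (b : el B) (a a' : el A), inner b (a + a') = inner b a + inner b a'
  inner_smul : ∀ {A B : C} (c : ℂ) (b : el B) (a : el A), inner b (c • a) = c • inner b a
  inner_act : ∀ {A B D : C} (b : el B) (a : el A) (f : Hom D A),
    inner b (act a f) = inner b a ⊚ f
  inner_adj : ∀ {A B : C} (a : el A) (b : el B), (inner b a)† = inner a b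
  inner_pos : ∀ {A : C} (a : el A), IsPos (inner a a)
  norm_sq : ∀ {A : C} (a : el A), ‖a‖ ^ 2 = ‖inner a a‖

attribute [instance] HilbMod.normedAddCommGroup HilbMod.normedSpace
attribute [instance] HilbMod.completeSpace

attribute [simp] HilbMod.inner_add HilbMod.inner_smul HilbMod.inner_act HilbMod.inner_adj

section CauchySchwarz

open scoped CStarAlgebra

attribute [local instance] CStarAlgebra.spectralOrder CStarAlgebra.spectralOrderedRing

variable {C : Type u} [CStarCat.{v} C]

lemma IsPos.nonneg {X : C} {a : Hom X X} (h : IsPos a) : 0 ≤ a := by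
  obtain ⟨b, rfl⟩ := h
  exact star_mul_self_nonneg b

lemma isPos_of_nonneg {X : C} {a : Hom X X} (h : 0 ≤ a) : IsPos a := by
  obtain ⟨b, hb⟩ := CStarAlgebra.nonneg_iff_eq_star_mul_self.1 h
  exact ⟨b, hb⟩

lemma isPos_iff {X : C} {a : Hom X X} : IsPos a ↔ 0 ≤ a := ⟨IsPos.nonneg, isPos_of_nonneg⟩

lemma isPos_adj_comp {X Y : C} (f : Hom X Y) : IsPos (f† ⊚ f) := CStarCat.pos f

lemma IsPos.add {X : C} {a b : Hom X X} (ha : IsPos a) (hb : IsPos b) : IsPos (a + b) :=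
  isPos_of_nonneg (add_nonneg ha.nonneg hb.nonneg)

lemma isPos_zero (X : C) : IsPos (0 : Hom X X) := isPos_of_nonneg le_rfl

lemma isPos_sum {ι : Type*} {X : C} (s : Finset ι) (a : ι → Hom X X) (h : ∀ i ∈ s, IsPos (a i)) :
    IsPos (∑ i ∈ s, a i) :=
  isPos_of_nonneg (Finset.sum_nonneg fun i hi => (h i hi).nonneg)

lemma isClosed_isPos (X : C) : IsClosed {a : Hom X X | IsPos a} := by
  simp_rw [isPos_iff]
  exact CStarAlgebra.isClosed_nonneg

lemma norm_le_norm_add {X : C} {a b : Hom X X} (ha : IsPos a) (hb : IsPos b) :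
    ‖a‖ ≤ ‖a + b‖ :=
  CStarAlgebra.norm_le_norm_of_nonneg_of_le ha.nonneg (le_add_of_nonneg_right hb.nonneg)

lemma eq_zero_of_isPos_neg {X : C} {a : Hom X X} (ha : IsPos a) (hb : IsPos (-a)) : a = 0 :=
  le_antisymm (neg_nonneg.1 hb.nonneg) ha.nonneg

/-- The Cauchy-Schwarz inequality for a semi-definite inner product with values in the
endomorphisms of an object. -/
lemma norm_sq_form_le {X : C} {V : Type*} [AddCommGroup V] [Module ℂ V] (s : V → V → Hom X X)
    (act : V → Hom X X → V)
    (s_add : ∀ a b b', s a (b + b') = s a b + s a b')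
    (s_smul : ∀ (c : ℂ) a b, s a (c • b) = c • s a b)
    (s_act : ∀ a b f, s a (act b f) = s a b ⊚ f)
    (s_adj : ∀ a b, (s a b)† = s b a)
    (s_pos : ∀ a, IsPos (s a a)) (a b : V) : ‖s a b‖ ^ 2 ≤ ‖s a a‖ * ‖s b b‖ := by
  have s_add' : ∀ a a' b, s (a + a') b = s a b + s a' b := fun a a' b => by
    rw [← s_adj, s_add, adj_add, s_adj, s_adj]
  have s_smul' : ∀ (c : ℂ) a b, s (c • a) b = star c • s a b := fun c a b => by
    rw [← s_adj, s_smul, adj_smul, s_adj]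
  have s_act' : ∀ a b f, s (act a f) b = f† ⊚ s a b := fun a b f => by
    rw [← s_adj, s_act, adj_comp, s_adj]
  have key : ∀ K : ℝ, 0 < K → ‖s a a‖ ≤ K → ‖s a b‖ ^ 2 ≤ K * ‖s b b‖ := by
    intro K hK hle
    set z := s a b with hz
    -- positivity of the form on `K • b - a ⟨a, b⟩`
    have h1 : IsPos (z† ⊚ s a a ⊚ z - ((2 * K : ℝ) : ℂ) • (z† ⊚ z) + ((K * K : ℝ) : ℂ) • s b b) := by
      have := s_pos ((K : ℂ) • b + (-1 : ℂ) • act a z)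
      simp only [s_add, s_add', s_smul, s_smul', s_act, s_act', ← hz] at this
      rw [← s_adj a b, ← hz] at this
      convert this using 1
      simp only [smul_smul, neg_smul, one_smul, star_neg, star_one, smul_neg, neg_neg,
        comp_assoc]
      simp only [Complex.star_def, Complex.conj_ofReal]
      push_cast
      module
    have h2 : z† ⊚ s a a ⊚ z ≤ (K : ℂ) • (z† ⊚ z) := by
      have e1 := CStarAlgebra.star_left_conjugate_le_norm_smul (a := z) (b := s a a) (s_adj a a)
      have e2 : star z * s a a * z = z† ⊚ s a a ⊚ z := comp_assoc _ _ _
      rw [e2] at e1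
      refine e1.trans ?_
      have e3 : (‖s a a‖ : ℝ) • (star z * z) ≤ K • (star z * z) :=
        smul_le_smul_of_nonneg_right hle (star_mul_self_nonneg z)
      exact e3
    have h3 : (K : ℂ) • (z† ⊚ z) ≤ ((K * K : ℝ) : ℂ) • s b b := by
      have h4 := add_le_add h1.nonneg h2
      rw [← sub_nonneg] at h4 ⊢
      convert h4 using 1
      push_cast
      module
    have h5 : IsPos ((K : ℂ) • (z† ⊚ z)) := by
      refine isPos_of_nonneg ?_
      exact (smul_nonneg hK.le (star_mul_self_nonneg z) : 0 ≤ K • (star z * z))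
    have h6 := CStarAlgebra.norm_le_norm_of_nonneg_of_le h5.nonneg h3
    rw [norm_smul, norm_smul, ← CStarCat.norm_sq] at h6
    simp only [Complex.norm_real, Real.norm_eq_abs, abs_of_pos hK, abs_of_pos (mul_pos hK hK)] at h6
    rw [mul_assoc] at h6
    exact le_of_mul_le_mul_left h6 hK
  refine le_of_forall_pos_le_add fun ε hε => ?_
  have hb : 0 < ‖s b b‖ + 1 := by positivity
  have := key (‖s a a‖ + ε / (‖s b b‖ + 1)) (by positivity) (by
    have : 0 < ε / (‖s b b‖ + 1) := by positivity
    linarith)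
  refine this.trans ?_
  rw [add_mul]
  gcongr
  rw [div_mul_eq_mul_div, div_le_iff₀ hb]
  nlinarith [norm_nonneg (s b b)]

/-- The Cauchy-Schwarz inequality for elements lying over different objects: `x` stands for
`b ⟨b, a⟩`. -/
lemma norm_sq_cross_le {X Y : C} {V : Type*} [AddCommGroup V] [Module ℂ V] (s : V → V → Hom X X)
    (act : V → Hom X X → V)
    (s_add : ∀ a b b', s a (b + b') = s a b + s a b')
    (s_smul : ∀ (c : ℂ) a b, s a (c • b) = c • s a b)
    (s_act : ∀ a b f, s a (act b f) = s a b ⊚ f)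
    (s_adj : ∀ a b, (s a b)† = s b a)
    (s_pos : ∀ a, IsPos (s a a)) {x a : V} {z : Hom X Y} {β : Hom Y Y}
    (h₁ : s x x = z† ⊚ β ⊚ z) (h₂ : s x a = z† ⊚ z) : ‖z‖ ^ 2 ≤ ‖β‖ * ‖s a a‖ := by
  rcases eq_or_ne z 0 with h0 | h0
  · rw [h0, norm_zero, zero_pow two_ne_zero]; positivity
  have h3 := norm_sq_form_le s act s_add s_smul s_act s_adj s_pos x a
  rw [h₁, h₂, ← CStarCat.norm_sq] at h3
  have h4 : ‖z† ⊚ β ⊚ z‖ ≤ ‖z‖ ^ 2 * ‖β‖ := by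
    refine (norm_comp_le _ _).trans ?_
    rw [CStarCat.norm_adj, sq, mul_assoc, mul_comm ‖z‖ ‖β‖]
    gcongr
    exact norm_comp_le _ _
  have hp : 0 < ‖z‖ := norm_pos_iff.2 h0
  have h5 : ‖z‖ ^ 2 * ‖z‖ ^ 2 ≤ ‖z‖ ^ 2 * (‖β‖ * ‖s a a‖) := by
    calc _ = (‖z‖ ^ 2) ^ 2 := by ring
      _ ≤ _ := h3
      _ ≤ (‖z‖ ^ 2 * ‖β‖) * ‖s a a‖ := by gcongr
      _ = _ := by ring
  exact le_of_mul_le_mul_left h5 (by positivity)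

end CauchySchwarz

namespace HilbMod

variable {C : Type u} [CStarCat.{v} C] (M : HilbMod C)

@[simp] lemma add_inner {A B : C} (b b' : M.el B) (a : M.el A) :
    M.inner (b + b') a = M.inner b a + M.inner b' a := by
  rw [← M.inner_adj, M.inner_add, adj_add, M.inner_adj, M.inner_adj]

@[simp] lemma smul_inner {A B : C} (c : ℂ) (b : M.el B) (a : M.el A) :
    M.inner (c • b) a = star c • M.inner b a := by
  rw [← M.inner_adj, M.inner_smul, adj_smul, M.inner_adj]

@[simp] lemma act_inner {A B D : C} (b : M.el B) (a : M.el A) (f : Hom D B) :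
    M.inner (M.act b f) a = f† ⊚ M.inner b a := by
  rw [← M.inner_adj, M.inner_act, adj_comp, M.inner_adj]

lemma norm_inner_le {A B : C} (b : M.el B) (a : M.el A) : ‖M.inner b a‖ ≤ ‖b‖ * ‖a‖ := by
  have h1 := norm_sq_cross_le (V := M.el A) (fun x y => M.inner x y) (fun x f => M.act x f)
    (by simp) (by simp) (by simp) (by simp) M.inner_pos (x := M.act b (M.inner b a)) (a := a)
    (z := M.inner b a) (β := M.inner b b) (by simp) (by simp)
  rw [← M.norm_sq, ← M.norm_sq, ← mul_pow] at h1
  exact (le_abs_self _).trans (abs_le_of_sq_le_sq h1 (by positivity))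

variable {M} in
lemma ext_inner {A : C} {a a' : M.el A} (h : ∀ (B : C) (b : M.el B), M.inner b a = M.inner b a') :
    a = a' := by
  have h1 : M.inner (a - a') (a - a') = 0 := by
    have := M.inner_add (a - a') (a - a') a'
    rw [sub_add_cancel, h] at this
    exact right_eq_add.1 this
  have h2 := M.norm_sq (a - a')
  rw [h1, norm_zero] at h2
  exact sub_eq_zero.1 (norm_eq_zero.1 (by simpa using h2))

lemma act_add {A B : C} (a : M.el A) (f g : Hom B A) :
    M.act a (f + g) = M.act a f + M.act a g := ext_inner (by simp)

lemma add_act {A B : C} (a a' : M.el A) (f : Hom B A) :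
    M.act (a + a') f = M.act a f + M.act a' f := ext_inner (by simp)

lemma act_smul {A B : C} (c : ℂ) (a : M.el A) (f : Hom B A) :
    M.act a (c • f) = c • M.act a f := ext_inner (by simp)

lemma smul_act {A B : C} (c : ℂ) (a : M.el A) (f : Hom B A) :
    M.act (c • a) f = c • M.act a f := ext_inner (by simp)

lemma act_act {A B D : C} (a : M.el A) (f : Hom B A) (g : Hom D B) :
    M.act (M.act a f) g = M.act a (f ⊚ g) := ext_inner (by simp)

lemma act_id {A : C} {e : Hom A A} (he : IsId e) (a : M.el A) : M.act a e = a :=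
  ext_inner fun B b => by simp [he.1]

lemma norm_act_le {A B : C} (a : M.el A) (f : Hom B A) : ‖M.act a f‖ ≤ ‖a‖ * ‖f‖ := by
  have h : ‖M.act a f‖ ^ 2 ≤ (‖a‖ * ‖f‖) ^ 2 := by
    rw [M.norm_sq, inner_act, act_inner, comp_assoc]
    calc _ ≤ ‖f†‖ * (‖M.inner a a‖ * ‖f‖) :=
          (norm_comp_le _ _).trans (by gcongr; exact norm_comp_le _ _)
      _ = _ := by rw [CStarCat.norm_adj, ← M.norm_sq]; ring
  exact (le_abs_self _).trans (abs_le_of_sq_le_sq h (by positivity))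

/-- The action as a continuous bilinear map. -/
def actL (A B : C) : M.el A →L[ℂ] Hom B A →L[ℂ] M.el B :=
  LinearMap.mkContinuous₂
    (LinearMap.mk₂ ℂ M.act M.add_act M.smul_act M.act_add M.act_smul) 1
    (fun g f => by simpa using M.norm_act_le g f)

/-- The inner product as a continuous sesquilinear map. -/
def innerL (A B : C) : M.el B →L⋆[ℂ] M.el A →L[ℂ] Hom A B :=
  LinearMap.mkContinuous₂
    (LinearMap.mk₂'ₛₗ (starRingEnd ℂ) (RingHom.id ℂ) M.inner M.add_inner
      (fun c b a => by simp) M.inner_add (fun c b a => by simp)) 1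
    (fun g f => by simpa using M.norm_inner_le g f)

@[simp] lemma actL_apply {A B : C} (a : M.el A) (f : Hom B A) : M.actL A B a f = M.act a f := rfl
@[simp] lemma innerL_apply {A B : C} (b : M.el B) (a : M.el A) :
    M.innerL A B b a = M.inner b a := rfl

@[fun_prop]
lemma continuous_act {T : Type*} [TopologicalSpace T] {A B : C} {a : T → M.el A}
    {f : T → Hom B A} (ha : Continuous a) (hf : Continuous f) :
    Continuous fun t => M.act (a t) (f t) := by
  have : Continuous fun t => M.actL A B (a t) (f t) := by fun_prop
  exact this

@[fun_prop]
lemma continuous_inner {T : Type*} [TopologicalSpace T] {A B : C} {b : T → M.el B}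
    {a : T → M.el A} (hb : Continuous b) (ha : Continuous a) :
    Continuous fun t => M.inner (b t) (a t) := by
  have : Continuous fun t => M.innerL A B (b t) (a t) := by fun_prop
  exact this

@[simp] lemma inner_zero {A B : C} (b : M.el B) : M.inner b (0 : M.el A) = 0 :=
  (M.innerL A B b).map_zero

@[simp] lemma zero_inner {A B : C} (a : M.el A) : M.inner (0 : M.el B) a = 0 := by
  rw [← M.inner_adj, inner_zero, adj_zero]

@[simp] lemma inner_sub {A B : C} (b : M.el B) (a a' : M.el A) :
    M.inner b (a - a') = M.inner b a - M.inner b a' := (M.innerL A B b).map_sub a a'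

@[simp] lemma sub_inner {A B : C} (b b' : M.el B) (a : M.el A) :
    M.inner (b - b') a = M.inner b a - M.inner b' a := by
  rw [← M.inner_adj, M.inner_sub, adj_sub, M.inner_adj, M.inner_adj]

end HilbMod

/-! ### Operators between Hilbert modules -/

section Operators

variable {C : Type u} [CStarCat.{v} C]

/-- Uniformly bounded families of bounded linear maps `M.el A → N.el A`, with the norm
`sup_A ‖f A‖`. -/
abbrev BddFam (M N : HilbMod C) : Type (max u v) :=
  lp (fun A : C => M.el A →L[ℂ] N.el A) ∞

/-- `g` is adjoint to `f`. -/
def IsAdjFam {M N : HilbMod C} (f : BddFam M N) (g : BddFam N M) : Prop :=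
  ∀ (A B : C) (m : M.el A) (n : N.el B), N.inner n (f A m) = M.inner (g B n) m

lemma BddFam.norm_apply_le {M N : HilbMod C} (f : BddFam M N) {A : C} (m : M.el A) :
    ‖f A m‖ ≤ ‖f‖ * ‖m‖ :=
  ((f A).le_opNorm m).trans (by gcongr; exact lp.norm_apply_le_norm ENNReal.top_ne_zero f A)

lemma BddFam.norm_le {M N : HilbMod C} {f : BddFam M N} {K : ℝ} (hK : 0 ≤ K)
    (h : ∀ A (m : M.el A), ‖f A m‖ ≤ K * ‖m‖) : ‖f‖ ≤ K :=
  lp.norm_le_of_forall_le hK fun A => (f A).opNorm_le_bound hK (h A)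

lemma IsAdjFam.symm {M N : HilbMod C} {f : BddFam M N} {g : BddFam N M} (h : IsAdjFam f g) :
    IsAdjFam g f := fun A B n m => by
  rw [← M.inner_adj, ← h, N.inner_adj]

lemma IsAdjFam.norm_le {M N : HilbMod C} {f : BddFam M N} {g : BddFam N M} (h : IsAdjFam f g) :
    ‖g‖ ≤ ‖f‖ := by
  refine BddFam.norm_le (norm_nonneg _) fun A n => ?_
  have h1 : ‖g A n‖ * ‖g A n‖ ≤ ‖g A n‖ * (‖f‖ * ‖n‖) := by
    rw [← sq, M.norm_sq, ← h]
    refine (N.norm_inner_le _ _).trans ?_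
    calc _ ≤ ‖n‖ * (‖f‖ * ‖g A n‖) := by gcongr; exact f.norm_apply_le _
      _ = _ := by ring
  rcases eq_or_ne (g A n) 0 with h0 | h0
  · rw [h0, norm_zero]; positivity
  · exact le_of_mul_le_mul_left h1 (norm_pos_iff.2 h0)

/-- The space of operators (adjointable bounded linear maps) between two Hilbert modules.
Naturality is a consequence of adjointability, see `Opr.map_act`. -/
def Opr (M N : HilbMod C) : Submodule ℂ (BddFam M N) where
  carrier := {f | ∃ g : BddFam N M, IsAdjFam f g}
  zero_mem' := ⟨0, fun A B m n => by simp⟩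
  add_mem' := by
    rintro f f' ⟨g, hg⟩ ⟨g', hg'⟩
    refine ⟨g + g', fun A B m n => ?_⟩
    simp [hg A B m n, hg' A B m n]
  smul_mem' := by
    rintro c f ⟨g, hg⟩
    refine ⟨star c • g, fun A B m n => ?_⟩
    simp [hg A B m n]

lemma isClosed_opr (M N : HilbMod C) : IsClosed (Opr M N : Set (BddFam M N)) := by
  refine isClosed_of_closure_subset fun f hf => ?_
  obtain ⟨F, hF, hlim⟩ := mem_closure_iff_seq_limit.1 hf
  choose G hG using hF
  have hsub : ∀ i j, IsAdjFam (F i - F j) (G i - G j) := fun i j A B m n => by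
    simp [hG i A B m n, hG j A B m n]
  have hc : CauchySeq G := by
    have hFc := hlim.cauchySeq
    rw [Metric.cauchySeq_iff] at hFc ⊢
    intro ε hε
    obtain ⟨k, hk⟩ := hFc ε hε
    refine ⟨k, fun i hi j hj => lt_of_le_of_lt ?_ (hk i hi j hj)⟩
    rw [dist_eq_norm, dist_eq_norm]
    exact (hsub i j).norm_le
  obtain ⟨g, hg⟩ := cauchySeq_tendsto_of_complete hc
  refine ⟨g, fun A B m n => ?_⟩
  have ev : ∀ {M' N' : HilbMod C} {F' : ℕ → BddFam M' N'} {f' : BddFam M' N'} {D : C}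
      (x : M'.el D), Filter.Tendsto F' Filter.atTop (nhds f') →
      Filter.Tendsto (fun i => F' i D x) Filter.atTop (nhds (f' D x)) := by
    intro M' N' F' f' D x h
    rw [tendsto_iff_norm_sub_tendsto_zero] at h ⊢
    refine squeeze_zero (fun _ => norm_nonneg _) (fun i => ?_)
      (by simpa using h.mul_const ‖x‖)
    exact (F' i - f').norm_apply_le x
  refine tendsto_nhds_unique
    (((N.innerL A B n).continuous.tendsto _).comp (ev m hlim)) ?_
  have h2 : Continuous fun y : M.el B => M.inner y m := by fun_prop
  refine ((h2.tendsto _).comp (ev n hg)).congr fun i => ?_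
  exact (hG i A B m n).symm

instance (M N : HilbMod C) : CompleteSpace (Opr M N) :=
  (isClosed_opr M N).completeSpace_coe

namespace Opr

variable {M N P : HilbMod C}

/-- The value of an operator. -/
def app (T : Opr M N) {A : C} (m : M.el A) : N.el A := T.1 A m

lemma ext {S T : Opr M N} (h : ∀ A (m : M.el A), app S m = app T m) : S = T :=
  Subtype.ext (lp.ext (funext fun A => ContinuousLinearMap.ext (h A)))

lemma app_add_left (S T : Opr M N) {A : C} (m : M.el A) : app (S + T) m = app S m + app T m := rfl
lemma app_smul_left (c : ℂ) (T : Opr M N) {A : C} (m : M.el A) : app (c • T) m = c • app T m := rfl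
lemma app_zero_left {A : C} (m : M.el A) : app (0 : Opr M N) m = 0 := rfl

lemma norm_app_le (T : Opr M N) {A : C} (m : M.el A) : ‖app T m‖ ≤ ‖T‖ * ‖m‖ :=
  BddFam.norm_apply_le T.1 m

lemma norm_le {T : Opr M N} {K : ℝ} (hK : 0 ≤ K) (h : ∀ A (m : M.el A), ‖app T m‖ ≤ K * ‖m‖) :
    ‖T‖ ≤ K := BddFam.norm_le (f := T.1) hK h

/-- The adjoint operator. -/
def adj (T : Opr M N) : Opr N M := ⟨T.2.choose, T.1, T.2.choose_spec.symm⟩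

lemma inner_app (T : Opr M N) {A B : C} (m : M.el A) (n : N.el B) :
    N.inner n (app T m) = M.inner (app (adj T) n) m := T.2.choose_spec A B m n

lemma app_inner (T : Opr M N) {A B : C} (m : M.el A) (n : N.el B) :
    N.inner (app T m) n = M.inner m (app (adj T) n) := by
  rw [← N.inner_adj, inner_app, M.inner_adj]

lemma map_act (T : Opr M N) {A B : C} (m : M.el A) (f : Hom B A) :
    app T (M.act m f) = N.act (app T m) f :=
  HilbMod.ext_inner fun D n => by simp [inner_app]

/-- Construction of an operator from an adjoint pair of maps, the first of which is bounded. -/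
def mk (f : ∀ A, M.el A → N.el A) (g : ∀ A, N.el A → M.el A) (K : ℝ) (hK : 0 ≤ K)
    (hf : ∀ A m, ‖f A m‖ ≤ K * ‖m‖)
    (h : ∀ A B (m : M.el A) (n : N.el B), N.inner n (f A m) = M.inner (g B n) m) : Opr M N := by
  have h' : ∀ A B (m : M.el A) (n : N.el B), M.inner m (g B n) = N.inner (f A m) n := by
    intro A B m n
    rw [← M.inner_adj, ← h, N.inner_adj]
  have hg : ∀ A n, ‖g A n‖ ≤ K * ‖n‖ := by
    intro A n
    have h1 : ‖g A n‖ * ‖g A n‖ ≤ ‖g A n‖ * (K * ‖n‖) := by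
      rw [← sq, M.norm_sq, ← h]
      refine (N.norm_inner_le _ _).trans ?_
      calc _ ≤ ‖n‖ * (K * ‖g A n‖) := by gcongr; exact hf _ _
        _ = _ := by ring
    rcases eq_or_ne (g A n) 0 with h0 | h0
    · rw [h0, norm_zero]; positivity
    · exact le_of_mul_le_mul_left h1 (norm_pos_iff.2 h0)
  let F : ∀ A, M.el A →L[ℂ] N.el A := fun A =>
    LinearMap.mkContinuous
      { toFun := f A
        map_add' := fun x y => HilbMod.ext_inner fun B b => by simp [h]
        map_smul' := fun c x => HilbMod.ext_inner fun B b => by simp [h] } K (hf A)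
  let G : ∀ A, N.el A →L[ℂ] M.el A := fun A =>
    LinearMap.mkContinuous
      { toFun := g A
        map_add' := fun x y => HilbMod.ext_inner fun B b => by simp [h']
        map_smul' := fun c x => HilbMod.ext_inner fun B b => by simp [h'] } K (hg A)
  have hF : Memℓp F ∞ := memℓp_infty ⟨K, by
    rintro _ ⟨A, rfl⟩; exact LinearMap.mkContinuous_norm_le _ hK _⟩
  have hG : Memℓp G ∞ := memℓp_infty ⟨K, by
    rintro _ ⟨A, rfl⟩; exact LinearMap.mkContinuous_norm_le _ hK _⟩
  exact ⟨⟨F, hF⟩, ⟨G, hG⟩, h⟩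

lemma app_mk (f : ∀ A, M.el A → N.el A) (g : ∀ A, N.el A → M.el A) (K : ℝ) (hK : 0 ≤ K)
    (hf : ∀ A m, ‖f A m‖ ≤ K * ‖m‖)
    (h : ∀ A B (m : M.el A) (n : N.el B), N.inner n (f A m) = M.inner (g B n) m)
    {A : C} (m : M.el A) : app (mk f g K hK hf h) m = f A m := rfl

/-- Composition of operators. -/
def comp (S : Opr N P) (T : Opr M N) : Opr M P :=
  mk (fun _ m => app S (app T m)) (fun _ p => app (adj T) (app (adj S) p)) (‖S‖ * ‖T‖)
    (by positivity)
    (fun A m => by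
      refine (norm_app_le S _).trans ?_
      rw [mul_assoc]
      gcongr
      exact norm_app_le T m)
    (fun A B m p => by rw [inner_app, inner_app])

lemma app_comp (S : Opr N P) (T : Opr M N) {A : C} (m : M.el A) :
    app (comp S T) m = app S (app T m) := rfl

lemma adj_unique {T : Opr M N} {S : Opr N M}
    (h : ∀ A B (m : M.el A) (n : N.el B), N.inner n (app T m) = M.inner (app S n) m) :
    adj T = S := ext fun A n => HilbMod.ext_inner fun B m => by
  rw [← app_inner, ← N.inner_adj, h, M.inner_adj]

lemma adj_adj (T : Opr M N) : adj (adj T) = T := adj_unique fun A B m n => by rw [app_inner]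

lemma adj_comp (S : Opr N P) (T : Opr M N) : adj (comp S T) = comp (adj T) (adj S) :=
  adj_unique fun A B m n => by simp only [app_comp, inner_app]

lemma norm_adj (T : Opr M N) : ‖adj T‖ = ‖T‖ := by
  have h : ∀ {M N : HilbMod C} (T : Opr M N), ‖adj T‖ ≤ ‖T‖ := fun T =>
    IsAdjFam.norm_le T.2.choose_spec
  exact le_antisymm (h T) (by simpa only [adj_adj] using h (adj T))

lemma adj_add (S T : Opr M N) : adj (S + T) = adj S + adj T :=
  adj_unique fun A B m n => by simp only [app_add_left, N.inner_add, M.add_inner, inner_app]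

lemma adj_smul (c : ℂ) (T : Opr M N) : adj (c • T) = star c • adj T :=
  adj_unique fun A B m n => by
    simp only [app_smul_left, N.inner_smul, M.smul_inner, inner_app, star_star]

lemma norm_comp_le (S : Opr N P) (T : Opr M N) : ‖comp S T‖ ≤ ‖S‖ * ‖T‖ :=
  norm_le (by positivity) fun A m => by
    rw [app_comp, mul_assoc]
    exact (norm_app_le S _).trans (by gcongr; exact norm_app_le T m)

lemma app_add (T : Opr M N) {A : C} (m m' : M.el A) : app T (m + m') = app T m + app T m' :=
  (T.1 A).map_add m m'

lemma app_smul (T : Opr M N) {A : C} (c : ℂ) (m : M.el A) : app T (c • m) = c • app T m :=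
  (T.1 A).map_smul c m

lemma norm_sq (T : Opr M N) : ‖T‖ ^ 2 = ‖comp (adj T) T‖ := by
  refine le_antisymm ?_ ?_
  · have h : ‖T‖ ≤ √‖comp (adj T) T‖ := norm_le (Real.sqrt_nonneg _) fun A m => by
      have h1 : ‖app T m‖ ^ 2 ≤ (√‖comp (adj T) T‖ * ‖m‖) ^ 2 := by
        rw [N.norm_sq, inner_app, mul_pow, Real.sq_sqrt (norm_nonneg _), ← app_comp]
        calc _ ≤ ‖app (comp (adj T) T) m‖ * ‖m‖ := M.norm_inner_le _ _
          _ ≤ (‖comp (adj T) T‖ * ‖m‖) * ‖m‖ := by gcongr; exact norm_app_le _ _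
          _ = _ := by ring
      exact (le_abs_self _).trans (abs_le_of_sq_le_sq h1 (by positivity))
    calc ‖T‖ ^ 2 ≤ (√‖comp (adj T) T‖) ^ 2 := by gcongr
      _ = _ := Real.sq_sqrt (norm_nonneg _)
  · refine (norm_comp_le _ _).trans ?_
    rw [norm_adj, sq]

lemma add_comp (S S' : Opr N P) (T : Opr M N) : comp (S + S') T = comp S T + comp S' T :=
  ext fun A m => by simp only [app_comp, app_add_left]

lemma comp_add (S : Opr N P) (T T' : Opr M N) : comp S (T + T') = comp S T + comp S T' :=
  ext fun A m => by simp only [app_comp, app_add_left, app_add]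

lemma smul_comp (c : ℂ) (S : Opr N P) (T : Opr M N) : comp (c • S) T = c • comp S T :=
  ext fun A m => by simp only [app_comp, app_smul_left]

lemma comp_smul (c : ℂ) (S : Opr N P) (T : Opr M N) : comp S (c • T) = c • comp S T :=
  ext fun A m => by simp only [app_comp, app_smul_left, app_smul]

lemma comp_assoc {Q : HilbMod C} (R : Opr P Q) (S : Opr N P) (T : Opr M N) :
    comp (comp R S) T = comp R (comp S T) :=
  ext fun A m => by simp only [app_comp]

end Opr
end Operators

section OprPos

/-- A criterion for positivity in a `C*`-algebra. -/
lemma exists_eq_star_mul_self {A : Type*} [NonUnitalCStarAlgebra A] {a : A} (hsa : star a = a)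
    (h : ∀ c x : A, star c = c → c * a * c = -(star x * x) → x = 0) :
    ∃ b : A, a = star b * b := by
  let _ := CStarAlgebra.spectralOrder A
  let _ := CStarAlgebra.spectralOrderedRing A
  have hc : 0 ≤ a⁻ := CFC.negPart_nonneg a
  have hcsa : star a⁻ = a⁻ := (IsSelfAdjoint.of_nonneg hc).star_eq
  obtain ⟨s, hs⟩ := CStarAlgebra.nonneg_iff_eq_star_mul_self.1 hc
  have hcac : a⁻ * a * a⁻ = -(star (s * a⁻) * (s * a⁻)) := by
    have e := CFC.posPart_sub_negPart a hsa
    have h1 : a⁻ * a = -(a⁻ * a⁻) := by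
      calc a⁻ * a = a⁻ * (a⁺ - a⁻) := by rw [e]
        _ = _ := by rw [mul_sub, CFC.negPart_mul_posPart, zero_sub]
    rw [h1, star_mul, hcsa, mul_assoc a⁻ (star s), ← mul_assoc (star s), ← hs]
    simp [mul_assoc]
  have h0 := h _ _ hcsa hcac
  have h2 : star a⁻ * a⁻ = 0 := by
    rw [hcsa]
    nth_rw 1 [hs]
    rw [mul_assoc, h0, mul_zero]
  have h3 : a⁻ = 0 := (CStarRing.star_mul_self_eq_zero_iff _).1 h2
  refine CStarAlgebra.nonneg_iff_eq_star_mul_self.1 ?_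
  rw [← CFC.posPart_sub_negPart a hsa, h3, sub_zero]
  exact CFC.posPart_nonneg a

/-- The preceding criterion for an algebra given by its operations. -/
lemma exists_eq_star_mul_self_of_operations {A : Type*} [NormedAddCommGroup A] [NormedSpace ℂ A]
    [CompleteSpace A] (mul : A → A → A) (st : A → A)
    (add_mul : ∀ a b c, mul (a + b) c = mul a c + mul b c)
    (mul_add : ∀ a b c, mul a (b + c) = mul a b + mul a c)
    (smul_mul : ∀ (z : ℂ) a b, mul (z • a) b = z • mul a b)
    (mul_smul : ∀ (z : ℂ) a b, mul a (z • b) = z • mul a b)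
    (mul_assoc : ∀ a b c, mul (mul a b) c = mul a (mul b c))
    (norm_mul_le : ∀ a b, ‖mul a b‖ ≤ ‖a‖ * ‖b‖)
    (st_st : ∀ a, st (st a) = a) (st_mul : ∀ a b, st (mul a b) = mul (st b) (st a))
    (st_add : ∀ a b, st (a + b) = st a + st b) (st_smul : ∀ (z : ℂ) a, st (z • a) = star z • st a)
    (norm_sq : ∀ a, ‖a‖ ^ 2 = ‖mul (st a) a‖) {a : A} (hsa : st a = a)
    (h : ∀ c x : A, st c = c → mul (mul c a) c = -(mul (st x) x) → x = 0) :
    ∃ b : A, a = mul (st b) b := by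
  let i1 : NonUnitalNormedRing A :=
    { (inferInstance : NormedAddCommGroup A) with
      mul := mul
      left_distrib := mul_add
      right_distrib := add_mul
      zero_mul := fun b => by
        change mul 0 b = 0
        simpa using smul_mul 0 0 b
      mul_zero := fun b => by
        change mul b 0 = 0
        simpa using mul_smul 0 b 0
      mul_assoc := mul_assoc
      norm_mul_le := norm_mul_le }
  let i2 : StarRing A :=
    { star := st
      star_involutive := st_st
      star_mul := st_mul
      star_add := st_add }
  let i3 : NonUnitalCStarAlgebra A :=
    { i1, i2, (inferInstance : NormedSpace ℂ A) with
      complete := (inferInstance : CompleteSpace A).complete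
      norm_mul_self_le := fun f => by
        rw [← sq]; exact (norm_sq f).le
      smul_assoc := smul_mul
      smul_comm := fun z a b => (mul_smul z a b).symm
      star_smul := st_smul }
  exact exists_eq_star_mul_self hsa h

variable {C : Type u} [CStarCat.{v} C]

lemma opr_pos {M N : HilbMod C} (T : Opr M N) :
    ∃ b : Opr M M, Opr.comp (Opr.adj T) T = Opr.comp (Opr.adj b) b := by
  refine exists_eq_star_mul_self_of_operations (A := Opr M M) Opr.comp Opr.adj
    Opr.add_comp Opr.comp_add Opr.smul_comp Opr.comp_smul Opr.comp_assoc
    Opr.norm_comp_le Opr.adj_adj Opr.adj_comp Opr.adj_add Opr.adj_smul Opr.norm_sq ?_ ?_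
  · change Opr.adj (Opr.comp (Opr.adj T) T) = _
    rw [Opr.adj_comp, Opr.adj_adj]
  · intro c x hc hx
    change Opr.adj c = c at hc
    change Opr.comp (Opr.comp c (Opr.comp (Opr.adj T) T)) c = -(Opr.comp (Opr.adj x) x) at hx
    refine Opr.ext fun A m => ?_
    have h1 : M.inner m (Opr.app (Opr.comp (Opr.comp c (Opr.comp (Opr.adj T) T)) c) m) =
        N.inner (Opr.app T (Opr.app c m)) (Opr.app T (Opr.app c m)) := by
      simp only [Opr.app_comp]
      rw [Opr.inner_app c, hc, ← Opr.app_inner]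
    have h2 : M.inner m (Opr.app (-(Opr.comp (Opr.adj x) x)) m) =
        - M.inner (Opr.app x m) (Opr.app x m) := by
      rw [← neg_one_smul ℂ, Opr.app_smul_left, M.inner_smul, Opr.app_comp, ← Opr.app_inner,
        neg_one_smul]
    rw [hx, h2] at h1
    have h3 : M.inner (Opr.app x m) (Opr.app x m) = 0 :=
      eq_zero_of_isPos_neg (M.inner_pos _) (by rw [h1]; exact N.inner_pos _)
    have h4 := M.norm_sq (Opr.app x m)
    rw [h3, norm_zero] at h4
    exact norm_eq_zero.1 (by simpa using h4)

end OprPos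

/-! ### The `C*`-category of small Hilbert modules -/

/-- A small Hilbert module over a (possibly large) `C*`-category: a Hilbert module generated by a
set of elements. -/
structure SmallMod (C : Type u) [CStarCat.{v} C] extends HilbMod C where
  small : ∃ (X : Type v) (s : X → C) (e : ∀ x, el (s x)), ∀ A : C,
    Dense (Submodule.span ℂ {a : el A | ∃ (x : X) (f : Hom A (s x)), a = act (e x) f} : Set (el A))

section SmallMod

variable {C : Type u} [CStarCat.{v} C]

instance (M N : SmallMod C) : Small.{v} (Opr M.toHilbMod N.toHilbMod) := by
  obtain ⟨X, s, e, h⟩ := M.small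
  refine small_of_injective (β := ∀ x, N.el (s x)) (f := fun T x => Opr.app T (e x)) ?_
  intro S T hST
  refine Opr.ext fun A m => ?_
  have hext : S.1 A = T.1 A := by
    refine ContinuousLinearMap.ext_on (h A) ?_
    rintro _ ⟨x, f, rfl⟩
    have h1 := congrFun hST x
    change Opr.app S _ = Opr.app T _
    rw [Opr.map_act, Opr.map_act]
    exact congrArg (fun y => N.act y f) h1
  exact congrArg (fun F => F m) hext

/-- The operators between two small Hilbert modules form a set: their type is equivalent to one
in the universe of the morphisms of `C`. -/
def SHom (M N : SmallMod C) : Type v := Shrink.{v} (Opr M.toHilbMod N.toHilbMod)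

namespace SHom

variable {M N P : SmallMod C}

/-- The bijection with the space of operators. -/
def equiv : SHom M N ≃ Opr M.toHilbMod N.toHilbMod := (equivShrink _).symm

instance : AddCommGroup (SHom M N) := equiv.addCommGroup
instance : Module ℂ (SHom M N) := equiv.module ℂ

/-- The linear bijection with the space of operators. -/
def linEquiv : SHom M N ≃ₗ[ℂ] Opr M.toHilbMod N.toHilbMod := equiv.linearEquiv ℂ

instance : NormedAddCommGroup (SHom M N) :=
  NormedAddCommGroup.induced _ _ (linEquiv (M := M) (N := N)) linEquiv.injective

instance : NormedSpace ℂ (SHom M N) :=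
  NormedSpace.induced ℂ _ _ (linEquiv (M := M) (N := N)).toLinearMap

lemma norm_def (T : SHom M N) : ‖T‖ = ‖linEquiv T‖ := rfl

instance : CompleteSpace (SHom M N) := by
  have : Isometry (linEquiv (M := M) (N := N)) :=
    AddMonoidHomClass.isometry_of_norm _ fun T => rfl
  exact (completeSpace_congr (e := linEquiv.toEquiv) this.isUniformEmbedding).2 inferInstance

end SHom

/-- The `C*`-category of small Hilbert modules over `C` and operators between them. -/
instance SmallMod.instCStarCat : CStarCat.{v} (SmallMod C) where
  Hom := SHom
  comp S T := SHom.linEquiv.symm (Opr.comp (SHom.linEquiv S) (SHom.linEquiv T))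
  adj T := SHom.linEquiv.symm (Opr.adj (SHom.linEquiv T))
  comp_assoc h g f := by simp only [LinearEquiv.apply_symm_apply, Opr.comp_assoc]
  add_comp g g' f := by rw [map_add, Opr.add_comp, map_add]
  comp_add g f f' := by rw [map_add, Opr.comp_add, map_add]
  smul_comp c g f := by rw [map_smul, Opr.smul_comp, map_smul]
  comp_smul c g f := by rw [map_smul, Opr.comp_smul, map_smul]
  norm_comp_le g f := by
    simp only [SHom.norm_def, LinearEquiv.apply_symm_apply]; exact Opr.norm_comp_le _ _
  adj_adj f := by simp only [LinearEquiv.apply_symm_apply, Opr.adj_adj, LinearEquiv.symm_apply_apply]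
  adj_comp g f := by simp only [LinearEquiv.apply_symm_apply, Opr.adj_comp]
  adj_add f g := by rw [map_add, Opr.adj_add, map_add]
  adj_smul c f := by rw [map_smul, Opr.adj_smul, map_smul]
  norm_adj f := by simp only [SHom.norm_def, LinearEquiv.apply_symm_apply, Opr.norm_adj]
  norm_sq f := by simp only [SHom.norm_def, LinearEquiv.apply_symm_apply, Opr.norm_sq]
  pos f := by
    obtain ⟨b, hb⟩ := opr_pos (SHom.linEquiv f)
    exact ⟨SHom.linEquiv.symm b, by simp only [LinearEquiv.apply_symm_apply, hb]⟩

namespace SmallMod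

variable {M N P : SmallMod C}

/-- The value of a morphism of `SmallMod C` on an element. -/
def app (T : Hom M N) {A : C} (m : M.el A) : N.el A :=
  Opr.app (SHom.linEquiv (show SHom M N from T)) m

/-- A morphism of `SmallMod C` from an adjoint pair of maps. -/
def mkHom (f : ∀ A, M.el A → N.el A) (g : ∀ A, N.el A → M.el A) (K : ℝ) (hK : 0 ≤ K)
    (hf : ∀ A m, ‖f A m‖ ≤ K * ‖m‖)
    (h : ∀ A B (m : M.el A) (n : N.el B), N.inner n (f A m) = M.inner (g B n) m) : Hom M N :=
  (SHom.linEquiv.symm (Opr.mk f g K hK hf h) : SHom M N)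

@[simp] lemma app_mkHom (f : ∀ A, M.el A → N.el A) (g : ∀ A, N.el A → M.el A) (K : ℝ) (hK : 0 ≤ K)
    (hf : ∀ A m, ‖f A m‖ ≤ K * ‖m‖)
    (h : ∀ A B (m : M.el A) (n : N.el B), N.inner n (f A m) = M.inner (g B n) m)
    {A : C} (m : M.el A) : app (mkHom f g K hK hf h) m = f A m := by
  rw [app, mkHom, LinearEquiv.apply_symm_apply, Opr.app_mk]

lemma hom_ext {S T : Hom M N} (h : ∀ A (m : M.el A), app S m = app T m) : S = T :=
  SHom.linEquiv.injective (Opr.ext h)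

@[simp] lemma app_comp (S : Hom N P) (T : Hom M N) {A : C} (m : M.el A) :
    app (S ⊚ T) m = app S (app T m) := by
  change Opr.app (SHom.linEquiv (SHom.linEquiv.symm _)) m = _
  rw [LinearEquiv.apply_symm_apply]; rfl

lemma inner_app (T : Hom M N) {A B : C} (m : M.el A) (n : N.el B) :
    N.inner n (app T m) = M.inner (app T† n) m := by
  have : SHom.linEquiv (show SHom N M from T†) = Opr.adj (SHom.linEquiv (show SHom M N from T)) :=
    SHom.linEquiv.apply_symm_apply _
  rw [app, app, this, Opr.inner_app]

lemma app_inner (T : Hom M N) {A B : C} (m : M.el A) (n : N.el B) :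
    N.inner (app T m) n = M.inner m (app T† n) := by
  rw [← N.inner_adj, inner_app, M.inner_adj]

lemma adj_unique {T : Hom M N} {S : Hom N M}
    (h : ∀ A B (m : M.el A) (n : N.el B), N.inner n (app T m) = M.inner (app S n) m) :
    T† = S := hom_ext fun A n => HilbMod.ext_inner fun B m => by
  rw [← app_inner, ← N.inner_adj, h, M.inner_adj]

@[simp] lemma add_app (S T : Hom M N) {A : C} (m : M.el A) :
    app (S + T) m = app S m + app T m := by
  have : SHom.linEquiv (show SHom M N from S + T) =
    SHom.linEquiv (show SHom M N from S) + SHom.linEquiv (show SHom M N from T) := map_add _ _ _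
  rw [app, this]; rfl

@[simp] lemma smul_app (c : ℂ) (T : Hom M N) {A : C} (m : M.el A) :
    app (c • T) m = c • app T m := by
  have : SHom.linEquiv (show SHom M N from c • T) =
    c • SHom.linEquiv (show SHom M N from T) := map_smul _ _ _
  rw [app, this]; rfl

@[simp] lemma app_add (T : Hom M N) {A : C} (m m' : M.el A) :
    app T (m + m') = app T m + app T m' := Opr.app_add _ _ _

@[simp] lemma app_smul (T : Hom M N) {A : C} (c : ℂ) (m : M.el A) :
    app T (c • m) = c • app T m := Opr.app_smul _ _ _

@[simp] lemma app_act (T : Hom M N) {A B : C} (m : M.el A) (f : Hom B A) :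
    app T (M.act m f) = N.act (app T m) f := Opr.map_act _ _ _

lemma norm_app_le (T : Hom M N) {A : C} (m : M.el A) : ‖app T m‖ ≤ ‖T‖ * ‖m‖ :=
  Opr.norm_app_le _ m

lemma norm_hom_le {T : Hom M N} {K : ℝ} (hK : 0 ≤ K) (h : ∀ A (m : M.el A), ‖app T m‖ ≤ K * ‖m‖) :
    ‖T‖ ≤ K := Opr.norm_le hK h

/-- Evaluation of a morphism as a continuous linear map. -/
def appL (T : Hom M N) (A : C) : M.el A →L[ℂ] N.el A :=
  LinearMap.mkContinuous ⟨⟨fun m => app T m, app_add T⟩, fun c m => app_smul T c m⟩ ‖T‖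
    (norm_app_le T)

@[simp] lemma appL_apply (T : Hom M N) {A : C} (m : M.el A) : appL T A m = app T m := rfl

@[fun_prop] lemma continuous_app (T : Hom M N) (A : C) :
    Continuous fun m : M.el A => app T m := (appL T A).continuous

/-- The identity operator. -/
def idHom (M : SmallMod C) : Hom M M :=
  mkHom (fun _ m => m) (fun _ m => m) 1 zero_le_one (fun A m => by simp) (fun A B m n => rfl)

@[simp] lemma app_idHom {A : C} (m : M.el A) : app (idHom M) m = m := app_mkHom ..

lemma isId_idHom (M : SmallMod C) : IsId (idHom M) :=
  ⟨fun N f => hom_ext fun A m => by simp, fun N f => hom_ext fun A m => by simp⟩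

end SmallMod
end SmallMod

/-! ### Approximate units -/

section Approx

lemma exists_approx_algebra {A : Type*} [NonUnitalCStarAlgebra A] {p : A}
    (hp : ∃ b, p = star b * b) {δ : ℝ} (hδ : 0 < δ) :
    ∃ s : A, star s = s ∧ s * p = p * s ∧ ‖s * p * s‖ ≤ 1 ∧
      ‖p - s * p * s * p - p * (s * p * s) + s * p * s * p * (s * p * s)‖ ≤ δ := by
  let _ := CStarAlgebra.spectralOrder A
  let _ := CStarAlgebra.spectralOrderedRing A
  have hp0 : 0 ≤ p := CStarAlgebra.nonneg_iff_eq_star_mul_self.2 hp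
  have hsa : IsSelfAdjoint p := IsSelfAdjoint.of_nonneg hp0
  have hε : 0 < δ ^ 2 := by positivity
  let f : ℝ → ℝ := fun t => √(t / (t ^ 2 + δ ^ 2))
  have hf : Continuous f := by
    refine Real.continuous_sqrt.comp (Continuous.div (by fun_prop) (by fun_prop) fun t => ?_)
    positivity
  have hf0 : f 0 = 0 := by simp [f]
  have e1 : p = cfcₙ (fun t : ℝ => t) p := (cfcₙ_id' ℝ p hsa).symm
  have hk : ∀ t : ℝ, 0 ≤ t → f t * t * f t = t ^ 2 / (t ^ 2 + δ ^ 2) := fun t ht0 => by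
    have : f t * f t = t / (t ^ 2 + δ ^ 2) := Real.mul_self_sqrt (by positivity)
    calc f t * t * f t = f t * f t * t := by ring
      _ = _ := by rw [this]; ring
  have hmul : ∀ g h : ℝ → ℝ, Continuous g → Continuous h → g 0 = 0 → h 0 = 0 →
      cfcₙ g p * cfcₙ h p = cfcₙ (fun t => g t * h t) p := fun g h hg hh hg0 hh0 =>
    (cfcₙ_mul g h p hg.continuousOn hg0 hh.continuousOn hh0).symm
  have e2 : cfcₙ f p * p = cfcₙ (fun t => f t * t) p := by
    nth_rw 2 [e1]
    exact hmul _ _ hf continuous_id hf0 rfl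
  have e3 : cfcₙ f p * p * cfcₙ f p = cfcₙ (fun t => f t * t * f t) p := by
    rw [e2]
    exact hmul _ _ (by fun_prop) hf (by simp) hf0
  refine ⟨cfcₙ f p, (cfcₙ_predicate f p).star_eq, ?_, ?_, ?_⟩
  · nth_rw 2 [e1]
    nth_rw 3 [e1]
    exact cfcₙ_commute_cfcₙ _ _ p
  · rw [e3]
    refine norm_cfcₙ_le fun t ht => ?_
    have ht0 : 0 ≤ t := quasispectrum_nonneg_of_nonneg p hp0 t ht
    rw [hk t ht0, Real.norm_of_nonneg (by positivity)]
    exact div_le_one_of_le₀ (by nlinarith) (by positivity)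
  · have e4 : cfcₙ f p * p * cfcₙ f p * p = cfcₙ (fun t => f t * t * f t * t) p := by
      rw [e3]
      nth_rw 2 [e1]
      exact hmul _ _ (by fun_prop) continuous_id (by simp) rfl
    have e5 : p * (cfcₙ f p * p * cfcₙ f p) = cfcₙ (fun t => t * (f t * t * f t)) p := by
      rw [e3]
      nth_rw 1 [e1]
      exact hmul _ _ continuous_id (by fun_prop) rfl (by simp)
    have e6 : cfcₙ f p * p * cfcₙ f p * p * (cfcₙ f p * p * cfcₙ f p) =
        cfcₙ (fun t => f t * t * f t * t * (f t * t * f t)) p := by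
      rw [e4, e3]
      exact hmul _ _ (by fun_prop) (by fun_prop) (by simp) (by simp)
    rw [e6, e5, e4]
    nth_rw 1 [e1]
    rw [← cfcₙ_sub _ _ p (by fun_prop) (by simp) (by fun_prop) (by simp),
      ← cfcₙ_sub _ _ p (by fun_prop) (by simp) (by fun_prop) (by simp),
      ← cfcₙ_add _ _ p (by fun_prop) (by simp) (by fun_prop) (by simp)]
    refine norm_cfcₙ_le fun t ht => ?_
    have ht0 : 0 ≤ t := quasispectrum_nonneg_of_nonneg p hp0 t ht
    have hd : 0 < t ^ 2 + δ ^ 2 := by positivity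
    rw [hk t ht0]
    have : t - t ^ 2 / (t ^ 2 + δ ^ 2) * t - t * (t ^ 2 / (t ^ 2 + δ ^ 2)) +
        t ^ 2 / (t ^ 2 + δ ^ 2) * t * (t ^ 2 / (t ^ 2 + δ ^ 2)) =
        t * δ ^ 4 / (t ^ 2 + δ ^ 2) ^ 2 := by
      field_simp
      ring
    rw [this, Real.norm_of_nonneg (by positivity), div_le_iff₀ (by positivity)]
    have h1 : t * δ ≤ t ^ 2 + δ ^ 2 := by nlinarith [sq_nonneg (t - δ), mul_nonneg ht0 hδ.le]
    have h2 : δ ^ 2 ≤ t ^ 2 + δ ^ 2 := by nlinarith [sq_nonneg t]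
    calc t * δ ^ 4 = δ * ((t * δ) * δ ^ 2) := by ring
      _ ≤ δ * ((t ^ 2 + δ ^ 2) * (t ^ 2 + δ ^ 2)) := by gcongr
      _ = _ := by ring

variable {C : Type u} [CStarCat.{v} C]

/-- For a finite family of morphisms `g j` with common target there is an approximate left unit
of the form `s p s`, where `p = ∑ g j (g j)*`. -/
lemma exists_approx {ι : Type*} [Fintype ι] {X : ι → C} {Y : C} (g : ∀ j, Hom (X j) Y) {δ : ℝ}
    (hδ : 0 < δ) : ∃ s : Hom Y Y, s† = s ∧
      s ⊚ (∑ j, g j ⊚ (g j)†) = (∑ j, g j ⊚ (g j)†) ⊚ s ∧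
      ‖s ⊚ (∑ j, g j ⊚ (g j)†) ⊚ s‖ ≤ 1 ∧
      ∀ j, ‖g j - s ⊚ (∑ j, g j ⊚ (g j)†) ⊚ s ⊚ g j‖ ≤ δ := by
  classical
  have hpj : ∀ j, IsPos (g j ⊚ (g j)†) := fun j => by
    simpa using isPos_adj_comp (g j)†
  obtain ⟨s, hs, hsp, hk1, hle⟩ := exists_approx_algebra (A := Hom Y Y)
    (isPos_sum Finset.univ _ fun j _ => hpj j) (show 0 < δ ^ 2 by positivity)
  refine ⟨s, hs, hsp, by simpa [mul_def] using hk1, fun j => ?_⟩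
  set p := ∑ j, g j ⊚ (g j)† with hp
  set k : Hom Y Y := s ⊚ p ⊚ s with hk
  have hpsa : p† = p := by
    have := (isPos_sum Finset.univ _ fun j _ => hpj j).nonneg
    obtain ⟨b, hb⟩ := isPos_sum Finset.univ _ fun j _ => hpj j
    rw [hp, hb]; simp
  have hs' : s† = s := hs
  have hksa : k† = k := by simp [hk, hs', hpsa]
  -- conjugation by `1 - k` preserves positivity
  have hconj : ∀ a : Hom Y Y, IsPos a → IsPos (a - k ⊚ a - a ⊚ k + k ⊚ a ⊚ k) := by
    rintro _ ⟨b, rfl⟩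
    refine ⟨b - b ⊚ k, ?_⟩
    simp [hksa]
    abel
  have hsum : p = g j ⊚ (g j)† + ∑ i ∈ Finset.univ.erase j, g i ⊚ (g i)† :=
    (Finset.add_sum_erase _ _ (Finset.mem_univ j)).symm
  have h1 := norm_le_norm_add (hconj _ (hpj j))
    (hconj _ (isPos_sum (Finset.univ.erase j) _ fun i _ => hpj i))
  set q := ∑ i ∈ Finset.univ.erase j, g i ⊚ (g i)† with hq
  have h2 : ‖g j - k ⊚ g j‖ ^ 2 = ‖g j ⊚ (g j)† - k ⊚ g j ⊚ (g j)† - (g j ⊚ (g j)†) ⊚ k +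
      k ⊚ (g j ⊚ (g j)†) ⊚ k‖ := by
    rw [norm_sq']
    congr 1
    simp [hksa]
    abel
  have h3 : g j ⊚ (g j)† - k ⊚ g j ⊚ (g j)† - (g j ⊚ (g j)†) ⊚ k + k ⊚ (g j ⊚ (g j)†) ⊚ k +
      (q - k ⊚ q - q ⊚ k + k ⊚ q ⊚ k) = p - k ⊚ p - p ⊚ k + k ⊚ p ⊚ k := by
    rw [hsum]
    simp
    abel
  rw [h3] at h1
  have h4 : ‖p - k ⊚ p - p ⊚ k + k ⊚ p ⊚ k‖ ≤ δ ^ 2 := by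
    convert hle using 2
    simp only [mul_def, hk, comp_assoc]
  have h5 : ‖g j - k ⊚ g j‖ ^ 2 ≤ δ ^ 2 := h2.le.trans (h1.trans h4)
  have h6 := (le_abs_self _).trans (abs_le_of_sq_le_sq h5 hδ.le)
  simpa [hk] using h6

/-- A right approximate unit for a morphism. -/
lemma exists_approx_right {X Y : C} (g : Hom X Y) {δ : ℝ} (hδ : 0 < δ) :
    ∃ e : Hom X X, ‖e‖ ≤ 1 ∧ ‖g - g ⊚ e‖ ≤ δ := by
  obtain ⟨s, hs, -, h1, h⟩ := exists_approx (fun _ : Unit => g†) hδ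
  refine ⟨(s ⊚ (g† ⊚ g) ⊚ s)†, by rw [norm_adj]; simpa using h1, ?_⟩
  have := h ()
  rw [← norm_adj] at this
  simpa [hs] using this

end Approx

/-! ### Functors -/

/-- A `*`-functor between `C*`-categories. -/
structure CFunctor (C : Type u₁) [CStarCat.{v} C] (D : Type u₂) [CStarCat.{v} D] where
  obj : C → D
  map : ∀ {X Y : C}, Hom X Y → Hom (obj X) (obj Y)
  map_add : ∀ {X Y : C} (f g : Hom X Y), map (f + g) = map f + map g
  map_smul : ∀ {X Y : C} (c : ℂ) (f : Hom X Y), map (c • f) = c • map f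
  map_comp : ∀ {X Y Z : C} (g : Hom Y Z) (f : Hom X Y), map (g ⊚ f) = map g ⊚ map f
  map_adj : ∀ {X Y : C} (f : Hom X Y), map f† = (map f)†

attribute [simp] CFunctor.map_add CFunctor.map_smul CFunctor.map_comp CFunctor.map_adj

namespace CFunctor

variable {C : Type u₁} [CStarCat.{v} C] {D : Type u₂} [CStarCat.{v} D]
variable {E : Type u₃} [CStarCat.{v} E] (F : CFunctor C D)

/-- The effect of a `*`-functor on the endomorphisms of an object. -/
def mapEnd (X : C) : Hom X X →⋆ₙₐ[ℂ] Hom (F.obj X) (F.obj X) where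
  toFun := F.map
  map_smul' := F.map_smul
  map_zero' := by simpa using F.map_smul (0 : ℂ) (0 : Hom X X)
  map_add' := F.map_add
  map_mul' := F.map_comp
  map_star' := F.map_adj

lemma norm_map_le {X Y : C} (f : Hom X Y) : ‖F.map f‖ ≤ ‖f‖ := by
  refine (le_abs_self _).trans (abs_le_of_sq_le_sq ?_ (norm_nonneg f))
  rw [CStarCat.norm_sq, CStarCat.norm_sq, ← map_adj, ← map_comp]
  exact NonUnitalStarAlgHom.norm_apply_le (F.mapEnd X) _

lemma norm_map (hF : ∀ X Y : C, Function.Injective (F.map : Hom X Y → _)) {X Y : C}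
    (f : Hom X Y) : ‖F.map f‖ = ‖f‖ := by
  have h : ‖F.map f‖ ^ 2 = ‖f‖ ^ 2 := by
    rw [CStarCat.norm_sq, CStarCat.norm_sq, ← map_adj, ← map_comp]
    exact NonUnitalStarAlgHom.norm_map (F.mapEnd X) (hF X X) _
  exact (pow_left_inj₀ (norm_nonneg _) (norm_nonneg _) two_ne_zero).1 h

/-- The effect of a `*`-functor on morphisms as a continuous linear map. -/
def mapL (X Y : C) : Hom X Y →L[ℂ] Hom (F.obj X) (F.obj Y) :=
  LinearMap.mkContinuous ⟨⟨F.map, F.map_add⟩, F.map_smul⟩ 1 fun f => by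
    simpa using F.norm_map_le f

@[simp] lemma mapL_apply {X Y : C} (f : Hom X Y) : F.mapL X Y f = F.map f := rfl

@[fun_prop] lemma continuous_map {T : Type*} [TopologicalSpace T] {X Y : C} {f : T → Hom X Y}
    (hf : Continuous f) : Continuous fun t => F.map (f t) := (F.mapL X Y).continuous.comp hf

@[simp] lemma map_zero (X Y : C) : F.map (0 : Hom X Y) = 0 := (F.mapL X Y).map_zero
@[simp] lemma map_sub {X Y : C} (f g : Hom X Y) : F.map (f - g) = F.map f - F.map g :=
  (F.mapL X Y).map_sub f g

lemma map_sum {ι : Type*} {X Y : C} (s : Finset ι) (f : ι → Hom X Y) :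
    F.map (∑ j ∈ s, f j) = ∑ j ∈ s, F.map (f j) := _root_.map_sum (F.mapL X Y) f s

/-- Identity morphisms are sent to identity morphisms. -/
def IsUnital : Prop := ∀ (X : C) (e : Hom X X), IsId e → IsId (F.map e)

/-- Composition of `*`-functors. -/
abbrev comp (G : CFunctor D E) (F : CFunctor C D) : CFunctor C E where
  obj X := G.obj (F.obj X)
  map f := G.map (F.map f)
  map_add := by simp
  map_smul := by simp
  map_comp := by simp
  map_adj := by simp

end CFunctor

/-! ### Representable modules -/

section Yoneda

variable {C : Type u} [CStarCat.{v} C]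

/-- The Hilbert module `Hom (-, A)` represented by an object `A`. -/
def yo (A : C) : SmallMod C where
  el B := Hom B A
  act b f := b ⊚ f
  inner b a := b† ⊚ a
  inner_add := by simp
  inner_smul := by simp
  inner_act := by simp
  inner_adj := by simp
  inner_pos := isPos_adj_comp
  norm_sq := CStarCat.norm_sq
  small := by
    refine ⟨Hom A A, fun _ => A, fun e => e, fun B f => ?_⟩
    rw [Metric.mem_closure_iff]
    intro ε hε
    obtain ⟨e, -, he⟩ := exists_approx_right f† (half_pos hε)
    refine ⟨e† ⊚ f, Submodule.subset_span ⟨e†, f, rfl⟩, ?_⟩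
    rw [dist_eq_norm, ← norm_adj]
    refine lt_of_le_of_lt ?_ (half_lt_self hε)
    simpa using he

/-- A morphism as an element of a representable module. -/
def yoEl {A B : C} (f : Hom B A) : (yo A).el B := f

/-- An element of a representable module as a morphism. -/
def yoHom {A B : C} (m : (yo A).el B) : Hom B A := m

@[simp] lemma yoEl_yoHom {A B : C} (m : (yo A).el B) : yoEl (yoHom m) = m := rfl
@[simp] lemma yoHom_yoEl {A B : C} (f : Hom B A) : yoHom (yoEl f) = f := rfl
lemma yoEl_add {A B : C} (f g : Hom B A) : yoEl (f + g) = yoEl f + yoEl g := rfl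
lemma yoEl_smul {A B : C} (c : ℂ) (f : Hom B A) : yoEl (c • f) = c • yoEl f := rfl
lemma norm_yoEl {A B : C} (f : Hom B A) : ‖yoEl f‖ = ‖f‖ := rfl
lemma norm_yoHom {A B : C} (m : (yo A).el B) : ‖yoHom m‖ = ‖m‖ := rfl
lemma yo_inner {A B D : C} (b : (yo A).el B) (a : (yo A).el D) :
    (yo A).inner b a = (yoHom b)† ⊚ yoHom a := rfl
lemma yo_act {A B D : C} (b : (yo A).el B) (f : Hom D B) : (yo A).act b f = yoEl (yoHom b ⊚ f) := rfl

/-- Two operators from a representable module that agree on all morphisms are equal. -/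
lemma yo_hom_ext {A : C} {M : SmallMod C} {S T : Hom (yo A) M}
    (h : ∀ (B : C) (g : Hom B A), SmallMod.app S (yoEl g) = SmallMod.app T (yoEl g)) : S = T :=
  SmallMod.hom_ext fun B g => h B (yoHom g)

/-- The operator between representable modules given by a morphism. -/
def yoMap {A B : C} (f : Hom A B) : Hom (yo A) (yo B) :=
  SmallMod.mkHom (M := yo A) (N := yo B) (fun _ m => yoEl (f ⊚ yoHom m))
    (fun _ n => yoEl (f† ⊚ yoHom n)) ‖f‖ (norm_nonneg f) (fun _ m => norm_comp_le f (yoHom m))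
    fun D E m n => by
      rw [yo_inner, yo_inner, yoHom_yoEl, yoHom_yoEl, adj_comp, adj_adj, comp_assoc]

lemma app_yoMap {A B D : C} (f : Hom A B) (m : Hom D A) :
    SmallMod.app (yoMap f) (yoEl m) = yoEl (f ⊚ m) := SmallMod.app_mkHom ..

/-- The Yoneda embedding. -/
abbrev yoneda (C : Type u) [CStarCat.{v} C] : CFunctor C (SmallMod C) where
  obj := yo
  map := yoMap
  map_add f g := yo_hom_ext fun _ m => by
    rw [SmallMod.add_app, app_yoMap, app_yoMap, app_yoMap, add_comp, yoEl_add]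
  map_smul c f := yo_hom_ext fun _ m => by
    rw [SmallMod.smul_app, app_yoMap, app_yoMap, smul_comp, yoEl_smul]
  map_comp g f := yo_hom_ext fun _ m => by
    rw [SmallMod.app_comp, app_yoMap, app_yoMap, app_yoMap, comp_assoc]
  map_adj {A B} f := (SmallMod.adj_unique fun D E m n => by
    rw [← yoEl_yoHom m, ← yoEl_yoHom n, app_yoMap, app_yoMap, yo_inner, yo_inner]
    simp only [yoHom_yoEl, adj_comp, adj_adj, comp_assoc]).symm

lemma yoMap_comp {A B D : C} (g : Hom B D) (f : Hom A B) : yoMap (g ⊚ f) = yoMap g ⊚ yoMap f :=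
  (yoneda C).map_comp g f

lemma yoMap_adj {A B : C} (f : Hom A B) : yoMap f† = (yoMap f)† := (yoneda C).map_adj f

/-- The operator `g ↦ a g` from a representable module defined by an element `a`. -/
def ofElem {M : SmallMod C} {A : C} (a : M.el A) : Hom (yo A) M :=
  SmallMod.mkHom (M := yo A) (fun _ g => M.act a (yoHom g)) (fun _ m => yoEl (M.inner a m))
    ‖a‖ (norm_nonneg a) (fun _ g => M.norm_act_le a (yoHom g)) fun D E g m => by
      rw [yo_inner, M.inner_act, yoHom_yoEl, M.inner_adj]

lemma app_ofElem {M : SmallMod C} {A B : C} (a : M.el A) (g : Hom B A) :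
    SmallMod.app (ofElem a) (yoEl g) = M.act a g := SmallMod.app_mkHom ..

lemma app_ofElem_adj {M : SmallMod C} {A B : C} (a : M.el A) (m : M.el B) :
    SmallMod.app (ofElem a)† m = yoEl (M.inner a m) := by
  refine HilbMod.ext_inner fun D g => ?_
  rw [← SmallMod.app_inner, ← yoEl_yoHom g, app_ofElem, yo_inner, M.act_inner]
  rfl

lemma comp_ofElem {M N : SmallMod C} (T : Hom M N) {A : C} (a : M.el A) :
    T ⊚ ofElem a = ofElem (SmallMod.app T a) := yo_hom_ext fun B g => by
  rw [SmallMod.app_comp, app_ofElem, app_ofElem, SmallMod.app_act]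

lemma ofElem_act {M : SmallMod C} {A B : C} (a : M.el A) (f : Hom B A) :
    ofElem a ⊚ yoMap f = ofElem (M.act a f) := yo_hom_ext fun D g => by
  rw [SmallMod.app_comp, app_ofElem, app_yoMap, app_ofElem, M.act_act]

lemma ofElem_adj_comp {M : SmallMod C} {A B : C} (b : M.el B) (a : M.el A) :
    (ofElem b)† ⊚ ofElem a = yoMap (M.inner b a) := yo_hom_ext fun D g => by
  rw [SmallMod.app_comp, app_ofElem, app_ofElem_adj, app_yoMap, M.inner_act]

lemma ofElem_yoEl {A B : C} (f : Hom A B) : ofElem (yoEl f) = yoMap f :=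
  yo_hom_ext fun D m => by rw [app_ofElem, app_yoMap, yo_act, yoHom_yoEl]

lemma yoMap_injective (a b : C) :
    Function.Injective (yoMap : Hom a b → Hom (yo a) (yo b)) := fun f g h => by
  have h2 : f ⊚ (f - g)† = g ⊚ (f - g)† := by
    have := congrArg (fun T => yoHom (SmallMod.app T (yoEl (f - g)†))) h
    simpa only [app_yoMap, yoHom_yoEl] using this
  rw [← sub_eq_zero, ← sub_comp] at h2
  have h3 := norm_sq' (f - g)
  rw [h2, norm_zero] at h3
  exact sub_eq_zero.1 (norm_eq_zero.1 (by simpa using h3))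

lemma norm_yoMap {A B : C} (f : Hom A B) : ‖yoMap f‖ = ‖f‖ :=
  (yoneda C).norm_map yoMap_injective f

lemma norm_ofElem {M : SmallMod C} {A : C} (a : M.el A) : ‖ofElem a‖ = ‖a‖ := by
  have h : ‖ofElem a‖ ^ 2 = ‖a‖ ^ 2 := by
    rw [CStarCat.norm_sq, ofElem_adj_comp, norm_yoMap, M.norm_sq]
  exact (pow_left_inj₀ (norm_nonneg _) (norm_nonneg _) two_ne_zero).1 h

lemma ofElem_add {M : SmallMod C} {A : C} (a b : M.el A) :
    ofElem (a + b) = ofElem a + ofElem b := yo_hom_ext fun D g => by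
  rw [SmallMod.add_app, app_ofElem, app_ofElem, app_ofElem, M.add_act]

lemma ofElem_smul {M : SmallMod C} {A : C} (c : ℂ) (a : M.el A) :
    ofElem (c • a) = c • ofElem a := yo_hom_ext fun D g => by
  rw [SmallMod.smul_app, app_ofElem, app_ofElem, M.smul_act]

end Yoneda

/-! ### Hereditary embeddings and restriction functors -/

section Restriction

variable {D : Type u₁} [CStarCat.{v} D] {C : Type u₂} [CStarCat.{v} C]

/-- `i` embeds `D` in `C` as a hereditary subcategory. -/
structure IsHereditaryEmbedding (i : CFunctor D C) : Prop where
  injective : ∀ a b : D, Function.Injective (i.map : Hom a b → Hom (i.obj a) (i.obj b))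
  hereditary : ∀ {a b c e : D} (f : Hom a b) (g : Hom (i.obj b) (i.obj c)) (h : Hom c e),
    ∃ k : Hom a e, i.map k = i.map h ⊚ g ⊚ i.map f

namespace IsHereditaryEmbedding

variable {i : CFunctor D C}

lemma isClosed_range (hi : IsHereditaryEmbedding i) (a b : D) :
    IsClosed (Set.range (i.map : Hom a b → Hom (i.obj a) (i.obj b))) := by
  have : Isometry (i.mapL a b) :=
    AddMonoidHomClass.isometry_of_norm _ fun f => i.norm_map hi.injective f
  exact this.isClosedEmbedding.isClosed_range

/-- Approximate units. -/
lemma approx {a : D} {X : C} {f : Hom (i.obj a) X} (hf : ∃ d, i.map d = f† ⊚ f) {δ : ℝ}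
    (hδ : 0 < δ) : ∃ e : Hom a a, ‖e‖ ≤ 1 ∧ ‖f - f ⊚ i.map e‖ ≤ δ := by
  obtain ⟨d, hd⟩ := hf
  obtain ⟨e, he, h⟩ := exists_approx_right d (show 0 < δ ^ 2 / 2 by positivity)
  refine ⟨e, he, (le_abs_self _).trans (abs_le_of_sq_le_sq ?_ hδ.le)⟩
  have h1 : (f - f ⊚ i.map e)† ⊚ (f - f ⊚ i.map e) =
      i.map (d - d ⊚ e) - i.map e† ⊚ i.map (d - d ⊚ e) := by
    simp only [CFunctor.map_sub, CFunctor.map_comp, hd]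
    simp
    abel
  rw [CStarCat.norm_sq, h1]
  have h2 := i.norm_map_le (d - d ⊚ e)
  have h3 := i.norm_map_le e†
  rw [norm_adj] at h3
  have h4 : ‖i.map e† ⊚ i.map (d - d ⊚ e)‖ ≤ 1 * (δ ^ 2 / 2) := by
    refine (norm_comp_le _ _).trans ?_
    gcongr
    · exact h3.trans he
    · exact h2.trans h
  calc _ ≤ ‖i.map (d - d ⊚ e)‖ + ‖i.map e† ⊚ i.map (d - d ⊚ e)‖ := norm_sub_le _ _
    _ ≤ δ ^ 2 / 2 + 1 * (δ ^ 2 / 2) := add_le_add (h2.trans h) h4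
    _ = δ ^ 2 := by ring

/-- A morphism with square in the subcategory is a limit of products. -/
lemma mem_closure {a : D} {X : C} {f : Hom (i.obj a) X} (hf : ∃ d, i.map d = f† ⊚ f) :
    f ∈ closure (Set.range fun e : Hom a a => f ⊚ i.map e) := by
  rw [Metric.mem_closure_iff]
  intro ε hε
  obtain ⟨e, -, he⟩ := approx hf (half_pos hε)
  exact ⟨_, ⟨e, rfl⟩, by rw [dist_eq_norm]; exact lt_of_le_of_lt he (half_lt_self hε)⟩

lemma exists_inner (hi : IsHereditaryEmbedding i) {a b : D} {X Y : C}
    {f : Hom (i.obj a) X} {g : Hom (i.obj b) Y}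
    (hf : ∃ d, i.map d = f† ⊚ f) (hg : ∃ d, i.map d = g† ⊚ g) (T : Hom X Y) :
    ∃ d : Hom a b, i.map d = g† ⊚ T ⊚ f := by
  have h := map_mem_closure₂ (f := fun (f : Hom (i.obj a) X) (g : Hom (i.obj b) Y) => g† ⊚ T ⊚ f)
    (u := Set.range (i.map : Hom a b → _)) (by fun_prop) (mem_closure hf) (mem_closure hg) (by
      rintro _ ⟨e, rfl⟩ _ ⟨e', rfl⟩
      obtain ⟨k, hk⟩ := hi.hereditary e (g† ⊚ T ⊚ f) e'†
      exact ⟨k, by rw [hk]; simp⟩)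
  rwa [(hi.isClosed_range a b).closure_eq] at h

lemma exists_inner' (hi : IsHereditaryEmbedding i) {a b : D} {X : C}
    {f : Hom (i.obj a) X} {g : Hom (i.obj b) X}
    (hf : ∃ d, i.map d = f† ⊚ f) (hg : ∃ d, i.map d = g† ⊚ g) :
    ∃ d : Hom a b, i.map d = g† ⊚ f := by
  have h := map_mem_closure₂ (f := fun (f : Hom (i.obj a) X) (g : Hom (i.obj b) X) => g† ⊚ f)
    (u := Set.range (i.map : Hom a b → _)) (by fun_prop) (mem_closure hf) (mem_closure hg) (by
      rintro _ ⟨e, rfl⟩ _ ⟨e', rfl⟩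
      obtain ⟨k, hk⟩ := hi.hereditary e (g† ⊚ f) e'†
      exact ⟨k, by rw [hk]; simp⟩)
  rwa [(hi.isClosed_range a b).closure_eq] at h

lemma exists_comp (hi : IsHereditaryEmbedding i) {a : D} {X Y : C} {f : Hom (i.obj a) X}
    (hf : ∃ d, i.map d = f† ⊚ f)
    (T : Hom X Y) : ∃ d, i.map d = (T ⊚ f)† ⊚ T ⊚ f := by
  obtain ⟨d, hd⟩ := hi.exists_inner hf hf (T† ⊚ T)
  exact ⟨d, by rw [hd]; simp⟩

variable (hi : IsHereditaryEmbedding i)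

/-- The space of morphisms `f : i a → X` such that `f* f` belongs to the subcategory. -/
def resSpace (X : C) (a : D) : Submodule ℂ (Hom (i.obj a) X) where
  carrier := {f | ∃ d, i.map d = f† ⊚ f}
  zero_mem' := ⟨0, by simp⟩
  add_mem' := by
    intro f g hf hg
    obtain ⟨d₁, h₁⟩ := hf
    obtain ⟨d₂, h₂⟩ := hg
    obtain ⟨d₃, h₃⟩ := hi.exists_inner' ⟨d₁, h₁⟩ ⟨d₂, h₂⟩
    refine ⟨d₁ + d₂ + d₃ + d₃†, ?_⟩
    simp [h₁, h₂, h₃]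
    abel
  smul_mem' := by
    rintro c f ⟨d, h⟩
    exact ⟨c • star c • d, by simp [h]⟩

lemma isClosed_resSpace (X : C) (a : D) : IsClosed (hi.resSpace X a : Set (Hom (i.obj a) X)) :=
  (hi.isClosed_range a a).preimage (f := fun f : Hom (i.obj a) X => f† ⊚ f) (by fun_prop)

/-- The inner product of two elements of the restriction. -/
def resInner {X : C} {a b : D} (g : hi.resSpace X b) (f : hi.resSpace X a) : Hom a b :=
  (hi.exists_inner' f.2 g.2).choose

lemma map_resInner {X : C} {a b : D} (g : hi.resSpace X b) (f : hi.resSpace X a) :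
    i.map (hi.resInner g f) = g.1† ⊚ f.1 := (hi.exists_inner' f.2 g.2).choose_spec

@[simp] lemma resInner_add {X : C} {a b : D} (g : hi.resSpace X b) (f f' : hi.resSpace X a) :
    hi.resInner g (f + f') = hi.resInner g f + hi.resInner g f' :=
  hi.injective _ _ (by simp [map_resInner])

@[simp] lemma resInner_smul {X : C} {a b : D} (c : ℂ) (g : hi.resSpace X b)
    (f : hi.resSpace X a) : hi.resInner g (c • f) = c • hi.resInner g f :=
  hi.injective _ _ (by simp [map_resInner])

lemma resInner_pos {X : C} {a : D} (f : hi.resSpace X a) : IsPos (hi.resInner f f) := by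
  refine exists_eq_star_mul_self (A := Hom a a) ?_ fun c x hc hx => ?_
  · exact hi.injective _ _ (by rw [star_def]; simp [map_resInner])
  · have hc' : c† = c := hc
    have h1 : i.map ((c ⊚ hi.resInner f f) ⊚ c) = i.map (-(x† ⊚ x)) := congrArg i.map hx
    have h2 : i.map (-(x† ⊚ x)) = -((i.map x)† ⊚ i.map x) := by
      simpa using i.map_sub 0 (x† ⊚ x)
    have h3 : i.map ((c ⊚ hi.resInner f f) ⊚ c) = (f.1 ⊚ i.map c)† ⊚ f.1 ⊚ i.map c := by
      have h6 : (i.map c)† = i.map c := by rw [← i.map_adj, hc']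
      simp [map_resInner, h6]
    rw [h2, h3] at h1
    have h4 := eq_zero_of_isPos_neg (isPos_adj_comp (i.map x))
      (by rw [← h1]; exact isPos_adj_comp _)
    have h5 := CStarCat.norm_sq (i.map x)
    rw [h4, norm_zero, i.norm_map hi.injective] at h5
    exact norm_eq_zero.1 (by simpa using h5)

lemma norm_sq_resInner {X : C} {a : D} (f : hi.resSpace X a) : ‖f‖ ^ 2 = ‖hi.resInner f f‖ := by
  rw [← i.norm_map hi.injective, map_resInner, ← CStarCat.norm_sq]; rfl

/-- The action of the subcategory on the restriction. -/
def resAct {X : C} {a b : D} (f : hi.resSpace X a) (g : Hom b a) : hi.resSpace X b :=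
  ⟨f.1 ⊚ i.map g, by
    obtain ⟨d, hd⟩ := f.2
    exact ⟨g† ⊚ d ⊚ g, by simp [hd]⟩⟩

@[simp] lemma resInner_act {X : C} {a b c : D} (g : hi.resSpace X b) (f : hi.resSpace X a)
    (h : Hom c a) : hi.resInner g (hi.resAct f h) = hi.resInner g f ⊚ h :=
  hi.injective _ _ (by simp [map_resInner, resAct])

lemma resInner_adj {X : C} {a b : D} (f : hi.resSpace X a) (g : hi.resSpace X b) :
    (hi.resInner g f)† = hi.resInner f g :=
  hi.injective _ _ (by simp [map_resInner])

lemma dense_resSpace (X : C) : ∃ (K : Type v) (s : K → D) (e : ∀ x, hi.resSpace X (s x)), ∀ a : D,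
    Dense (Submodule.span ℂ {f : hi.resSpace X a | ∃ (x : K) (g : Hom a (s x)),
      f = hi.resAct (e x) g} : Set (hi.resSpace X a)) := by
  refine ⟨{k : Hom X X // ∃ (a : D) (h : hi.resSpace X a), k = h.1 ⊚ h.1†},
    fun k => k.2.choose, fun k => k.2.choose_spec.choose, fun a h => ?_⟩
  rw [Metric.mem_closure_iff]
  intro ε hε
  obtain ⟨s, hs, hsp, -, hle⟩ := exists_approx (fun _ : Unit => h.1) (half_pos hε)
  simp only [Finset.univ_unique, Finset.sum_const, Finset.card_singleton, one_smul] at hs hsp hle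
  let k : {k : Hom X X // ∃ (a : D) (h : hi.resSpace X a), k = h.1 ⊚ h.1†} := ⟨_, a, h, rfl⟩
  have hk : h.1 ⊚ h.1† = k.2.choose_spec.choose.1 ⊚ k.2.choose_spec.choose.1† :=
    k.2.choose_spec.choose_spec
  obtain ⟨d, hd⟩ := hi.exists_inner h.2 k.2.choose_spec.choose.2 (s ⊚ s)
  refine ⟨_, Submodule.subset_span ⟨k, d, rfl⟩, ?_⟩
  rw [dist_eq_norm]
  refine lt_of_le_of_lt (le_of_eq_of_le ?_ (hle ())) (half_lt_self hε)
  change ‖h.1 - k.2.choose_spec.choose.1 ⊚ i.map d‖ = _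
  rw [hd, ← comp_assoc, ← hk]
  congr 2
  rw [← comp_assoc s, hsp]
  simp

/-- The restriction of an object of `C` to a Hilbert module over `D`. -/
def res (X : C) : SmallMod D where
  el a := hi.resSpace X a
  completeSpace a := (hi.isClosed_resSpace X a).completeSpace_coe
  act f g := hi.resAct f g
  inner g f := hi.resInner g f
  inner_add g f f' := hi.resInner_add g f f'
  inner_smul c g f := hi.resInner_smul c g f
  inner_act g f h := hi.resInner_act g f h
  inner_adj g f := hi.resInner_adj g f
  inner_pos f := hi.resInner_pos f
  norm_sq f := hi.norm_sq_resInner f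
  small := hi.dense_resSpace X

/-- A morphism `f : i a → X` with `f* f` in `D`, as an element of the restriction of `X`. -/
def resEl {X : C} {a : D} (f : Hom (i.obj a) X) (hf : ∃ d, i.map d = f† ⊚ f) : (hi.res X).el a :=
  (⟨f, hf⟩ : hi.resSpace X a)

/-- An element of the restriction of `X` as a morphism. -/
def resHom {X : C} {a : D} (m : (hi.res X).el a) : Hom (i.obj a) X := (show hi.resSpace X a from m).1

lemma resHom_mem {X : C} {a : D} (m : (hi.res X).el a) :
    ∃ d, i.map d = (hi.resHom m)† ⊚ hi.resHom m := (show hi.resSpace X a from m).2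

@[simp] lemma resHom_resEl {X : C} {a : D} (f : Hom (i.obj a) X)
    (hf : ∃ d, i.map d = f† ⊚ f) : hi.resHom (hi.resEl f hf) = f := rfl

lemma resHom_injective {X : C} {a : D} {m m' : (hi.res X).el a}
    (h : hi.resHom m = hi.resHom m') : m = m' := Subtype.ext h

lemma norm_resHom {X : C} {a : D} (m : (hi.res X).el a) : ‖hi.resHom m‖ = ‖m‖ := rfl

lemma resHom_add {X : C} {a : D} (m m' : (hi.res X).el a) :
    hi.resHom (m + m') = hi.resHom m + hi.resHom m' := rfl

lemma resHom_smul {X : C} {a : D} (c : ℂ) (m : (hi.res X).el a) :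
    hi.resHom (c • m) = c • hi.resHom m := rfl

lemma resHom_act {X : C} {a b : D} (m : (hi.res X).el a) (f : Hom b a) :
    hi.resHom ((hi.res X).act m f) = hi.resHom m ⊚ i.map f := rfl

lemma map_inner_res {X : C} {a b : D} (m : (hi.res X).el a) (m' : (hi.res X).el b) :
    i.map ((hi.res X).inner m' m) = (hi.resHom m')† ⊚ hi.resHom m := hi.map_resInner _ _

/-- The effect of the restriction functor on morphisms. -/
def resMap {X Y : C} (T : Hom X Y) : Hom (hi.res X) (hi.res Y) :=
  SmallMod.mkHom (fun _ m => hi.resEl (T ⊚ hi.resHom m) (hi.exists_comp (hi.resHom_mem m) T))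
    (fun _ n => hi.resEl (T† ⊚ hi.resHom n) (hi.exists_comp (hi.resHom_mem n) T†))
    ‖T‖ (norm_nonneg T) (fun _ m => norm_comp_le T (hi.resHom m))
    (fun _ _ m n => hi.injective _ _ (by
      rw [map_inner_res, map_inner_res, resHom_resEl, resHom_resEl, adj_comp, adj_adj, comp_assoc]))

lemma resHom_app_resMap {X Y : C} (T : Hom X Y) {a : D} (m : (hi.res X).el a) :
    hi.resHom (SmallMod.app (hi.resMap T) m) = T ⊚ hi.resHom m :=
  congrArg hi.resHom (SmallMod.app_mkHom ..)

/-- The restriction functor. -/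
abbrev resFunctor : CFunctor C (SmallMod D) where
  obj := hi.res
  map T := hi.resMap T
  map_add S T := SmallMod.hom_ext fun A m => hi.resHom_injective (by
    rw [SmallMod.add_app, resHom_add]
    simp only [resHom_app_resMap, add_comp])
  map_smul c S := SmallMod.hom_ext fun A m => hi.resHom_injective (by
    rw [SmallMod.smul_app, resHom_smul]
    simp only [resHom_app_resMap, smul_comp])
  map_comp S T := SmallMod.hom_ext fun A m => hi.resHom_injective (by
    rw [SmallMod.app_comp]
    simp only [resHom_app_resMap, comp_assoc])
  map_adj T := (SmallMod.adj_unique fun A B m n => hi.injective _ _ (by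
    rw [map_inner_res, map_inner_res]
    simp only [resHom_app_resMap, adj_comp, adj_adj, comp_assoc])).symm

end IsHereditaryEmbedding
end Restriction

/-! ### Completion of pre-Hilbert modules -/

/-- A family of vector spaces with a right action and a semi-definite inner product. -/
structure PreMod (C : Type u) [CStarCat.{v} C] where
  el : C → Type v
  [addCommGroup : ∀ A, AddCommGroup (el A)]
  [module : ∀ A, Module ℂ (el A)]
  act : ∀ {A B : C}, Hom B A → el A →ₗ[ℂ] el B
  inner : ∀ {A B : C}, el B → el A → Hom A B
  inner_add : ∀ {A B : C} (b : el B) (a a' : el A), inner b (a + a') = inner b a + inner b a'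
  inner_smul : ∀ {A B : C} (c : ℂ) (b : el B) (a : el A), inner b (c • a) = c • inner b a
  inner_act : ∀ {A B D : C} (b : el B) (a : el A) (f : Hom D A),
    inner b (act f a) = inner b a ⊚ f
  inner_adj : ∀ {A B : C} (a : el A) (b : el B), (inner b a)† = inner a b
  inner_pos : ∀ {A : C} (a : el A), IsPos (inner a a)

namespace PreMod

attribute [local instance] PreMod.addCommGroup PreMod.module

variable {C : Type u} [CStarCat.{v} C] (P : PreMod C)

lemma add_inner {A B : C} (b b' : P.el B) (a : P.el A) :
    P.inner (b + b') a = P.inner b a + P.inner b' a := by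
  rw [← P.inner_adj, P.inner_add, adj_add, P.inner_adj, P.inner_adj]

lemma smul_inner {A B : C} (c : ℂ) (b : P.el B) (a : P.el A) :
    P.inner (c • b) a = star c • P.inner b a := by
  rw [← P.inner_adj, P.inner_smul, adj_smul, P.inner_adj]

lemma act_inner {A B D : C} (b : P.el B) (a : P.el A) (f : Hom D B) :
    P.inner (P.act f b) a = f† ⊚ P.inner b a := by
  rw [← P.inner_adj, P.inner_act, adj_comp, P.inner_adj]

lemma norm_inner_le_sqrt {A B : C} (b : P.el B) (a : P.el A) :
    ‖P.inner b a‖ ≤ √‖P.inner b b‖ * √‖P.inner a a‖ := by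
  have h1 := norm_sq_cross_le (V := P.el A) (fun x y => P.inner x y) (fun x f => P.act f x)
    P.inner_add P.inner_smul P.inner_act (fun a b => P.inner_adj b a) P.inner_pos
    (x := P.act (P.inner b a) b) (a := a) (z := P.inner b a) (β := P.inner b b)
    (by rw [P.inner_act, P.act_inner, comp_assoc]) (by rw [P.act_inner])
  rw [← Real.sqrt_mul (norm_nonneg _)]
  exact Real.le_sqrt_of_sq_le h1

lemma core (A : C) : @SeminormedSpace.Core ℂ (P.el A) _ _ ⟨fun a => √‖P.inner a a‖⟩ _ :=
  letI : Norm (P.el A) := ⟨fun a => √‖P.inner a a‖⟩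
  { norm_nonneg := fun a => Real.sqrt_nonneg _
    norm_smul := fun c a => by
      change √‖P.inner (c • a) (c • a)‖ = ‖c‖ * √‖P.inner a a‖
      rw [P.inner_smul, P.smul_inner, norm_smul, norm_smul, norm_star, ← mul_assoc, ← sq,
        Real.sqrt_mul (by positivity), Real.sqrt_sq (norm_nonneg _)]
    norm_triangle := fun a b => by
      change √‖P.inner (a + b) (a + b)‖ ≤ √‖P.inner a a‖ + √‖P.inner b b‖
      refine Real.sqrt_le_iff.2 ⟨by positivity, ?_⟩
      rw [P.inner_add, P.add_inner, P.add_inner]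
      have h1 := P.norm_inner_le_sqrt a b
      have h2 := P.norm_inner_le_sqrt b a
      have h3 := Real.sq_sqrt (norm_nonneg (P.inner a a))
      have h4 := Real.sq_sqrt (norm_nonneg (P.inner b b))
      calc _ ≤ (‖P.inner a a‖ + ‖P.inner b a‖) + (‖P.inner a b‖ + ‖P.inner b b‖) :=
            (norm_add_le _ _).trans (add_le_add (norm_add_le _ _) (norm_add_le _ _))
        _ ≤ _ := by nlinarith }

/-- The seminorm given by the inner product. -/
instance seminormed (A : C) : SeminormedAddCommGroup (P.el A) :=
  letI : Norm (P.el A) := ⟨fun a => √‖P.inner a a‖⟩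
  SeminormedAddCommGroup.ofCore (P.core A)

instance normed (A : C) : NormedSpace ℂ (P.el A) where
  norm_smul_le c a := ((P.core A).norm_smul c a).le

lemma norm_def {A : C} (a : P.el A) : ‖a‖ = √‖P.inner a a‖ := rfl

lemma norm_sq {A : C} (a : P.el A) : ‖a‖ ^ 2 = ‖P.inner a a‖ := Real.sq_sqrt (norm_nonneg _)

lemma norm_inner_le {A B : C} (b : P.el B) (a : P.el A) : ‖P.inner b a‖ ≤ ‖b‖ * ‖a‖ :=
  P.norm_inner_le_sqrt b a

open UniformSpace

/-- The inner product as a biadditive map. -/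
def innerAdd (A B : C) : P.el B →+ P.el A →+ Hom A B :=
  AddMonoidHom.mk' (fun b => AddMonoidHom.mk' (P.inner b) (P.inner_add b)) fun b b' => by
    ext a; exact P.add_inner b b' a

lemma continuous_innerAdd (A B : C) :
    Continuous fun p : P.el B × P.el A => P.innerAdd A B p.1 p.2 := by
  let L : P.el B →L⋆[ℂ] P.el A →L[ℂ] Hom A B := LinearMap.mkContinuous₂
    (LinearMap.mk₂'ₛₗ (starRingEnd ℂ) (RingHom.id ℂ) P.inner P.add_inner
      (fun c b a => P.smul_inner c b a) P.inner_add (fun c b a => P.inner_smul c b a)) 1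
    (fun g f => by simpa using P.norm_inner_le g f)
  have : Continuous fun p : P.el B × P.el A => L p.1 p.2 := by fun_prop
  exact this

/-- The extended inner product. -/
def cInner {A B : C} (b : Completion (P.el B)) (a : Completion (P.el A)) : Hom A B :=
  (((Completion.isDenseInducing_toCompl (P.el B)).prodMap
    (Completion.isDenseInducing_toCompl (P.el A))).extend fun p => P.innerAdd A B p.1 p.2) (b, a)

lemma cInner_coe {A B : C} (b : P.el B) (a : P.el A) :
    P.cInner (b : Completion (P.el B)) (a : Completion (P.el A)) = P.inner b a :=
  ((Completion.isDenseInducing_toCompl (P.el B)).prodMap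
    (Completion.isDenseInducing_toCompl (P.el A))).extend_eq (P.continuous_innerAdd A B) (b, a)

@[fun_prop]
lemma continuous_cInner {T : Type*} [TopologicalSpace T] {A B : C} {b : T → Completion (P.el B)}
    {a : T → Completion (P.el A)} (hb : Continuous b) (ha : Continuous a) :
    Continuous fun t => P.cInner (b t) (a t) :=
  ((Completion.isDenseInducing_toCompl (P.el B)).extend_Z_bilin
    (Completion.isDenseInducing_toCompl (P.el A)) (P.continuous_innerAdd A B)).comp
      (hb.prodMk ha)

/-- The action of a morphism as a continuous linear map. -/
def actL {A B : C} (f : Hom B A) : P.el A →L[ℂ] P.el B :=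
  (P.act f).mkContinuous ‖f‖ fun a => by
    rw [P.norm_def, P.norm_def]
    refine Real.sqrt_le_iff.2 ⟨by positivity, ?_⟩
    rw [mul_pow, Real.sq_sqrt (norm_nonneg _), P.inner_act, P.act_inner, comp_assoc]
    refine (CStarCat.norm_comp_le _ _).trans ?_
    rw [norm_adj, sq, mul_assoc, mul_comm ‖f‖ ‖P.inner a a‖]
    gcongr
    exact CStarCat.norm_comp_le _ _

/-- The extended action. -/
def cAct {A B : C} (a : Completion (P.el A)) (f : Hom B A) : Completion (P.el B) :=
  Completion.map (P.actL f) a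

lemma cAct_coe {A B : C} (a : P.el A) (f : Hom B A) :
    P.cAct (a : Completion (P.el A)) f = (P.act f a : P.el B) :=
  Completion.map_coe (P.actL f).uniformContinuous a

@[fun_prop]
lemma continuous_cAct {T : Type*} [TopologicalSpace T] {A B : C} {a : T → Completion (P.el A)}
    (f : Hom B A) (ha : Continuous a) : Continuous fun t => P.cAct (a t) f :=
  Completion.continuous_map.comp ha

lemma cInner_add {A B : C} (b : Completion (P.el B)) (a a' : Completion (P.el A)) :
    P.cInner b (a + a') = P.cInner b a + P.cInner b a' := by
  induction b, a, a' using Completion.induction_on₃ with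
  | hp => exact isClosed_eq (by fun_prop) (by fun_prop)
  | ih b a a' => rw [← Completion.coe_add]; simp only [cInner_coe, P.inner_add]

lemma cInner_smul {A B : C} (c : ℂ) (b : Completion (P.el B)) (a : Completion (P.el A)) :
    P.cInner b (c • a) = c • P.cInner b a := by
  induction b, a using Completion.induction_on₂ with
  | hp =>
    exact isClosed_eq (P.continuous_cInner continuous_fst (continuous_snd.const_smul c))
      ((P.continuous_cInner continuous_fst continuous_snd).const_smul c)
  | ih b a => rw [← Completion.coe_smul]; simp only [cInner_coe, P.inner_smul]

lemma cInner_cAct {A B D : C} (b : Completion (P.el B)) (a : Completion (P.el A)) (f : Hom D A) :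
    P.cInner b (P.cAct a f) = P.cInner b a ⊚ f := by
  induction b, a using Completion.induction_on₂ with
  | hp => exact isClosed_eq (by fun_prop) (by fun_prop)
  | ih b a => simp only [cAct_coe, cInner_coe, P.inner_act]

lemma cInner_adj {A B : C} (a : Completion (P.el A)) (b : Completion (P.el B)) :
    (P.cInner b a)† = P.cInner a b := by
  induction b, a using Completion.induction_on₂ with
  | hp => exact isClosed_eq (by fun_prop) (by fun_prop)
  | ih b a => simp only [cInner_coe, P.inner_adj]

lemma cInner_pos {A : C} (a : Completion (P.el A)) : IsPos (P.cInner a a) := by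
  induction a using Completion.induction_on with
  | hp => exact (isClosed_isPos _).preimage (by fun_prop)
  | ih a => rw [cInner_coe]; exact P.inner_pos a

lemma norm_sq_cInner {A : C} (a : Completion (P.el A)) : ‖a‖ ^ 2 = ‖P.cInner a a‖ := by
  induction a using Completion.induction_on with
  | hp => exact isClosed_eq (by fun_prop) (by fun_prop)
  | ih a => rw [cInner_coe, Completion.norm_coe, P.norm_sq]

/-- The completion of a pre-Hilbert module. -/
abbrev completion : HilbMod C where
  el A := Completion (P.el A)
  act a f := P.cAct a f
  inner b a := P.cInner b a
  inner_add := P.cInner_add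
  inner_smul := P.cInner_smul
  inner_act := P.cInner_cAct
  inner_adj := P.cInner_adj
  inner_pos := P.cInner_pos
  norm_sq := P.norm_sq_cInner

/-- The canonical map to the completion. -/
def toCompl (A : C) : P.el A →ₗ[ℂ] P.completion.el A :=
  (Completion.toComplL (𝕜 := ℂ) (E := P.el A)).toLinearMap

lemma denseRange_toCompl (A : C) : DenseRange (P.toCompl A) :=
  Completion.denseRange_coe

lemma inner_toCompl {A B : C} (b : P.el B) (a : P.el A) :
    P.completion.inner (P.toCompl B b) (P.toCompl A a) = P.inner b a := P.cInner_coe b a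

end PreMod

/-! ### Extension of Hilbert modules along a functor -/

section Extension

/-- A square root of `‖t‖² - t* t`. -/
lemma exists_sqrt_norm_sq_sub {A : Type*} [NonUnitalCStarAlgebra A] {e : A}
    (he : ∀ x, e * x = x) (he' : ∀ x, x * e = x) (t : A) :
    ∃ r : A, (‖t‖ ^ 2) • e - star t * t = star r * r := by
  let _ := CStarAlgebra.spectralOrder A
  let _ := CStarAlgebra.spectralOrderedRing A
  set a := star t * t with ha
  have ha0 : 0 ≤ a := star_mul_self_nonneg t
  have hsa : IsSelfAdjoint a := IsSelfAdjoint.of_nonneg ha0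
  have hest : star e = e := by
    have h1 := he (star e)
    have h2 := congrArg star h1
    rw [star_mul, star_star, h1] at h2
    exact h2
  set K := ‖t‖ with hK
  have hK0 : 0 ≤ K := norm_nonneg t
  let h : ℝ → ℝ := fun x => √(K ^ 2 - x) - K
  have hh : Continuous h := by fun_prop
  have hh0 : h 0 = 0 := by simp [h, Real.sqrt_sq hK0]
  have hs : star (cfcₙ h a) = cfcₙ h a := (cfcₙ_predicate h a).star_eq
  have hmul : cfcₙ h a * cfcₙ h a = cfcₙ (fun x => h x * h x) a :=
    (cfcₙ_mul h h a hh.continuousOn hh0 hh.continuousOn hh0).symm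
  have hsum : (2 * K) • cfcₙ h a + cfcₙ (fun x => h x * h x) a = -a := by
    rw [← cfcₙ_smul (2 * K) h a hh.continuousOn hh0,
      ← cfcₙ_add _ _ a (by fun_prop) (by simp [hh0]) (by fun_prop) (by simp [hh0])]
    have e1 : -a = cfcₙ (fun x : ℝ => -x) a := by
      rw [cfcₙ_neg (fun x : ℝ => x) a, cfcₙ_id' ℝ a hsa]
    rw [e1]
    refine cfcₙ_congr fun x hx => ?_
    have hx1 : ‖x‖ ≤ ‖a‖ :=
      NonUnitalIsometricContinuousFunctionalCalculus.norm_quasispectrum_le a hx hsa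
    rw [ha, CStarRing.norm_star_mul_self, ← sq] at hx1
    have hx2 : 0 ≤ K ^ 2 - x := sub_nonneg.2 ((le_abs_self x).trans hx1)
    have h3 := Real.sq_sqrt hx2
    simp only [h, smul_eq_mul]
    nlinarith
  refine ⟨K • e + cfcₙ h a, ?_⟩
  rw [star_add, star_smul, hest, hs, star_trivial, add_mul, mul_add, mul_add, smul_mul_smul_comm,
    he, smul_mul_assoc, he, mul_smul_comm, he', hmul, add_assoc, ← add_assoc (K • cfcₙ h a),
    ← add_smul, ← two_mul, hsum, ← sq, sub_eq_add_neg]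

variable {D : Type u₁} [CStarCat.{v} D] {C : Type u₂} [CStarCat.{v} C]

lemma exists_sqrt_operator {M N : SmallMod D} (T : Hom M N) :
    ∃ R : Hom M M, ∀ (a b : D) (m : M.el a) (m' : M.el b),
      (‖T‖ ^ 2) • M.inner m' m - N.inner (SmallMod.app T m') (SmallMod.app T m) =
        M.inner (SmallMod.app R m') (SmallMod.app R m) := by
  obtain ⟨b, hb⟩ := CStarCat.pos T
  have hn : ‖b‖ ^ 2 = ‖T‖ ^ 2 := by rw [CStarCat.norm_sq, CStarCat.norm_sq, hb]
  obtain ⟨R, hR⟩ := exists_sqrt_norm_sq_sub (A := Hom M M) (e := SmallMod.idHom M)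
    (fun x => (SmallMod.isId_idHom M).2 M x) (fun x => (SmallMod.isId_idHom M).1 M x) b
  refine ⟨R, fun x y m m' => ?_⟩
  have h1 : ((‖T‖ ^ 2 : ℝ) : ℂ) • SmallMod.idHom M - T† ⊚ T = R† ⊚ R := by
    rw [hb, ← hn]; exact hR
  have h2 := congrArg (fun S => M.inner m' (SmallMod.app S m)) (sub_eq_iff_eq_add.1 h1)
  simp only [SmallMod.smul_app, SmallMod.add_app, SmallMod.app_comp, SmallMod.app_idHom,
    M.inner_smul, M.inner_add] at h2
  rw [← SmallMod.app_inner, ← SmallMod.app_inner] at h2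
  exact sub_eq_iff_eq_add.2 h2

lemma comp_sum {ι : Type*} {X Y Z : C} (s : Finset ι) (g : Hom Y Z) (f : ι → Hom X Y) :
    g ⊚ (∑ j ∈ s, f j) = ∑ j ∈ s, g ⊚ f j := map_sum (compL X Y Z g) f s

lemma sum_comp {ι : Type*} {X Y Z : C} (s : Finset ι) (g : ι → Hom Y Z) (f : Hom X Y) :
    (∑ j ∈ s, g j) ⊚ f = ∑ j ∈ s, g j ⊚ f := map_sum ((compL X Y Z).flip f) g s

lemma adj_sum {ι : Type*} {X Y : C} (s : Finset ι) (f : ι → Hom X Y) :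
    (∑ j ∈ s, f j)† = ∑ j ∈ s, (f j)† := map_sum (adjL X Y) f s

lemma app_sum {ι : Type*} {M N : SmallMod D} (s : Finset ι) (T : ι → Hom M N) {a : D}
    (m : M.el a) : SmallMod.app (∑ j ∈ s, T j) m = ∑ j ∈ s, SmallMod.app (T j) m :=
  map_sum (AddMonoidHom.mk' (fun T : Hom M N => SmallMod.app T m)
    fun S T => SmallMod.add_app S T m) T s

/-- Positivity of the matrix `f ⟨m k, m j⟩`. -/
lemma isPos_gram (f : CFunctor D C) (M : SmallMod D) {ι : Type*} [Fintype ι] (b : ι → D)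
    (m : ∀ j, M.el (b j)) {A : C} (g : ∀ j, Hom A (f.obj (b j))) :
    IsPos (∑ k, ∑ j, (g k)† ⊚ f.map (M.inner (m k) (m j)) ⊚ g j) := by
  let Φ : (∀ j, M.el (b j)) → Hom A A := fun x =>
    ∑ k, ∑ j, (g k)† ⊚ f.map (M.inner (m k) (x j)) ⊚ g j
  have hΦ : Continuous Φ := by fun_prop
  refine closure_minimal (s := {x | IsPos (Φ x)} ∩ Set.univ) (t := {x | IsPos (Φ x)})
    (fun x hx => hx.1) ((isClosed_isPos A).preimage hΦ) ?_
  rw [Metric.mem_closure_iff]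
  intro ε hε
  obtain ⟨s, hs, -, -, hle⟩ := exists_approx (fun j => ofElem (m j)) (half_pos hε)
  set p := ∑ j, ofElem (m j) ⊚ (ofElem (m j))† with hp
  refine ⟨fun j => SmallMod.app (s ⊚ p ⊚ s) (m j), ⟨?_, trivial⟩, ?_⟩
  · have happ : ∀ {d : D} (y : M.el d), SmallMod.app p y = ∑ l, M.act (m l) (M.inner (m l) y) := by
      intro d y
      rw [hp, app_sum]
      exact Finset.sum_congr rfl fun l _ => by
        rw [SmallMod.app_comp, app_ofElem_adj, app_ofElem]
    have key : ∀ k j, M.inner (m k) (SmallMod.app (s ⊚ p ⊚ s) (m j)) =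
        ∑ l, (M.inner (m l) (SmallMod.app s (m k)))† ⊚ M.inner (m l) (SmallMod.app s (m j)) := by
      intro k j
      rw [SmallMod.app_comp, SmallMod.app_comp, SmallMod.inner_app, hs, happ,
        ← HilbMod.innerL_apply, map_sum]
      exact Finset.sum_congr rfl fun l _ => by
        rw [HilbMod.innerL_apply, M.inner_act, M.inner_adj]
    have : Φ (fun j => SmallMod.app (s ⊚ p ⊚ s) (m j)) =
        ∑ l, (∑ k, f.map (M.inner (m l) (SmallMod.app s (m k))) ⊚ g k)† ⊚
          (∑ j, f.map (M.inner (m l) (SmallMod.app s (m j))) ⊚ g j) := by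
      change ∑ k, ∑ j, (g k)† ⊚ f.map (M.inner (m k) (SmallMod.app (s ⊚ p ⊚ s) (m j))) ⊚ g j = _
      simp only [key, f.map_sum, comp_sum, sum_comp, adj_sum, f.map_comp, f.map_adj, adj_comp,
        comp_assoc]
      rw [Finset.sum_comm]
      conv_rhs => rw [Finset.sum_comm]
      refine Finset.sum_congr rfl fun j _ => ?_
      rw [Finset.sum_comm]
    change IsPos (Φ _)
    rw [this]
    exact isPos_sum _ _ fun l _ => isPos_adj_comp _
  · refine lt_of_le_of_lt ((dist_pi_le_iff (half_pos hε).le).2 fun j => ?_) (half_lt_self hε)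
    rw [dist_eq_norm, ← norm_ofElem]
    refine le_of_eq_of_le ?_ (hle j)
    have h1 : ∀ x y : M.el (b j), ofElem (x - y) = ofElem x - ofElem y := fun x y => by
      rw [eq_sub_iff_add_eq, ← ofElem_add, sub_add_cancel]
    rw [h1, ← comp_ofElem, comp_assoc, comp_assoc]

/-- An extension of a Hilbert module `M` over `D` along a functor `f` from `D` to `C`: a Hilbert
module over `C` generated by a copy of `M`. -/
structure Extension (f : CFunctor D C) (M : SmallMod D) where
  mod : SmallMod C
  incl : ∀ b : D, M.el b →ₗ[ℂ] mod.el (f.obj b)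
  inner_incl : ∀ {b b' : D} (m : M.el b) (m' : M.el b'),
    mod.inner (incl b' m') (incl b m) = f.map (M.inner m' m)
  dense : ∀ A : C, Dense (Submodule.span ℂ {y : mod.el A | ∃ (b : D) (m : M.el b)
    (g : Hom A (f.obj b)), y = mod.act (incl b m) g} : Set (mod.el A))

section Construct

variable (f : CFunctor D C) (M : SmallMod D) {K : Type v} (s : K → D) (e : ∀ x, M.el (s x))

/-- The free vector space on symbols `(x, g)` that stand for `e x · g`. -/
abbrev ExtSp (A : C) : Type v := ((x : K) × Hom A (f.obj (s x))) →₀ ℂ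

/-- The inner product on symbols. -/
def extInner {A B : C} (q : ExtSp f s B) : ExtSp f s A →ₗ[ℂ] Hom A B :=
  Finsupp.linearCombination ℂ fun j => q.sum fun i c =>
    star c • (i.2† ⊚ f.map (M.inner (e i.1) (e j.1)) ⊚ j.2)

lemma extInner_act {A B E : C} (q : ExtSp f s B) (p : ExtSp f s A) (h : Hom E A) :
    extInner f M s e q (Finsupp.lmapDomain ℂ ℂ (fun p => ⟨p.1, p.2 ⊚ h⟩) p) =
      extInner f M s e q p ⊚ h := by
  rw [extInner, extInner, Finsupp.lmapDomain_apply, Finsupp.linearCombination_mapDomain]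
  simp only [Finsupp.linearCombination_apply, Finsupp.sum, sum_comp, Function.comp_def,
    smul_comp, comp_assoc]

lemma extInner_adj {A B : C} (p : ExtSp f s A) (q : ExtSp f s B) :
    (extInner f M s e q p)† = extInner f M s e p q := by
  simp only [extInner, Finsupp.linearCombination_apply, Finsupp.sum, adj_sum, adj_smul,
    Finset.smul_sum, adj_comp, adj_adj, ← f.map_adj, M.inner_adj, comp_assoc]
  rw [Finset.sum_comm]
  refine Finset.sum_congr rfl fun i _ => Finset.sum_congr rfl fun j _ => ?_
  rw [star_star, smul_comm]

lemma extInner_pos {A : C} (p : ExtSp f s A) : IsPos (extInner f M s e p p) := by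
  have h := isPos_gram f M (fun j : p.support => s j.1.1) (fun j => e j.1.1)
    (fun j => p j.1 • j.1.2)
  convert h using 1
  simp only [extInner, Finsupp.linearCombination_apply, Finsupp.sum, Finset.smul_sum]
  rw [Finset.sum_comm, ← Finset.sum_coe_sort]
  refine Finset.sum_congr rfl fun i _ => ?_
  rw [← Finset.sum_coe_sort]
  refine Finset.sum_congr rfl fun j _ => ?_
  rw [adj_smul, smul_comp, comp_smul, comp_smul, smul_comm]

/-- The algebraic part of the extension of a Hilbert module along a functor `f`, built on
elements `e x` over the objects `s x`. -/
def preExt : PreMod C where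
  el A := ExtSp f s A
  act h := Finsupp.lmapDomain ℂ ℂ fun p => ⟨p.1, p.2 ⊚ h⟩
  inner q p := extInner f M s e q p
  inner_add q p p' := map_add (extInner f M s e q) p p'
  inner_smul c q p := map_smul (extInner f M s e q) c p
  inner_act q p h := extInner_act f M s e q p h
  inner_adj p q := extInner_adj f M s e p q
  inner_pos p := extInner_pos f M s e p

/-- The completed extension. -/
def extMod : HilbMod C := (preExt f M s e).completion

/-- The canonical map from the free vector space to the completed extension. -/
def extMap (A : C) : ExtSp f s A →ₗ[ℂ] (extMod f M s e).el A := (preExt f M s e).toCompl A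

lemma denseRange_extMap (A : C) : DenseRange (extMap f M s e A) :=
  (preExt f M s e).denseRange_toCompl A

lemma inner_extMap {A B : C} (q : ExtSp f s B) (p : ExtSp f s A) :
    (extMod f M s e).inner (extMap f M s e B q) (extMap f M s e A p) = extInner f M s e q p :=
  (preExt f M s e).inner_toCompl q p

/-- The generators of the extension. -/
def extGen {A : C} (x : K) (g : Hom A (f.obj (s x))) : (extMod f M s e).el A :=
  extMap f M s e A (Finsupp.single ⟨x, g⟩ 1)

lemma inner_extGen {A B : C} (x y : K) (g : Hom A (f.obj (s x))) (h : Hom B (f.obj (s y))) :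
    (extMod f M s e).inner (extGen f M s e y h) (extGen f M s e x g) =
      h† ⊚ f.map (M.inner (e y) (e x)) ⊚ g := by
  rw [extGen, extGen, inner_extMap, extInner, Finsupp.linearCombination_single, one_smul,
    Finsupp.sum_single_index]
  · simp
  · simp

lemma dense_extGen (A : C) : Dense (Submodule.span ℂ
    {y : (extMod f M s e).el A | ∃ (x : K) (g : Hom A (f.obj (s x))),
      y = extGen f M s e x g} : Set ((extMod f M s e).el A)) := by
  refine Dense.mono ?_ (denseRange_extMap f M s e A)
  rintro _ ⟨p, rfl⟩
  induction p using Finsupp.induction_linear with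
  | zero => rw [map_zero]; exact Submodule.zero_mem _
  | add p q hp hq => rw [map_add]; exact Submodule.add_mem _ hp hq
  | single i c =>
    rw [← mul_one c, ← smul_eq_mul, ← Finsupp.smul_single, map_smul]
    exact Submodule.smul_mem _ _ (Submodule.subset_span ⟨i.1, i.2, rfl⟩)

/-- Two elements with the same inner products with the generators are equal. -/
lemma ext_extGen {A : C} {a a' : (extMod f M s e).el A}
    (h : ∀ (B : C) (y : K) (g : Hom B (f.obj (s y))),
      (extMod f M s e).inner (extGen f M s e y g) a =
        (extMod f M s e).inner (extGen f M s e y g) a') : a = a' := by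
  refine HilbMod.ext_inner fun B b => ?_
  have := ContinuousLinearMap.ext_on (f := (extMod f M s e).innerL A B |>.flip a)
    (g := (extMod f M s e).innerL A B |>.flip a') (dense_extGen f M s e B) (by
      rintro _ ⟨y, g, rfl⟩
      exact h B y g)
  exact congrArg (fun F => F b) this

/-- The elements `e x` generate `M`. -/
abbrev Generates : Prop := ∀ b : D, Dense (Submodule.span ℂ
  {m : M.el b | ∃ (x : K) (g : Hom b (s x)), m = M.act (e x) g} : Set (M.el b))

/-- The finite combinations of generators of `M`. -/
def genMap (b : D) : (((x : K) × Hom b (s x)) →₀ ℂ) →ₗ[ℂ] M.el b :=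
  Finsupp.linearCombination ℂ fun p => M.act (e p.1) p.2

/-- The copies in the extension of the finite combinations of generators of `M`. -/
def genMap' (b : D) : (((x : K) × Hom b (s x)) →₀ ℂ) →ₗ[ℂ] (extMod f M s e).el (f.obj b) :=
  Finsupp.linearCombination ℂ fun p => extGen f M s e p.1 (f.map p.2)

lemma denseRange_genMap (he : Generates M s e) (b : D) : DenseRange (genMap M s e b) := by
  have h1 : Set.range (genMap M s e b) = (Submodule.span ℂ
      {m : M.el b | ∃ (x : K) (g : Hom b (s x)), m = M.act (e x) g} : Set (M.el b)) := by
    rw [← LinearMap.coe_range, genMap, Finsupp.range_linearCombination]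
    congr 2
    ext m
    constructor
    · rintro ⟨p, rfl⟩; exact ⟨p.1, p.2, rfl⟩
    · rintro ⟨x, g, rfl⟩; exact ⟨⟨x, g⟩, rfl⟩
  rw [DenseRange, h1]
  exact he b

lemma inner_genMap' {b b' : D} (q : ((x : K) × Hom b' (s x)) →₀ ℂ)
    (p : ((x : K) × Hom b (s x)) →₀ ℂ) :
    (extMod f M s e).inner (genMap' f M s e b' q) (genMap' f M s e b p) =
      f.map (M.inner (genMap M s e b' q) (genMap M s e b p)) := by
  induction q using Finsupp.induction_linear with
  | zero => simp
  | add q q' h h' => simp [h, h']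
  | single i c =>
    induction p using Finsupp.induction_linear with
    | zero => simp
    | add q q' h h' => simp [h, h']
    | single j d => simp [genMap, genMap', inner_extGen]

lemma norm_genMap'_le (b : D) (p : ((x : K) × Hom b (s x)) →₀ ℂ) :
    ‖genMap' f M s e b p‖ ≤ 1 * ‖genMap M s e b p‖ := by
  rw [one_mul]
  refine (le_abs_self _).trans (abs_le_of_sq_le_sq ?_ (norm_nonneg _))
  rw [HilbMod.norm_sq, HilbMod.norm_sq, inner_genMap']
  exact f.norm_map_le _

/-- The inclusion of `M` in the extension. -/
def extIncl (b : D) : M.el b →L[ℂ] (extMod f M s e).el (f.obj b) :=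
  (genMap' f M s e b).extendOfNorm (genMap M s e b)

lemma extIncl_genMap (he : Generates M s e) (b : D) (p : ((x : K) × Hom b (s x)) →₀ ℂ) :
    extIncl f M s e b (genMap M s e b p) = genMap' f M s e b p :=
  LinearMap.extendOfNorm_eq (denseRange_genMap M s e he b) ⟨1, norm_genMap'_le f M s e b⟩ p

lemma inner_extIncl (he : Generates M s e) {b b' : D} (m : M.el b) (m' : M.el b') :
    (extMod f M s e).inner (extIncl f M s e b' m') (extIncl f M s e b m) =
      f.map (M.inner m' m) := by
  have h1 := denseRange_genMap M s e he b
  have h2 := denseRange_genMap M s e he b'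
  refine h1.induction_on (p := fun m => (extMod f M s e).inner (extIncl f M s e b' m')
    (extIncl f M s e b m) = f.map (M.inner m' m)) m (isClosed_eq (by fun_prop) (by fun_prop))
    fun p => ?_
  refine h2.induction_on (p := fun m' => (extMod f M s e).inner (extIncl f M s e b' m')
    (extIncl f M s e b (genMap M s e b p)) = f.map (M.inner m' (genMap M s e b p))) m'
    (isClosed_eq (by fun_prop) (by fun_prop)) fun q => ?_
  rw [extIncl_genMap _ _ _ _ he, extIncl_genMap _ _ _ _ he, inner_genMap']

lemma inner_extGen_extIncl (he : Generates M s e) {B : C} {b : D} (y : K) (g : Hom B (f.obj (s y))) (m : M.el b) :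
    (extMod f M s e).inner (extGen f M s e y g) (extIncl f M s e b m) =
      g† ⊚ f.map (M.inner (e y) m) := by
  have h1 := denseRange_genMap M s e he b
  refine h1.induction_on (p := fun m => (extMod f M s e).inner (extGen f M s e y g)
    (extIncl f M s e b m) = g† ⊚ f.map (M.inner (e y) m)) m
    (isClosed_eq (by fun_prop) (by fun_prop)) fun p => ?_
  rw [extIncl_genMap _ _ _ _ he]
  induction p using Finsupp.induction_linear with
  | zero => simp
  | add q q' h h' => simp [h, h']
  | single j d => simp [genMap, genMap', inner_extGen]

lemma act_extIncl (he : Generates M s e) {A : C} (x : K) (g : Hom A (f.obj (s x))) :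
    (extMod f M s e).act (extIncl f M s e (s x) (e x)) g = extGen f M s e x g :=
  ext_extGen f M s e fun B y h => by
    rw [HilbMod.inner_act, inner_extGen_extIncl _ _ _ _ he, inner_extGen, comp_assoc]

end Construct

/-- The extension of a Hilbert module along a functor. -/
def extension (f : CFunctor D C) (M : SmallMod D) : Extension f M :=
  let e := M.small.choose_spec.choose_spec.choose
  let he := M.small.choose_spec.choose_spec.choose_spec
  { mod :=
      { extMod f M _ e with
        small := ⟨M.small.choose, fun x => f.obj (M.small.choose_spec.choose x),
          fun x => extIncl f M _ e _ (e x), fun A => by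
            simp only [act_extIncl f M _ e he]
            exact dense_extGen f M _ e A⟩ }
    incl := fun b => (extIncl f M _ e b).toLinearMap
    inner_incl := fun m m' => inner_extIncl f M _ e he m m'
    dense := fun A => by
      refine Dense.mono (Submodule.span_mono ?_) (dense_extGen f M _ e A)
      rintro _ ⟨x, g, rfl⟩
      exact ⟨_, e x, g, (act_extIncl f M _ e he x g).symm⟩ }

end Extension

section ExtensionFunctor

variable {D : Type u₁} [CStarCat.{v} D] {C : Type u₂} [CStarCat.{v} C]

namespace Extension

variable {f : CFunctor D C} {M N P : SmallMod D}

lemma _root_.CStarCat.HilbMod.ext_act {X : HilbMod C} {A : C} {x y : X.el A}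
    (h : ∀ (B : C) (g : Hom B A), X.act x g = X.act y g) : x = y := by
  refine HilbMod.ext_inner fun B b => ?_
  have h1 : (X.inner b x - X.inner b y) ⊚ (X.inner b x - X.inner b y)† = 0 := by
    rw [sub_comp, ← X.inner_act, ← X.inner_act, h, sub_self]
  have h2 := norm_sq' (X.inner b x - X.inner b y)
  rw [h1, norm_zero] at h2
  exact sub_eq_zero.1 (norm_eq_zero.1 (by simpa using h2))

/-- Two morphisms from an extension that agree on the generators are equal. -/
lemma hom_ext (E : Extension f M) {X : SmallMod C} {S T : Hom E.mod X}
    (h : ∀ (b : D) (m : M.el b), SmallMod.app S (E.incl b m) = SmallMod.app T (E.incl b m)) :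
    S = T := by
  refine SmallMod.hom_ext fun A y => ?_
  have := ContinuousLinearMap.ext_on (f := SmallMod.appL S A) (g := SmallMod.appL T A)
    (E.dense A) (by
      rintro _ ⟨b, m, g, rfl⟩
      simp [h])
  exact congrArg (fun F => F y) this

/-- The finite sums `∑ T m · g` in an extension, for an operator `T`. -/
def sumMap (E' : Extension f N) (T : Hom M N) (A : C) :
    (((b : D) × M.el b × Hom A (f.obj b)) →₀ ℂ) →ₗ[ℂ] E'.mod.el A :=
  Finsupp.linearCombination ℂ fun p => E'.mod.act (E'.incl p.1 (SmallMod.app T p.2.1)) p.2.2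

lemma denseRange_sumMap (E : Extension f M) (A : C) :
    DenseRange (E.sumMap (SmallMod.idHom M) A) := by
  have h1 : Set.range (E.sumMap (SmallMod.idHom M) A) = (Submodule.span ℂ {y : E.mod.el A |
      ∃ (b : D) (m : M.el b) (g : Hom A (f.obj b)), y = E.mod.act (E.incl b m) g} :
      Set (E.mod.el A)) := by
    rw [← LinearMap.coe_range, sumMap, Finsupp.range_linearCombination]
    congr 2
    ext y
    constructor
    · rintro ⟨p, rfl⟩; exact ⟨p.1, p.2.1, p.2.2, by simp⟩
    · rintro ⟨b, m, g, rfl⟩; exact ⟨⟨b, m, g⟩, by simp⟩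
  rw [DenseRange, h1]
  exact E.dense A

lemma norm_sumMap_le (E : Extension f M) (E' : Extension f N) (T : Hom M N) (A : C)
    (p : ((b : D) × M.el b × Hom A (f.obj b)) →₀ ℂ) :
    ‖E'.sumMap T A p‖ ≤ ‖T‖ * ‖E.sumMap (SmallMod.idHom M) A p‖ := by
  obtain ⟨R, hR⟩ := exists_sqrt_operator T
  have h1 : ∀ p q : ((b : D) × M.el b × Hom A (f.obj b)) →₀ ℂ,
      ((‖T‖ ^ 2 : ℝ) : ℂ) • E.mod.inner (E.sumMap (SmallMod.idHom M) A q)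
          (E.sumMap (SmallMod.idHom M) A p) =
        E'.mod.inner (E'.sumMap T A q) (E'.sumMap T A p) +
          E.mod.inner (E.sumMap R A q) (E.sumMap R A p) := by
    intro p q
    induction q using Finsupp.induction_linear with
    | zero => simp
    | add q q' h h' => simp only [map_add, HilbMod.add_inner, smul_add, h, h']; abel
    | single i c =>
      induction p using Finsupp.induction_linear with
      | zero => simp
      | add q q' h h' => simp only [map_add, HilbMod.inner_add, smul_add, h, h']; abel
      | single j d =>
        have h2 := hR j.1 i.1 j.2.1 i.2.1
        have h3 : ((‖T‖ ^ 2 : ℝ) : ℂ) • M.inner i.2.1 j.2.1 =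
          N.inner (SmallMod.app T i.2.1) (SmallMod.app T j.2.1) +
            M.inner (SmallMod.app R i.2.1) (SmallMod.app R j.2.1) := by
          rw [add_comm]; exact sub_eq_iff_eq_add.1 h2
        have h4 := congrArg f.map h3
        simp only [CFunctor.map_add, CFunctor.map_smul] at h4
        have h5 := congrArg (fun F => d • star c • i.2.2† ⊚ F ⊚ j.2.2) h4
        simp only [smul_comp, comp_smul, add_comp, comp_add] at h5
        simp only [sumMap, Finsupp.linearCombination_single, HilbMod.smul_inner,
          HilbMod.inner_smul, HilbMod.act_inner, HilbMod.inner_act, SmallMod.app_idHom,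
          inner_incl]
        simp only [smul_comp, comp_assoc, ← smul_add]
        rw [← h5]
        module
  have h2 := h1 p p
  have h3 := norm_le_norm_add (E'.mod.inner_pos (E'.sumMap T A p))
    (E.mod.inner_pos (E.sumMap R A p))
  rw [← h2, norm_smul, ← HilbMod.norm_sq, ← HilbMod.norm_sq] at h3
  refine (le_abs_self _).trans (abs_le_of_sq_le_sq ?_ (by positivity))
  rw [mul_pow]
  simpa using h3

lemma inner_sumMap (E : Extension f M) (E' : Extension f N) (T : Hom M N) {A B : C}
    (p : ((b : D) × M.el b × Hom A (f.obj b)) →₀ ℂ)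
    (q : ((b : D) × N.el b × Hom B (f.obj b)) →₀ ℂ) :
    E'.mod.inner (E'.sumMap (SmallMod.idHom N) B q) (E'.sumMap T A p) =
      E.mod.inner (E.sumMap T† B q) (E.sumMap (SmallMod.idHom M) A p) := by
  induction q using Finsupp.induction_linear with
  | zero => simp
  | add q q' h h' => simp [h, h']
  | single i c =>
    induction p using Finsupp.induction_linear with
    | zero => simp
    | add q q' h h' => simp [h, h']
    | single j d => simp [sumMap, inner_incl, SmallMod.inner_app]

lemma inner_extend (E : Extension f M) (E' : Extension f N) (T : Hom M N) {A B : C}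
    (y : E.mod.el A) (z : E'.mod.el B) :
    E'.mod.inner z ((E'.sumMap T A).extendOfNorm (E.sumMap (SmallMod.idHom M) A) y) =
      E.mod.inner ((E.sumMap T† B).extendOfNorm (E'.sumMap (SmallMod.idHom N) B) z) y := by
  refine (E.denseRange_sumMap A).induction_on y
    (isClosed_eq (by fun_prop) (by fun_prop)) fun p => ?_
  refine (E'.denseRange_sumMap B).induction_on z
    (isClosed_eq (by fun_prop) (by fun_prop)) fun q => ?_
  rw [LinearMap.extendOfNorm_eq (E.denseRange_sumMap A) ⟨_, E.norm_sumMap_le E' T A⟩,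
    LinearMap.extendOfNorm_eq (E'.denseRange_sumMap B) ⟨_, E'.norm_sumMap_le E T† B⟩,
    inner_sumMap]

/-- The operator between extensions induced by an operator. -/
def map (E : Extension f M) (E' : Extension f N) (T : Hom M N) : Hom E.mod E'.mod :=
  SmallMod.mkHom
    (fun A => (E'.sumMap T A).extendOfNorm (E.sumMap (SmallMod.idHom M) A))
    (fun A => (E.sumMap T† A).extendOfNorm (E'.sumMap (SmallMod.idHom N) A))
    ‖T‖ (norm_nonneg T)
    (fun A => LinearMap.norm_extendOfNorm_apply_le (E.denseRange_sumMap A) _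
      (E.norm_sumMap_le E' T A))
    (fun _ _ y z => E.inner_extend E' T y z)

lemma adj_map (E : Extension f M) (E' : Extension f N) (T : Hom M N) :
    (E.map E' T)† = E'.map E T† :=
  SmallMod.adj_unique fun A B y z => by
    rw [map, map, SmallMod.app_mkHom, SmallMod.app_mkHom, inner_extend]

lemma app_map (E : Extension f M) (E' : Extension f N) (T : Hom M N) {b : D} (m : M.el b) :
    SmallMod.app (E.map E' T) (E.incl b m) = E'.incl b (SmallMod.app T m) := by
  refine HilbMod.ext_act fun A g => ?_
  have h1 := LinearMap.extendOfNorm_eq (E.denseRange_sumMap A) ⟨_, E.norm_sumMap_le E' T A⟩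
    (Finsupp.single ⟨b, m, g⟩ 1)
  rw [← SmallMod.app_act, map, SmallMod.app_mkHom]
  simpa [sumMap] using h1

end Extension

/-- The functor `H f` from Hilbert modules over `D` to Hilbert modules over `C` induced by a
functor `f`. -/
abbrev extFunctor (f : CFunctor D C) : CFunctor (SmallMod D) (SmallMod C) where
  obj M := (extension f M).mod
  map T := (extension f _).map (extension f _) T
  map_add S T := Extension.hom_ext _ fun b m => by simp [Extension.app_map]
  map_smul c T := Extension.hom_ext _ fun b m => by simp [Extension.app_map]
  map_comp S T := Extension.hom_ext _ fun b m => by simp [Extension.app_map]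
  map_adj T := (Extension.adj_map _ _ T).symm

end ExtensionFunctor

/-! ### Pre-complete categories -/

section PreComplete

/-- A unitary (isometric) isomorphism. -/
def IsUnitary {C : Type u} [CStarCat.{v} C] {X Y : C} (t : Hom X Y) : Prop :=
  IsId (t† ⊚ t) ∧ IsId (t ⊚ t†)

namespace CFunctor

variable {C : Type u₁} [CStarCat.{v} C] {D : Type u₂} [CStarCat.{v} D]

/-- A natural unitary isomorphism between two `*`-functors. -/
structure IsNaturalUnitary (F G : CFunctor C D) (t : ∀ X, Hom (F.obj X) (G.obj X)) : Prop where
  unitary : ∀ X, IsUnitary (t X)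
  natural : ∀ {X Y : C} (f : Hom X Y), t Y ⊚ F.map f = G.map f ⊚ t X

/-- The identity functor. -/
abbrev id (C : Type u) [CStarCat.{v} C] : CFunctor C C where
  obj X := X
  map f := f
  map_add _ _ := rfl
  map_smul _ _ := rfl
  map_comp _ _ := rfl
  map_adj _ := rfl

/-- An equivalence of `C*`-categories: a fully faithful and essentially surjective `*`-functor. -/
structure IsEquivalence (F : CFunctor C D) : Prop where
  bijective : ∀ X Y : C, Function.Bijective (F.map : Hom X Y → Hom (F.obj X) (F.obj Y))
  essSurj : ∀ Z : D, ∃ (X : C) (t : Hom (F.obj X) Z), IsUnitary t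

end CFunctor

/-- A pre-complete `C*`-category: a unital `C*`-category `C` with a unital `*`-functor `L` from the
Hilbert modules over `C` to `C` and a natural unitary isomorphism `η` from the identity of `C` to
the restriction of `L` along the Yoneda embedding. -/
structure PreComplete (C : Type u) [CStarCat.{v} C] where
  exists_id : ∀ X : C, ∃ e : Hom X X, IsId e
  L : CFunctor (SmallMod C) C
  isUnital_L : L.IsUnital
  η : ∀ X : C, Hom X (L.obj (yo X))
  isNaturalUnitary_η : CFunctor.IsNaturalUnitary (CFunctor.id C) (L.comp (yoneda C)) η

/-- A functor `F` between pre-complete `C*`-categories is continuous if it is unital and commutes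
with the functors `L`, up to a natural unitary isomorphism which is the canonical one on
representable modules. -/
def PreComplete.IsContinuous {C : Type u₁} [CStarCat.{v} C] {C' : Type u₂} [CStarCat.{v} C']
    (P : PreComplete C) (P' : PreComplete C') (F : CFunctor C C') : Prop :=
  F.IsUnital ∧ ∃ θ : ∀ M : SmallMod C, Hom (P'.L.obj ((extFunctor F).obj M)) (F.obj (P.L.obj M)),
    CFunctor.IsNaturalUnitary (P'.L.comp (extFunctor F)) (F.comp P.L) θ ∧
    ∀ (X : C) (e : Hom X X), IsId e →
      θ (yo X) ⊚ P'.L.map (ofElem ((extension F (yo X)).incl X (yoEl e))) ⊚ P'.η (F.obj X) =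
        F.map (P.η X)

variable {C : Type u} [CStarCat.{v} C]

/-- A hereditary subalgebra `B` of the endomorphisms of `X`: a closed self-adjoint subalgebra such
that `B C(X) B` is contained in `B`. -/
structure HereditarySubalgebra (X : C) extends Submodule ℂ (Hom X X) where
  isClosed : IsClosed carrier
  adj_mem : ∀ {a : Hom X X}, a ∈ carrier → a† ∈ carrier
  comp_mem : ∀ {a b : Hom X X}, a ∈ carrier → b ∈ carrier → a ⊚ b ∈ carrier
  hereditary : ∀ {a b : Hom X X} (f : Hom X X), a ∈ carrier → b ∈ carrier → a ⊚ f ⊚ b ∈ carrier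

namespace HereditarySubalgebra

variable {X : C} (B : HereditarySubalgebra X)

/-- The closed span of the morphisms `a h : A → X` with `a` in `B`. -/
def space (A : C) : Submodule ℂ (Hom A X) :=
  (Submodule.span ℂ {g | ∃ a ∈ B.carrier, ∃ h : Hom A X, g = a ⊚ h}).topologicalClosure

lemma isClosed_space (A : C) : IsClosed (B.space A : Set (Hom A X)) :=
  Submodule.isClosed_topologicalClosure _

lemma comp_mem_space {A A' : C} {g : Hom A X} (hg : g ∈ B.space A) (f : Hom A' A) :
    g ⊚ f ∈ B.space A' := by
  let T : Hom A X →L[ℂ] Hom A' X := (compL A' A X).flip f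
  have h1 : Submodule.span ℂ {g | ∃ a ∈ B.carrier, ∃ h : Hom A X, g = a ⊚ h} ≤
      (B.space A').comap T.toLinearMap := by
    refine Submodule.span_le.2 ?_
    rintro _ ⟨a, ha, h, rfl⟩
    exact subset_closure (Submodule.subset_span ⟨a, ha, h ⊚ f, comp_assoc a h f⟩)
  have h2 : B.space A ≤ (B.space A').comap T.toLinearMap :=
    Submodule.topologicalClosure_minimal _ h1 ((B.isClosed_space A').preimage T.continuous)
  exact h2 hg

lemma mem_space {a : Hom X X} (ha : a ∈ B.carrier) : a ∈ B.space X := by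
  refine Metric.mem_closure_iff.2 fun ε hε => ?_
  obtain ⟨e, -, he⟩ := exists_approx_right a (half_pos hε)
  refine ⟨a ⊚ e, Submodule.subset_span ⟨a, ha, e, rfl⟩, ?_⟩
  rw [dist_eq_norm]
  exact lt_of_le_of_lt he (half_lt_self hε)

/-- The submodule `B X` of the module represented by `X`. -/
def mod : SmallMod C where
  el A := B.space A
  completeSpace A := (B.isClosed_space A).completeSpace_coe
  act g f := ⟨g.1 ⊚ f, B.comp_mem_space g.2 f⟩
  inner h g := h.1† ⊚ g.1
  inner_add h g g' := comp_add _ _ _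
  inner_smul c h g := comp_smul _ _ _
  inner_act h g f := (comp_assoc _ _ _).symm
  inner_adj h g := by simp
  inner_pos g := isPos_adj_comp g.1
  norm_sq g := CStarCat.norm_sq g.1
  small := by
    refine ⟨B.carrier, fun _ => X, fun a => ⟨a.1, B.mem_space a.2⟩, fun A g => ?_⟩
    refine Metric.mem_closure_iff.2 fun ε hε => ?_
    obtain ⟨y, hy, hd⟩ := Metric.mem_closure_iff.1 g.2 ε hε
    have h1 : Submodule.span ℂ {g | ∃ a ∈ B.carrier, ∃ h : Hom A X, g = a ⊚ h} ≤
        (Submodule.span ℂ {g : B.space A | ∃ (a : B.carrier) (h : Hom A X),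
          g = ⟨a.1 ⊚ h, B.comp_mem_space (B.mem_space a.2) h⟩}).map (B.space A).subtype := by
      refine Submodule.span_le.2 ?_
      rintro _ ⟨a, ha, h, rfl⟩
      exact ⟨⟨a ⊚ h, B.comp_mem_space (B.mem_space ha) h⟩,
        Submodule.subset_span ⟨⟨a, ha⟩, h, rfl⟩, rfl⟩
    obtain ⟨z, hz, rfl⟩ := h1 hy
    exact ⟨z, hz, hd⟩

/-- An element of the closed span, as an element of the submodule `B X`. -/
def toMod {A : C} (g : B.space A) : B.mod.el A := g

/-- Weak density of a hereditary subalgebra `B`: there is a unitary isomorphism from `L (B X)` to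
`X` compatible with the inclusions of `B X` in both objects. -/
def IsWeaklyDense (P : PreComplete C) : Prop :=
  ∃ t : Hom (P.L.obj B.mod) X, IsUnitary t ∧
    ∀ (A : C) (g : B.space A), t ⊚ P.L.map (ofElem (B.toMod g)) ⊚ P.η A = g.1

end HereditarySubalgebra

/-- Absolutely compact morphisms. -/
def PreComplete.IsAbsolutelyCompact (P : PreComplete C) {X Y : C} (k : Hom X Y) : Prop :=
  ∀ (Z : C) (h₁ : Hom Z X) (h₂ : Hom Z Y) (B : HereditarySubalgebra Z), B.IsWeaklyDense P →
    h₂† ⊚ k ⊚ h₁ ∈ B.carrier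

/-- A hereditary subcategory is generating if every object `Y` of `C` is naturally the colimit of
its restriction, compatibly with the morphisms that belong to the restriction of `Y`. -/
def IsHereditaryEmbedding.IsGenerating {D : Type u₁} [CStarCat.{v} D] {i : CFunctor D C}
    (hi : IsHereditaryEmbedding i) (P : PreComplete C) : Prop :=
  ∃ μ : ∀ Y : C, Hom Y (P.L.obj ((extFunctor i).obj (hi.res Y))),
    CFunctor.IsNaturalUnitary (CFunctor.id C) (P.L.comp ((extFunctor i).comp hi.resFunctor)) μ ∧
    ∀ (Y : C) (a : D) (f : (hi.res Y).el a),
      μ Y ⊚ hi.resHom f = P.L.map (ofElem ((extension i (hi.res Y)).incl a f)) ⊚ P.η (i.obj a)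

end PreComplete

/-! ### The pre-complete category of Hilbert modules -/

section Hilb

variable (D : Type u) [CStarCat.{v} D]

lemma yoMap_adj_comp {C : Type u} [CStarCat.{v} C] {a b c : C} (g : Hom b a) (f : Hom c a) :
    (yoMap g)† ⊚ yoMap f = yoMap (g† ⊚ f) := by
  rw [yoMap_comp, yoMap_adj]

/-- The Yoneda embedding is hereditary. -/
lemma isHereditaryEmbedding_yoneda : IsHereditaryEmbedding (yoneda D) where
  injective := yoMap_injective
  hereditary {a b c e} f g h := by
    refine ⟨h ⊚ yoHom (SmallMod.app g (yoEl f)), ?_⟩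
    rw [CFunctor.map_comp]
    congr 1
    change yoMap _ = g ⊚ yoMap f
    rw [← ofElem_yoEl, ← ofElem_yoEl, comp_ofElem, yoEl_yoHom]

/-- Morphisms between representable modules over a unital category. -/
lemma exists_yoMap_eq {C : Type u} [CStarCat.{v} C] {X Y : C} {e : Hom X X} (he : IsId e)
    (T : Hom (yo X) (yo Y)) : ∃ t : Hom X Y, yoMap t = T := by
  refine ⟨yoHom (SmallMod.app T (yoEl e)), ?_⟩
  rw [← ofElem_yoEl, yoEl_yoHom, ← comp_ofElem, ofElem_yoEl]
  refine yo_hom_ext fun A m => ?_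
  rw [SmallMod.app_comp, app_yoMap, he.2]

/-- The embedding of `D` in the category of Hilbert modules over the category of Hilbert modules
over `D`. -/
abbrev yoneda₂ : CFunctor D (SmallMod (SmallMod D)) := (yoneda (SmallMod D)).comp (yoneda D)

lemma isHereditaryEmbedding_yoneda₂ : IsHereditaryEmbedding (yoneda₂ D) where
  injective a b := (yoMap_injective _ _).comp (yoMap_injective a b)
  hereditary {a b c e} f g h := by
    obtain ⟨t, rfl⟩ := exists_yoMap_eq (SmallMod.isId_idHom (yo b)) g
    obtain ⟨k, hk⟩ := (isHereditaryEmbedding_yoneda D).hereditary f t h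
    refine ⟨k, ?_⟩
    have h1 := congrArg (yoneda (SmallMod D)).map hk
    simpa only [yoMap_comp] using h1

/-- Restriction of the Hilbert modules over the category of Hilbert modules over `D`. -/
abbrev hilbL : CFunctor (SmallMod (SmallMod D)) (SmallMod D) :=
  (isHereditaryEmbedding_yoneda₂ D).resFunctor

variable {D}

lemma exists_yoMap_ofElem {M : SmallMod D} {d : D} (m : M.el d) :
    ∃ k, (yoneda₂ D).map k = (yoMap (ofElem m))† ⊚ yoMap (ofElem m) :=
  ⟨M.inner m m, by rw [yoMap_adj_comp, ofElem_adj_comp]⟩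

/-- The element of the restriction of the module represented by `M` defined by an element
of `M`. -/
def unitEl {M : SmallMod D} {d : D} (m : M.el d) : ((hilbL D).obj (yo M)).el d :=
  (isHereditaryEmbedding_yoneda₂ D).resEl (yoMap (ofElem m)) (exists_yoMap_ofElem m)

lemma resHom_unitEl {M : SmallMod D} {d : D} (m : M.el d) :
    (isHereditaryEmbedding_yoneda₂ D).resHom (unitEl m) = yoMap (ofElem m) :=
  IsHereditaryEmbedding.resHom_resEl _ _ _

lemma ofElem_injective {M : SmallMod D} {d : D} {m m' : M.el d} (h : ofElem m = ofElem m') :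
    m = m' := HilbMod.ext_act fun A g => by
  rw [← app_ofElem, ← app_ofElem, h]

lemma unitEl_injective {M : SmallMod D} {d : D} {m m' : M.el d} (h : unitEl m = unitEl m') :
    m = m' := by
  refine ofElem_injective (yoMap_injective _ _ ?_)
  rw [← resHom_unitEl, ← resHom_unitEl, h]

lemma exists_unitEl {M : SmallMod D} {d : D} (F : ((hilbL D).obj (yo M)).el d) :
    ∃ m : M.el d, unitEl m = F := by
  obtain ⟨T, hT⟩ := exists_yoMap_eq (SmallMod.isId_idHom (yo d))
    ((isHereditaryEmbedding_yoneda₂ D).resHom F)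
  obtain ⟨k, hk⟩ := (isHereditaryEmbedding_yoneda₂ D).resHom_mem F
  rw [← hT, yoMap_adj_comp] at hk
  have h1 : (yoneda D).map k = T† ⊚ T := yoMap_injective _ _ hk
  have h2 := IsHereditaryEmbedding.mem_closure (i := yoneda D) ⟨k, h1⟩
  let J : M.el d →ₗᵢ[ℂ] Hom (yo d) M :=
    ⟨⟨⟨ofElem, ofElem_add⟩, ofElem_smul⟩, norm_ofElem⟩
  have h3 : IsClosed (Set.range J) := J.isometry.isClosedEmbedding.isClosed_range
  have h4 : (Set.range fun e : Hom d d => T ⊚ (yoneda D).map e) ⊆ Set.range J := by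
    rintro _ ⟨e, rfl⟩
    refine ⟨SmallMod.app T (yoEl e), ?_⟩
    change ofElem _ = T ⊚ yoMap e
    rw [← ofElem_yoEl, comp_ofElem]
  obtain ⟨m, hm⟩ := closure_minimal h4 h3 h2
  refine ⟨m, IsHereditaryEmbedding.resHom_injective _ ?_⟩
  rw [resHom_unitEl]
  exact (congrArg yoMap hm).trans hT

/-- The inverse of `unitEl`. -/
def unitInv {M : SmallMod D} {d : D} (F : ((hilbL D).obj (yo M)).el d) : M.el d :=
  (exists_unitEl F).choose

lemma unitEl_unitInv {M : SmallMod D} {d : D} (F : ((hilbL D).obj (yo M)).el d) :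
    unitEl (unitInv F) = F := (exists_unitEl F).choose_spec

lemma unitInv_unitEl {M : SmallMod D} {d : D} (m : M.el d) : unitInv (unitEl m) = m :=
  unitEl_injective (unitEl_unitInv _)

lemma norm_unitEl_le {M : SmallMod D} {d : D} (m : M.el d) : ‖unitEl m‖ ≤ 1 * ‖m‖ := by
  rw [one_mul, ← IsHereditaryEmbedding.norm_resHom, resHom_unitEl, norm_yoMap, norm_ofElem]

lemma inner_unitEl {M : SmallMod D} {d d' : D} (m : M.el d) (m' : M.el d') :
    ((hilbL D).obj (yo M)).inner (unitEl m') (unitEl m) = M.inner m' m := by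
  refine (isHereditaryEmbedding_yoneda₂ D).injective _ _ ?_
  rw [IsHereditaryEmbedding.map_inner_res, resHom_unitEl, resHom_unitEl, yoMap_adj_comp,
    ofElem_adj_comp]

/-- The canonical isomorphism from `M` to the restriction of the module represented by `M`. -/
def hilbUnit (M : SmallMod D) : Hom M ((hilbL D).obj (yo M)) :=
  SmallMod.mkHom (fun _ m => unitEl m) (fun _ F => unitInv F) 1 zero_le_one
    (fun _ m => norm_unitEl_le m) (fun _ _ m F => by
      rw [← inner_unitEl m, unitEl_unitInv])

lemma app_hilbUnit {M : SmallMod D} {d : D} (m : M.el d) :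
    SmallMod.app (hilbUnit M) m = unitEl m := SmallMod.app_mkHom ..

lemma app_hilbUnit_adj {M : SmallMod D} {d : D} (F : ((hilbL D).obj (yo M)).el d) :
    SmallMod.app (hilbUnit M)† F = unitInv F := by
  refine HilbMod.ext_inner fun B b => ?_
  rw [← SmallMod.app_inner, app_hilbUnit, ← inner_unitEl _ b, unitEl_unitInv]

lemma isId_of_app {M : SmallMod D} {T : Hom M M}
    (h : ∀ (A : D) (m : M.el A), SmallMod.app T m = m) : IsId T := by
  have : T = SmallMod.idHom M := SmallMod.hom_ext fun A m => by rw [h, SmallMod.app_idHom]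
  rw [this]
  exact SmallMod.isId_idHom M

lemma isUnital_resFunctor {E : Type u₁} [CStarCat.{v} E] {i : CFunctor D E}
    (hi : IsHereditaryEmbedding i) : hi.resFunctor.IsUnital := fun X e he =>
  isId_of_app fun A m => hi.resHom_injective (by
    rw [IsHereditaryEmbedding.resHom_app_resMap, he.2])

lemma isUnitary_hilbUnit (M : SmallMod D) : IsUnitary (hilbUnit M) :=
  ⟨isId_of_app fun A m => by
    rw [SmallMod.app_comp, app_hilbUnit, app_hilbUnit_adj, unitInv_unitEl],
  isId_of_app fun A F => by
    rw [SmallMod.app_comp, app_hilbUnit_adj, app_hilbUnit, unitEl_unitInv]⟩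

lemma natural_hilbUnit {M N : SmallMod D} (T : Hom M N) :
    hilbUnit N ⊚ T = (hilbL D).map (yoMap T) ⊚ hilbUnit M :=
  SmallMod.hom_ext fun A m => by
    rw [SmallMod.app_comp, SmallMod.app_comp, app_hilbUnit, app_hilbUnit]
    refine IsHereditaryEmbedding.resHom_injective _ ?_
    rw [IsHereditaryEmbedding.resHom_app_resMap, resHom_unitEl, resHom_unitEl, ← comp_ofElem]
    exact yoMap_comp _ _

attribute [local irreducible] IsHereditaryEmbedding.res IsHereditaryEmbedding.resMap yo yoMap in
/-- The pre-complete structure on the category of Hilbert modules over `D`: the functor `L`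
restricts a Hilbert module over this category to `D`. -/
def hilbPreComplete (D : Type u) [CStarCat.{v} D] : PreComplete (SmallMod D) where
  exists_id M := ⟨SmallMod.idHom M, SmallMod.isId_idHom M⟩
  L := hilbL D
  isUnital_L := isUnital_resFunctor _
  η := hilbUnit
  isNaturalUnitary_η := ⟨isUnitary_hilbUnit, fun T => natural_hilbUnit T⟩

end Hilb

end CStarCat

end

/-!
For a pre-complete category `(C, L, η)`, an element `n` of a Hilbert module `N` over `A` defines a
morphism `ev n = L ñ ⊚ η : A → L N`, and `(ev n')† ⊚ ev n = ⟨n', n⟩`. Thus `N` is a submodule of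
the module represented by `L N`. All unitary operators needed below are obtained from families of
elements that generate two modules and have the same inner products (`exists_unitary_of_dense`).

*From an embedding to an equivalence.* The closed span `B` of the operators `ev n ⊚ (ev n')†` is a
hereditary subalgebra of the endomorphisms of `L N`, and `B (L N)` is the copy `ev N` of `N`;
hence `B` is weakly dense (`isWeaklyDense_rankOneAlgebra`). If the morphisms of the subcategory are
absolutely compact, then `f ⊚ i e ⊚ f†` belongs to `B` for every `f : i a → L N`; when `f† ⊚ f`
lies in the subcategory, an approximate unit shows that `f` comes from an element of `N`
(`exists_ev_eq`). Applied to the extension of a module `M` over `D`, this identifies `M` with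
the restriction of the colimit of its extension, so that restriction is essentially surjective;
applied to an arbitrary `N`, it shows that the restriction of `L N` is generated by the images of
the elements of `N`, which amounts to continuity (`isContinuous_of_dense_colimitElements`). That
restriction is bijective on morphisms is a formal consequence of the generation
property: the inverse sends `T` to `(μ Y)† ⊚ L (H i T) ⊚ μ X`.

*From an equivalence to an embedding.* Let `F` be a continuous equivalence from `C` to the Hilbert
modules over `D`, and lift the Yoneda embedding along `F` to a functor `i`. Continuity of `F`
says that `F (L N)` is generated by the images of the elements of `N`
(`PreComplete.IsContinuous.dense_colimitElements`). For the extension of the restriction of `Y` this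
gives the unitary `μ Y`. For the module `B Z` of a weakly dense hereditary subalgebra `B` it shows
that `F Z` is generated by `F(B)`, so that `F(B)` contains all rank one operators of `F Z`,
among which are the images of the morphisms `h₂† ⊚ i (k ⊚ e) ⊚ h₁`.
-/

namespace CStarCat

/-! ### Closed spans and unitary operators between Hilbert modules -/

section ClosedSpan

/-- A continuous linear map that sends a set into a closed subspace sends its closed span into
this subspace. -/
lemma apply_mem_of_mem_closedSpan {E E' : Type*} [NormedAddCommGroup E] [NormedSpace ℂ E]
    [NormedAddCommGroup E'] [NormedSpace ℂ E'] (Λ : E →L[ℂ] E') {S : Set E} {W : Submodule ℂ E'}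
    (hW : IsClosed (W : Set E')) (h : ∀ s ∈ S, Λ s ∈ W) {m : E}
    (hm : m ∈ closure (Submodule.span ℂ S : Set E)) : Λ m ∈ W := by
  have h1 : Submodule.span ℂ S ≤ W.comap Λ.toLinearMap := Submodule.span_le.2 h
  exact closure_minimal (t := Λ ⁻¹' W) h1 (hW.preimage Λ.continuous) hm

end ClosedSpan

section Unitary

variable {C : Type u} [CStarCat.{v} C] {X Y Z : C} {t : Hom X Y}

lemma IsUnitary.symm (ht : IsUnitary t) : IsUnitary t† := by
  refine ⟨?_, ?_⟩
  · rw [adj_adj]; exact ht.2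
  · rw [adj_adj]; exact ht.1

lemma IsUnitary.adj_comp_cancel (ht : IsUnitary t) (f : Hom Z X) : t† ⊚ t ⊚ f = f := by
  rw [← comp_assoc, ht.1.2]

lemma IsUnitary.comp_adj_cancel (ht : IsUnitary t) (f : Hom Z Y) : t ⊚ t† ⊚ f = f := by
  rw [← comp_assoc, ht.2.2]

lemma IsUnitary.map {C' : Type u₁} [CStarCat.{v} C'] {F : CFunctor C C'} (hF : F.IsUnital)
    (ht : IsUnitary t) : IsUnitary (F.map t) := by
  refine ⟨?_, ?_⟩
  · rw [← F.map_adj, ← F.map_comp]; exact hF _ _ ht.1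
  · rw [← F.map_adj, ← F.map_comp]; exact hF _ _ ht.2

end Unitary

section Modules

variable {D : Type u} [CStarCat.{v} D] {M N : SmallMod D}

lemma app_adj_app {t : Hom M N} (ht : IsUnitary t) {a : D} (m : M.el a) :
    SmallMod.app t† (SmallMod.app t m) = m := by
  have h : t† ⊚ t = SmallMod.idHom M := by
    rw [← ht.1.1 M (SmallMod.idHom M), (SmallMod.isId_idHom M).2]
  rw [← SmallMod.app_comp, h, SmallMod.app_idHom]

lemma app_app_adj {t : Hom M N} (ht : IsUnitary t) {a : D} (n : N.el a) :
    SmallMod.app t (SmallMod.app t† n) = n := by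
  simpa using app_adj_app ht.symm n

lemma SmallMod.hom_ext_of_dense {J : D → Type*} {x : ∀ a, J a → M.el a}
    (hx : ∀ a, Dense (Submodule.span ℂ (Set.range (x a)) : Set (M.el a))) {S T : Hom M N}
    (h : ∀ a j, SmallMod.app S (x a j) = SmallMod.app T (x a j)) : S = T := by
  refine SmallMod.hom_ext fun a m => ?_
  have := ContinuousLinearMap.ext_on (f := SmallMod.appL S a) (g := SmallMod.appL T a) (hx a) (by
    rintro _ ⟨j, rfl⟩
    exact h a j)
  exact congrArg (fun F => F m) this

/-- Two families of elements that generate `M` and `N` and have the same inner products define a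
unitary operator from `M` to `N`. -/
theorem exists_unitary_of_dense {J : D → Type*} {x : ∀ a, J a → M.el a} {y : ∀ a, J a → N.el a}
    (hx : ∀ a, Dense (Submodule.span ℂ (Set.range (x a)) : Set (M.el a)))
    (hy : ∀ a, Dense (Submodule.span ℂ (Set.range (y a)) : Set (N.el a)))
    (h : ∀ a b (j : J a) (k : J b), M.inner (x b k) (x a j) = N.inner (y b k) (y a j)) :
    ∃ U : Hom M N, IsUnitary U ∧ ∀ a j, SmallMod.app U (x a j) = y a j := by
  let X := fun a => Finsupp.linearCombination ℂ (x a)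
  let Y := fun a => Finsupp.linearCombination ℂ (y a)
  have hX : ∀ a, DenseRange (X a) := fun a => by
    have := hx a
    rwa [← Finsupp.range_linearCombination] at this
  have hY : ∀ a, DenseRange (Y a) := fun a => by
    have := hy a
    rwa [← Finsupp.range_linearCombination] at this
  have hin : ∀ a b p q, M.inner (X b q) (X a p) = N.inner (Y b q) (Y a p) := by
    intro a b p q
    induction q using Finsupp.induction_linear with
    | zero => simp
    | add q q' h h' => simp [h, h']
    | single i c =>
      induction p using Finsupp.induction_linear with
      | zero => simp
      | add q q' h h' => simp only [map_add, HilbMod.inner_add, h, h']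
      | single j d => simp [X, Y, h]
  have hn : ∀ a p, ‖X a p‖ = ‖Y a p‖ := fun a p => by
    refine (pow_left_inj₀ (norm_nonneg _) (norm_nonneg _) two_ne_zero).1 ?_
    rw [M.norm_sq, N.norm_sq, hin]
  have hn₁ : ∀ a p, ‖Y a p‖ ≤ 1 * ‖X a p‖ := fun a p => by rw [hn, one_mul]
  have hn₂ : ∀ a p, ‖X a p‖ ≤ 1 * ‖Y a p‖ := fun a p => by rw [hn, one_mul]
  let f := fun a => (Y a).extendOfNorm (X a)
  let g := fun a => (X a).extendOfNorm (Y a)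
  have hf : ∀ a p, f a (X a p) = Y a p := fun a p =>
    LinearMap.extendOfNorm_eq (hX a) ⟨_, hn₁ a⟩ p
  have hg : ∀ a p, g a (Y a p) = X a p := fun a p =>
    LinearMap.extendOfNorm_eq (hY a) ⟨_, hn₂ a⟩ p
  have hfg : ∀ a b (m : M.el a) (n : N.el b), N.inner n (f a m) = M.inner (g b n) m := by
    intro a b m n
    refine (hX a).induction_on m (isClosed_eq (by fun_prop) (by fun_prop)) fun p => ?_
    refine (hY b).induction_on n (isClosed_eq (by fun_prop) (by fun_prop)) fun q => ?_
    rw [hf, hg, hin]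
  let U : Hom M N := SmallMod.mkHom (fun a => f a) (fun a => g a) 1 zero_le_one
    (fun a => LinearMap.norm_extendOfNorm_apply_le (hX a) _ (hn₁ a)) hfg
  let V : Hom N M := SmallMod.mkHom (fun a => g a) (fun a => f a) 1 zero_le_one
    (fun a => LinearMap.norm_extendOfNorm_apply_le (hY a) _ (hn₂ a)) fun a b n m => by
      rw [← HilbMod.inner_adj, ← hfg, HilbMod.inner_adj]
  have hU : ∀ a (m : M.el a), SmallMod.app U m = f a m := fun a m => SmallMod.app_mkHom ..
  have hV : ∀ a (n : N.el a), SmallMod.app V n = g a n := fun a n => SmallMod.app_mkHom ..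
  have hUV : U† = V := SmallMod.adj_unique fun a b m n => by rw [hU, hV, hfg]
  have hxX : ∀ a j, x a j = X a (Finsupp.single j 1) := fun a j => by simp [X]
  have hyY : ∀ a j, y a j = Y a (Finsupp.single j 1) := fun a j => by simp [Y]
  refine ⟨U, ⟨?_, ?_⟩, fun a j => by rw [hU, hxX, hf, hyY]⟩
  · rw [hUV]
    refine isId_of_app fun a m => ?_
    rw [SmallMod.app_comp, hU, hV]
    exact (hX a).induction_on m (isClosed_eq (by fun_prop) (by fun_prop)) fun p => by
      rw [hf, hg]
  · rw [hUV]
    refine isId_of_app fun a n => ?_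
    rw [SmallMod.app_comp, hU, hV]
    exact (hY a).induction_on n (isClosed_eq (by fun_prop) (by fun_prop)) fun p => by
      rw [hg, hf]

/-- The operators from a representable module given by elements, as an isometry. -/
noncomputable def ofElemL (M : SmallMod D) (a : D) : M.el a →ₗᵢ[ℂ] Hom (yo a) M :=
  ⟨⟨⟨ofElem, ofElem_add⟩, ofElem_smul⟩, norm_ofElem⟩

/-- The value at a fixed element, as a continuous linear function of the operator. -/
noncomputable def evalL {a : D} (m : M.el a) (N : SmallMod D) : Hom M N →L[ℂ] N.el a :=
  LinearMap.mkContinuous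
    ⟨⟨fun T => SmallMod.app T m, fun S T => SmallMod.add_app S T m⟩,
      fun c T => SmallMod.smul_app c T m⟩ ‖m‖ fun T => by
    rw [mul_comm]; exact SmallMod.norm_app_le T m

@[simp] lemma ofElemL_apply {a : D} (m : M.el a) : ofElemL M a m = ofElem m := rfl

@[simp] lemma evalL_apply {a : D} (m : M.el a) (T : Hom M N) :
    evalL m N T = SmallMod.app T m := rfl

/-- Every element of a Hilbert module is a limit of its multiples by endomorphisms. -/
lemma mem_closure_act {a : D} (m : M.el a) :
    m ∈ closure (Set.range fun e : Hom a a => M.act m e) := by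
  have h := IsHereditaryEmbedding.mem_closure (i := yoneda D) (f := ofElem m)
    ⟨M.inner m m, by rw [ofElem_adj_comp]⟩
  rw [(ofElemL M a).isometry.isEmbedding.isInducing.closure_eq_preimage_closure_image,
    Set.mem_preimage, ← Set.range_comp]
  have e1 : (ofElemL M a ∘ fun e => M.act m e) = fun e => ofElem m ⊚ yoMap e :=
    funext fun e => (ofElem_act m e).symm
  rw [e1]
  exact h

lemma mem_of_forall_act_mem {a : D} {m : M.el a} {W : Set (M.el a)} (hW : IsClosed W)
    (h : ∀ e : Hom a a, M.act m e ∈ W) : m ∈ W :=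
  closure_minimal (by rintro _ ⟨e, rfl⟩; exact h e) hW (mem_closure_act m)

end Modules

/-! ### Elements of a module as morphisms into its colimit -/

namespace PreComplete

variable {C : Type u} [CStarCat.{v} C] (P : PreComplete C) {N N' : SmallMod C}

/-- The canonical morphism from `A` to `L N` defined by an element of `N A`. The module `N` is
thereby embedded isometrically, but in general not adjointably, in the module represented by
`L N`. -/
noncomputable def ev {A : C} (n : N.el A) : Hom A (P.L.obj N) := P.L.map (ofElem n) ⊚ P.η A

lemma η_natural {A B : C} (f : Hom A B) : P.η B ⊚ f = P.L.map (yoMap f) ⊚ P.η A :=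
  P.isNaturalUnitary_η.natural f

lemma ev_act {A B : C} (n : N.el A) (f : Hom B A) : P.ev (N.act n f) = P.ev n ⊚ f := by
  rw [ev, ev, comp_assoc, η_natural, ← ofElem_act, P.L.map_comp, comp_assoc]

lemma map_ev {A : C} (T : Hom N N') (n : N.el A) :
    P.L.map T ⊚ P.ev n = P.ev (SmallMod.app T n) := by
  rw [ev, ev, ← comp_assoc, ← P.L.map_comp, comp_ofElem]

lemma ev_adj_comp {A B : C} (n' : N.el B) (n : N.el A) : (P.ev n')† ⊚ P.ev n = N.inner n' n := by
  have h1 : (P.L.map (ofElem n'))† ⊚ P.L.map (ofElem n) = P.L.map (yoMap (N.inner n' n)) := by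
    rw [← P.L.map_adj, ← P.L.map_comp, ofElem_adj_comp]
  rw [ev, ev, adj_comp, comp_assoc, ← comp_assoc (P.L.map (ofElem n'))†, h1, ← η_natural]
  exact (P.isNaturalUnitary_η.unitary B).adj_comp_cancel _

/-- The map `ev` as a linear isometry. -/
noncomputable def evL (N : SmallMod C) (A : C) : N.el A →ₗᵢ[ℂ] Hom A (P.L.obj N) where
  toFun := P.ev
  map_add' n n' := by rw [ev, ofElem_add, P.L.map_add, add_comp]; rfl
  map_smul' c n := by rw [ev, ofElem_smul, P.L.map_smul, smul_comp]; rfl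
  norm_map' n := by
    refine (pow_left_inj₀ (norm_nonneg _) (norm_nonneg _) two_ne_zero).1 ?_
    rw [CStarCat.norm_sq, N.norm_sq]
    exact congrArg norm (P.ev_adj_comp n n)

@[simp] lemma evL_apply {A : C} (n : N.el A) : P.evL N A n = P.ev n := rfl

lemma isClosed_range_evL (N : SmallMod C) (A : C) :
    IsClosed (LinearMap.range (P.evL N A).toLinearMap : Set (Hom A (P.L.obj N))) :=
  (P.evL N A).isometry.isClosedEmbedding.isClosed_range

end PreComplete

/-! ### The hereditary subalgebra defined by a module -/

section ModuleAlgebra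

variable {C : Type u} [CStarCat.{v} C] (P : PreComplete C) (N : SmallMod C)

/-- The closed subspace of the endomorphisms of `L N` spanned by the operators of rank one
between elements of `N`. -/
noncomputable def rankOneSpan : Submodule ℂ (Hom (P.L.obj N) (P.L.obj N)) :=
  (Submodule.span ℂ {b | ∃ (A : C) (n n' : N.el A), b = P.ev n ⊚ (P.ev n')†}).topologicalClosure

lemma isClosed_rankOneSpan : IsClosed (rankOneSpan P N : Set (Hom (P.L.obj N) (P.L.obj N))) :=
  Submodule.isClosed_topologicalClosure _

variable {N}

lemma rankOne_mem {A : C} (n n' : N.el A) : P.ev n ⊚ (P.ev n')† ∈ rankOneSpan P N :=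
  subset_closure (Submodule.subset_span ⟨A, n, n', rfl⟩)

lemma rankOneSpan_adj_mem {b : Hom (P.L.obj N) (P.L.obj N)} (hb : b ∈ rankOneSpan P N) :
    b† ∈ rankOneSpan P N := by
  have h1 : Submodule.span ℂ {b | ∃ (A : C) (n n' : N.el A), b = P.ev n ⊚ (P.ev n')†} ≤
      (rankOneSpan P N).comap (adjL (P.L.obj N) (P.L.obj N)).toLinearMap := by
    refine Submodule.span_le.2 ?_
    rintro _ ⟨A, n, n', rfl⟩
    change (P.ev n ⊚ (P.ev n')†)† ∈ rankOneSpan P N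
    rw [adj_comp, adj_adj]
    exact rankOne_mem P n' n
  exact closure_minimal (t := adjL (P.L.obj N) (P.L.obj N) ⁻¹' rankOneSpan P N) h1
    ((isClosed_rankOneSpan P N).preimage (adjL _ _).continuous) hb

/-- The rank one algebra sends every morphism to `L N` into the image of `N`. -/
lemma rankOneSpan_comp_mem_range {b : Hom (P.L.obj N) (P.L.obj N)} (hb : b ∈ rankOneSpan P N)
    {A : C} (h : Hom A (P.L.obj N)) : ∃ n : N.el A, P.ev n = b ⊚ h := by
  refine apply_mem_of_mem_closedSpan ((compL A (P.L.obj N) (P.L.obj N)).flip h)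
    (P.isClosed_range_evL N A) ?_ hb
  rintro _ ⟨A', n, n', rfl⟩
  refine ⟨N.act n ((P.ev n')† ⊚ h), ?_⟩
  change P.ev _ = (P.ev n ⊚ (P.ev n')†) ⊚ h
  rw [P.ev_act, comp_assoc]

lemma rankOneSpan_hereditary {a b : Hom (P.L.obj N) (P.L.obj N)}
    (f : Hom (P.L.obj N) (P.L.obj N)) (ha : a ∈ rankOneSpan P N) (hb : b ∈ rankOneSpan P N) :
    a ⊚ f ⊚ b ∈ rankOneSpan P N := by
  refine apply_mem_of_mem_closedSpan
    ((compL _ _ _ a).comp (compL (P.L.obj N) _ _ f)) (isClosed_rankOneSpan P N) ?_ hb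
  rintro _ ⟨A, n, n', rfl⟩
  obtain ⟨m, hm⟩ := rankOneSpan_comp_mem_range P ha (f ⊚ P.ev n)
  change a ⊚ f ⊚ P.ev n ⊚ (P.ev n')† ∈ rankOneSpan P N
  rw [← comp_assoc f, ← comp_assoc a, ← hm]
  exact rankOne_mem P m n'

variable (N) in
/-- The hereditary subalgebra of the endomorphisms of `L N` defined by `N`: the algebra of compact
operators of `N`, acting on `L N`. -/
noncomputable def rankOneAlgebra : HereditarySubalgebra (P.L.obj N) where
  __ := rankOneSpan P N
  isClosed := isClosed_rankOneSpan P N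
  adj_mem hb := rankOneSpan_adj_mem P hb
  comp_mem {a b} ha hb := by
    obtain ⟨e, he⟩ := P.exists_id (P.L.obj N)
    have h := rankOneSpan_hereditary P e ha hb
    rwa [he.2] at h
  hereditary f ha hb := rankOneSpan_hereditary P f ha hb

/-- If `f f*` belongs to a hereditary subalgebra `B` of the endomorphisms of `X`, then `f` belongs
to the module `B X`. -/
lemma HereditarySubalgebra.mem_space_of_comp_adj_mem {X A : C} (B : HereditarySubalgebra X)
    {f : Hom A X} (hf : f ⊚ f† ∈ B.carrier) : f ∈ B.space A := by
  rw [← SetLike.mem_coe, ← (B.isClosed_space A).closure_eq, Metric.mem_closure_iff]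
  intro ε hε
  obtain ⟨s, -, hsp, -, hle⟩ := exists_approx (fun _ : Unit => f) (half_pos hε)
  simp only [Finset.univ_unique, Finset.sum_const, Finset.card_singleton, one_smul] at hsp hle
  -- `s f f† s f` is close to `f` and equal to `f f† s s f`, as `s` commutes with `f f†`
  refine ⟨_, subset_closure (Submodule.subset_span ⟨f ⊚ f†, hf, s ⊚ s ⊚ f, rfl⟩), ?_⟩
  rw [dist_eq_norm]
  refine lt_of_le_of_lt (le_of_eq_of_le ?_ (hle ())) (half_lt_self hε)
  rw [← comp_assoc _ s, ← hsp]
  simp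

lemma mem_space_rankOneAlgebra {A : C} {g : Hom A (P.L.obj N)} :
    g ∈ (rankOneAlgebra P N).space A ↔ ∃ n : N.el A, P.ev n = g := by
  refine ⟨fun hg => ?_, ?_⟩
  · refine apply_mem_of_mem_closedSpan (ContinuousLinearMap.id ℂ _)
      (P.isClosed_range_evL N A) ?_ hg
    rintro _ ⟨b, hb, h, rfl⟩
    exact rankOneSpan_comp_mem_range P hb h
  · rintro ⟨n, rfl⟩
    exact HereditarySubalgebra.mem_space_of_comp_adj_mem _ (rankOne_mem P n n)

/-- The module generated by the rank one algebra of `N` is a copy of `N`, whose colimit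
is `L N`. -/
theorem isWeaklyDense_rankOneAlgebra : (rankOneAlgebra P N).IsWeaklyDense P := by
  let B := rankOneAlgebra P N
  let y : ∀ A, N.el A → B.mod.el A := fun A n =>
    B.toMod ⟨P.ev n, (mem_space_rankOneAlgebra P).2 ⟨n, rfl⟩⟩
  have hx : ∀ A, Dense (Submodule.span ℂ (Set.range (id : N.el A → N.el A)) : Set (N.el A)) :=
    fun A => by simp
  have hy : ∀ A, Dense (Submodule.span ℂ (Set.range (y A)) : Set (B.mod.el A)) := fun A => by
    have h1 : Set.range (y A) = Set.univ := Set.eq_univ_of_forall fun g => by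
      obtain ⟨n, hn⟩ := (mem_space_rankOneAlgebra P).1 (show B.space A from g).2
      exact ⟨n, Subtype.ext hn⟩
    simp [h1]
  obtain ⟨U, hU, hUy⟩ := exists_unitary_of_dense (M := N) (N := B.mod) (J := fun A => N.el A)
    (x := fun A => id) (y := y) hx hy fun A A' n n' => (P.ev_adj_comp n' n).symm
  refine ⟨P.L.map U†, hU.symm.map P.isUnital_L, fun A g => ?_⟩
  obtain ⟨n, hn⟩ := (mem_space_rankOneAlgebra P).1 g.2
  have hg : B.toMod g = SmallMod.app U n := by
    rw [show SmallMod.app U n = y A n from hUy A n]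
    exact Subtype.ext hn.symm
  rw [← hn]
  change P.L.map U† ⊚ P.ev (B.toMod g) = P.ev n
  rw [P.map_ev, hg, app_adj_app hU]

/-- If the image of `i` consists of absolutely compact morphisms, then a morphism from `i a` to
`L N` whose square belongs to the subcategory comes from an element of `N`. -/
theorem exists_ev_eq {D : Type u₁} [CStarCat.{v} D] {i : CFunctor D C}
    (hk : ∀ (a b : D) (k : Hom a b), P.IsAbsolutelyCompact (i.map k)) {a : D}
    {f : Hom (i.obj a) (P.L.obj N)} (hf : ∃ d, i.map d = f† ⊚ f) :
    ∃ n : N.el (i.obj a), P.ev n = f := by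
  rw [← mem_space_rankOneAlgebra P]
  refine HereditarySubalgebra.mem_space_of_comp_adj_mem _ ?_
  have h1 : IsClosed {g : Hom (i.obj a) (P.L.obj N) | g ⊚ f† ∈ (rankOneAlgebra P N).carrier} :=
    (rankOneAlgebra P N).isClosed.preimage (f := fun g => g ⊚ f†) (by fun_prop)
  -- `f` is a limit of morphisms `f ⊚ i e`, and `f ⊚ i e ⊚ f†` belongs to the algebra
  refine closure_minimal ?_ h1 (IsHereditaryEmbedding.mem_closure hf)
  rintro _ ⟨e, rfl⟩
  have h2 := hk a a e (P.L.obj N) f† f† _ (isWeaklyDense_rankOneAlgebra P)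
  change (f ⊚ i.map e) ⊚ f† ∈ (rankOneAlgebra P N).carrier
  rw [comp_assoc]
  rwa [adj_adj] at h2

end ModuleAlgebra

/-! ### Restrictions of modules over the category of modules -/

section HilbGeneration

variable {D : Type u} [CStarCat.{v} D]

/-- The element `ev g k` of the restriction of `G`, as an operator from a representable module. -/
lemma resHom_app_ev {G : SmallMod (SmallMod D)} {K : SmallMod D} (g : G.el K) {d : D}
    (k : K.el d) :
    (isHereditaryEmbedding_yoneda₂ D).resHom (SmallMod.app ((hilbPreComplete D).ev g) k) =
      ofElem g ⊚ yoMap (ofElem k) := by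
  have h : SmallMod.app ((hilbPreComplete D).ev g) k =
      SmallMod.app ((isHereditaryEmbedding_yoneda₂ D).resMap (ofElem g)) (unitEl k) := by
    rw [← app_hilbUnit]
    exact SmallMod.app_comp _ _ k
  rw [h]
  refine (IsHereditaryEmbedding.resHom_app_resMap _ _ _).trans ?_
  rw [resHom_unitEl]

/-- Elements that generate a module `G` over the category of Hilbert modules also generate its
restriction. -/
theorem dense_restriction {G : SmallMod (SmallMod D)} {J : Type*} {K : J → SmallMod D}
    {g : ∀ j, G.el (K j)}
    (hg : ∀ A, Dense (Submodule.span ℂ {y : G.el A | ∃ (j : J) (h : Hom A (K j)),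
      y = G.act (g j) h} : Set (G.el A))) (d : D) :
    Dense (Submodule.span ℂ {z : ((hilbPreComplete D).L.obj G).el d | ∃ (j : J) (k : (K j).el d),
      z = SmallMod.app ((hilbPreComplete D).ev (g j)) k} :
      Set (((hilbPreComplete D).L.obj G).el d)) := by
  intro z
  let hY := isHereditaryEmbedding_yoneda₂ D
  set W := (Submodule.span ℂ {z : ((hilbPreComplete D).L.obj G).el d |
    ∃ (j : J) (k : (K j).el d), z = SmallMod.app ((hilbPreComplete D).ev (g j)) k}) with hW
  change z ∈ (W.topologicalClosure : Set _)
  refine mem_of_forall_act_mem W.isClosed_topologicalClosure fun e => ?_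
  -- `z` is given by an element `n` of `G` over the module represented by `d`
  let T : Hom (yo (yo d)) G := hY.resHom z
  let n : G.el (yo d) := SmallMod.app T (yoEl (SmallMod.idHom (yo d)))
  have hn : ofElem n = T := by
    rw [← comp_ofElem, ofElem_yoEl]
    refine yo_hom_ext fun A m => ?_
    rw [SmallMod.app_comp, app_yoMap, (SmallMod.isId_idHom (yo d)).2]
  have hz : ((hilbPreComplete D).L.obj G).act z e =
      SmallMod.app ((hilbPreComplete D).ev n) (yoEl e) := by
    refine hY.resHom_injective ?_
    refine Eq.trans ?_ (resHom_app_ev n (yoEl e)).symm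
    rw [hn, ofElem_yoEl]
    exact hY.resHom_act z e
  rw [hz]
  refine apply_mem_of_mem_closedSpan
    ((evalL (yoEl e) _).comp ((hilbPreComplete D).evL G (yo d)).toContinuousLinearMap)
    W.isClosed_topologicalClosure ?_ (hg (yo d) n)
  rintro _ ⟨j, h, rfl⟩
  refine subset_closure (Submodule.subset_span ⟨j, SmallMod.app h (yoEl e), ?_⟩)
  change SmallMod.app ((hilbPreComplete D).ev (G.act (g j) h)) (yoEl e) = _
  rw [PreComplete.ev_act, SmallMod.app_comp]

end HilbGeneration

/-! ### The restriction functor of an absolutely compact generating subcategory -/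

section RestrictionFunctor

variable {D : Type u₁} [CStarCat.{v} D] {C : Type u} [CStarCat.{v} C] {P : PreComplete C}
  {i : CFunctor D C} {hi : IsHereditaryEmbedding i}

namespace Extension

variable {M : SmallMod D}

lemma incl_act (E : Extension i M) {a b : D} (m : M.el b) (g : Hom a b) :
    E.incl a (M.act m g) = E.mod.act (E.incl b m) (i.map g) := by
  have h1 : E.mod.inner (E.incl a (M.act m g) - E.mod.act (E.incl b m) (i.map g))
      (E.incl a (M.act m g) - E.mod.act (E.incl b m) (i.map g)) = 0 := by
    simp [inner_incl]
  have h2 := E.mod.norm_sq (E.incl a (M.act m g) - E.mod.act (E.incl b m) (i.map g))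
  rw [h1, norm_zero] at h2
  exact sub_eq_zero.1 (norm_eq_zero.1 (by simpa using h2))

lemma norm_incl_le (E : Extension i M) {a : D} (m : M.el a) : ‖E.incl a m‖ ≤ 1 * ‖m‖ := by
  rw [one_mul]
  refine (le_abs_self _).trans (abs_le_of_sq_le_sq ?_ (norm_nonneg _))
  rw [HilbMod.norm_sq, HilbMod.norm_sq, inner_incl]
  exact i.norm_map_le _

/-- The inclusion of `M` in an extension as a continuous linear map. -/
noncomputable def inclL (E : Extension i M) (a : D) : M.el a →L[ℂ] E.mod.el (i.obj a) :=
  (E.incl a).mkContinuous 1 E.norm_incl_le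

end Extension

namespace IsHereditaryEmbedding

variable (hi) in
/-- Composition with a morphism of the subcategory sends every morphism into the restriction. -/
noncomputable def resComp {a b : D} (e : Hom b a) (X : C) :
    Hom (i.obj a) X →L[ℂ] (hi.res X).el b :=
  LinearMap.mkContinuous
    { toFun := fun f => hi.resEl (f ⊚ i.map e) (by
        obtain ⟨k, hk⟩ := hi.hereditary e (f† ⊚ f) e†
        exact ⟨k, by rw [hk]; simp⟩)
      map_add' := fun f g => hi.resHom_injective (add_comp f g _)
      map_smul' := fun c f => hi.resHom_injective (smul_comp c f _) } ‖i.map e‖ fun f => by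
    rw [mul_comm]
    exact norm_comp_le f (i.map e)

@[simp] lemma resHom_resComp {a b : D} (e : Hom b a) {X : C} (f : Hom (i.obj a) X) :
    hi.resHom (hi.resComp e X f) = f ⊚ i.map e := rfl

lemma act_eq_resComp {a b : D} (e : Hom b a) {X : C} (z : (hi.res X).el a) :
    (hi.res X).act z e = hi.resComp e X (hi.resHom z) := rfl

lemma map_eq_of_isGenerating {μ : ∀ Y : C, Hom Y (P.L.obj ((extFunctor i).obj (hi.res Y)))}
    (h : CFunctor.IsNaturalUnitary (CFunctor.id C)
      (P.L.comp ((extFunctor i).comp hi.resFunctor)) μ) {X Y : C} (S : Hom X Y) :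
    S = (μ Y)† ⊚ P.L.map ((extFunctor i).map (hi.resFunctor.map S)) ⊚ μ X := by
  have h1 := h.natural S
  exact ((h.unitary Y).adj_comp_cancel S).symm.trans (congrArg (fun T => (μ Y)† ⊚ T) h1)

/-- The inverse of restriction on morphisms sends `T` to the morphism induced by `T` on the colimits
of the extensions. -/
theorem IsGenerating.bijective (h : hi.IsGenerating P) (X Y : C) :
    Function.Bijective (hi.resFunctor.map : Hom X Y → Hom (hi.res X) (hi.res Y)) := by
  obtain ⟨μ, hμ, hc⟩ := h
  refine ⟨fun S T hST => ?_, fun T => ?_⟩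
  · rw [map_eq_of_isGenerating hμ S, map_eq_of_isGenerating hμ T, hST]
  · refine ⟨(μ Y)† ⊚ P.L.map ((extFunctor i).map T) ⊚ μ X, ?_⟩
    refine SmallMod.hom_ext fun a f => hi.resHom_injective ?_
    refine (hi.resHom_app_resMap _ f).trans ?_
    have h1 : P.L.map ((extFunctor i).map T) ⊚ μ X ⊚ hi.resHom f =
        μ Y ⊚ hi.resHom (SmallMod.app T f) := by
      rw [hc, hc]
      refine (P.map_ev _ _).trans ?_
      rw [Extension.app_map]
      rfl
    rw [comp_assoc, comp_assoc, h1]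
    exact (hμ.unitary Y).adj_comp_cancel _

/-- A module `M` over the subcategory is the restriction of the colimit of its extension. -/
theorem exists_unitary_res_extension (hi : IsHereditaryEmbedding i)
    (hk : ∀ (a b : D) (k : Hom a b), P.IsAbsolutelyCompact (i.map k)) (M : SmallMod D)
    (E : Extension i M) : ∃ U : Hom M (hi.res (P.L.obj E.mod)), IsUnitary U := by
  have hsq : ∀ {a b : D} (m : M.el a) (m' : M.el b),
      i.map (M.inner m' m) = (P.ev (E.incl b m'))† ⊚ P.ev (E.incl a m) := fun m m' => by
    rw [P.ev_adj_comp, E.inner_incl]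
  let y : ∀ a, M.el a → (hi.res (P.L.obj E.mod)).el a := fun a m =>
    hi.resEl (P.ev (E.incl a m)) ⟨_, hsq m m⟩
  have hin : ∀ a b (m : M.el a) (m' : M.el b),
      M.inner m' m = (hi.res (P.L.obj E.mod)).inner (y b m') (y a m) := by
    intro a b m m'
    refine hi.injective _ _ ?_
    rw [map_inner_res, resHom_resEl, resHom_resEl, hsq]
  have hy : ∀ a, Dense (Submodule.span ℂ (Set.range (y a)) :
      Set ((hi.res (P.L.obj E.mod)).el a)) := by
    intro a z
    set W := Submodule.span ℂ (Set.range (y a))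
    change z ∈ (W.topologicalClosure : Set _)
    refine mem_of_forall_act_mem W.isClosed_topologicalClosure fun e => ?_
    obtain ⟨n, hn⟩ := exists_ev_eq P hk (hi.resHom_mem z)
    rw [act_eq_resComp, ← hn]
    refine apply_mem_of_mem_closedSpan
      ((hi.resComp e _).comp (P.evL E.mod (i.obj a)).toContinuousLinearMap)
      W.isClosed_topologicalClosure ?_ (E.dense _ n)
    rintro _ ⟨b, m, g, rfl⟩
    -- as `m` is a limit of elements `m c`, the morphism `g` may be replaced by `i c ⊚ g`
    let Λ : M.el b →L[ℂ] (hi.res (P.L.obj E.mod)).el a :=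
      (hi.resComp e _).comp (((compL _ _ _).flip g).comp
        ((P.evL E.mod (i.obj b)).toContinuousLinearMap.comp (E.inclL b)))
    have hΛ : hi.resComp e _ (P.ev (E.mod.act (E.incl b m) g)) = Λ m := by
      rw [P.ev_act]; rfl
    refine (congrArg (· ∈ W.topologicalClosure) hΛ).mpr ?_
    refine mem_of_forall_act_mem (W := Λ ⁻¹' W.topologicalClosure)
      (W.isClosed_topologicalClosure.preimage Λ.continuous) fun c => ?_
    obtain ⟨k, hk'⟩ := hi.hereditary e g c
    refine subset_closure (Submodule.subset_span ⟨M.act m k, hi.resHom_injective ?_⟩)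
    change P.ev (E.incl a (M.act m k)) = (P.ev (E.incl b (M.act m c)) ⊚ g) ⊚ i.map e
    rw [E.incl_act, E.incl_act, P.ev_act, P.ev_act, hk', comp_assoc, comp_assoc]
  obtain ⟨U, hU, -⟩ := exists_unitary_of_dense (J := fun a => M.el a) (x := fun a => id) (y := y)
    (fun a => by simp) hy hin
  exact ⟨U, hU⟩

theorem IsGenerating.isEquivalence (h : hi.IsGenerating P)
    (hk : ∀ (a b : D) (k : Hom a b), P.IsAbsolutelyCompact (i.map k)) :
    hi.resFunctor.IsEquivalence where
  bijective := h.bijective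
  essSurj M := by
    obtain ⟨U, hU⟩ := hi.exists_unitary_res_extension (P := P) hk M (extension i M)
    exact ⟨_, U†, hU.symm⟩

end IsHereditaryEmbedding

end RestrictionFunctor

/-! ### Continuity of functors with values in Hilbert modules -/

section Continuity

variable {D : Type u₁} [CStarCat.{v} D] {C : Type u} [CStarCat.{v} C] {P : PreComplete C}

/-- The comparison unitary of a continuous functor, described on the elements of a module: naturality
reduces them to the representable case. -/
lemma PreComplete.IsContinuous.exists_unitary {C' : Type u₂} [CStarCat.{v} C']
    {P' : PreComplete C'} {F : CFunctor C C'} (hF : P.IsContinuous P' F) (N : SmallMod C) :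
    ∃ θ : Hom (P'.L.obj (extension F N).mod) (F.obj (P.L.obj N)), IsUnitary θ ∧
      ∀ (A : C) (n : N.el A), θ ⊚ P'.ev ((extension F N).incl A n) = F.map (P.ev n) := by
  obtain ⟨-, θ, hθ, hc⟩ := hF
  refine ⟨θ N, hθ.unitary N, fun A n => ?_⟩
  obtain ⟨e, he⟩ := P.exists_id A
  have h1 := hc A e he
  have h2 : θ N ⊚ P'.L.map ((extFunctor F).map (ofElem n)) = F.map (P.L.map (ofElem n)) ⊚ θ (yo A) :=
    hθ.natural (ofElem n)
  have h3 : SmallMod.app ((extFunctor F).map (ofElem n)) ((extension F (yo A)).incl A (yoEl e)) =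
      (extension F N).incl A n := by
    refine (Extension.app_map _ _ _ _).trans ?_
    rw [app_ofElem, N.act_id he]
  have h4 : P'.L.map ((extFunctor F).map (ofElem n)) ⊚
      P'.ev ((extension F (yo A)).incl A (yoEl e)) = P'.ev ((extension F N).incl A n) := by
    rw [P'.map_ev, h3]
  rw [← h4, ← comp_assoc, h2, comp_assoc]
  change F.map (P.L.map (ofElem n)) ⊚ θ (yo A) ⊚ P'.L.map _ ⊚ P'.η _ = _
  rw [h1, ← F.map_comp]
  rfl

lemma PreComplete.isContinuous_of_natural {C' : Type u₂} [CStarCat.{v} C'] {P' : PreComplete C'}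
    {F : CFunctor C C'} (hF : F.IsUnital)
    (θ : ∀ N, Hom (P'.L.obj (extension F N).mod) (F.obj (P.L.obj N))) (hθ : ∀ N, IsUnitary (θ N))
    (hnat : ∀ {N N' : SmallMod C} (T : Hom N N'),
      θ N' ⊚ P'.L.map ((extension F N).map (extension F N') T) = F.map (P.L.map T) ⊚ θ N)
    (hc : ∀ N A (n : N.el A), θ N ⊚ P'.ev ((extension F N).incl A n) = F.map (P.ev n)) :
    P.IsContinuous P' F := by
  refine ⟨hF, θ, ⟨hθ, fun T => hnat T⟩, fun X e he => ?_⟩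
  refine (hc (yo X) X (yoEl e)).trans ?_
  congr 1
  rw [PreComplete.ev, ofElem_yoEl, ← P.η_natural, he.1]

variable {F : CFunctor C (SmallMod D)}

/-- The elements of `F (L N)` that come from elements of `N`. -/
def colimitElements (P : PreComplete C) (F : CFunctor C (SmallMod D)) (N : SmallMod C) (d : D) :
    Set ((F.obj (P.L.obj N)).el d) :=
  {z | ∃ (A : C) (n : N.el A) (k : (F.obj A).el d), z = SmallMod.app (F.map (P.ev n)) k}

lemma dense_restriction_extension (F : CFunctor C (SmallMod D)) (N : SmallMod C) (d : D) :
    Dense (Submodule.span ℂ (Set.range fun j : (A : C) × N.el A × (F.obj A).el d =>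
      SmallMod.app ((hilbPreComplete D).ev ((extension F N).incl j.1 j.2.1)) j.2.2) :
      Set (((hilbPreComplete D).L.obj (extension F N).mod).el d)) := by
  have h := dense_restriction (J := (A : C) × N.el A) (K := fun j => F.obj j.1)
    (g := fun j => (extension F N).incl j.1 j.2) (fun B => by
      refine ((extension F N).dense B).mono (Submodule.span_mono ?_)
      rintro _ ⟨A, n, g, rfl⟩
      exact ⟨⟨A, n⟩, g, rfl⟩) d
  refine h.mono (Submodule.span_mono ?_)
  rintro _ ⟨⟨A, n⟩, k, rfl⟩
  exact ⟨⟨A, n, k⟩, rfl⟩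

/-- A continuous functor with values in Hilbert modules sends colimits to modules generated by the
images of the elements. -/
theorem PreComplete.IsContinuous.dense_colimitElements
    (hF : P.IsContinuous (hilbPreComplete D) F) (N : SmallMod C) (d : D) :
    Dense (Submodule.span ℂ (colimitElements P F N d) : Set ((F.obj (P.L.obj N)).el d)) := by
  intro z
  obtain ⟨θ, hθ, hc⟩ := hF.exists_unitary N
  have h1 := dense_restriction_extension F N d (SmallMod.app θ† z)
  rw [← app_app_adj hθ z]
  refine apply_mem_of_mem_closedSpan (SmallMod.appL θ d)
    (W := (Submodule.span ℂ (colimitElements P F N d)).topologicalClosure)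
    (Submodule.isClosed_topologicalClosure _) ?_ h1
  rintro _ ⟨⟨A, n, k⟩, rfl⟩
  refine subset_closure (Submodule.subset_span ⟨A, n, k, ?_⟩)
  rw [← hc, SmallMod.app_comp, SmallMod.appL_apply]

lemma inner_app_ev (P' : PreComplete (SmallMod D)) {N : SmallMod C} (E : Extension F N)
    {d d' : D} {A A' : C} (n : N.el A) (n' : N.el A') (k : (F.obj A).el d)
    (k' : (F.obj A').el d') :
    (P'.L.obj E.mod).inner (SmallMod.app (P'.ev (E.incl A' n')) k')
        (SmallMod.app (P'.ev (E.incl A n)) k) =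
      (F.obj (P.L.obj N)).inner (SmallMod.app (F.map (P.ev n')) k')
        (SmallMod.app (F.map (P.ev n)) k) := by
  rw [SmallMod.app_inner, SmallMod.app_inner, ← SmallMod.app_comp, ← SmallMod.app_comp,
    P'.ev_adj_comp, E.inner_incl, ← F.map_adj, ← F.map_comp, P.ev_adj_comp]

/-- A unital functor with values in Hilbert modules is continuous if it sends colimits to modules
generated by the images of the elements. -/
theorem isContinuous_of_dense_colimitElements (hF : F.IsUnital)
    (h : ∀ N d, Dense (Submodule.span ℂ (colimitElements P F N d) :
      Set ((F.obj (P.L.obj N)).el d))) : P.IsContinuous (hilbPreComplete D) F := by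
  have hex := fun N : SmallMod C => exists_unitary_of_dense
    (J := fun d => (A : C) × N.el A × (F.obj A).el d)
    (x := fun d j => SmallMod.app ((hilbPreComplete D).ev ((extension F N).incl j.1 j.2.1)) j.2.2)
    (y := fun d j => SmallMod.app (F.map (P.ev j.2.1)) j.2.2)
    (dense_restriction_extension F N)
    (fun d => (h N d).mono (Submodule.span_mono (by
      rintro _ ⟨A, n, k, rfl⟩
      exact ⟨⟨A, n, k⟩, rfl⟩)))
    (fun d d' j j' => inner_app_ev _ _ _ _ _ _)
  choose θ hθ hc using hex
  have hc' : ∀ N A (n : N.el A), θ N ⊚ (hilbPreComplete D).ev ((extension F N).incl A n) =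
      F.map (P.ev n) := fun N A n => SmallMod.hom_ext fun d k => by
    rw [SmallMod.app_comp]
    exact hc N d ⟨A, n, k⟩
  have hnat : ∀ {N N' : SmallMod C} (T : Hom N N'),
      θ N' ⊚ (hilbPreComplete D).L.map ((extension F N).map (extension F N') T) =
        F.map (P.L.map T) ⊚ θ N := fun {N N'} T => by
    refine SmallMod.hom_ext_of_dense (dense_restriction_extension F N) fun d j => ?_
    have h1 : (θ N' ⊚ (hilbPreComplete D).L.map ((extension F N).map (extension F N') T)) ⊚
        (hilbPreComplete D).ev ((extension F N).incl j.1 j.2.1) =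
          (F.map (P.L.map T) ⊚ θ N) ⊚ (hilbPreComplete D).ev ((extension F N).incl j.1 j.2.1) := by
      rw [comp_assoc, comp_assoc, hc', PreComplete.map_ev, Extension.app_map, hc', ← F.map_comp,
        P.map_ev]
    have h2 := congrArg (fun S => SmallMod.app S j.2.2) h1
    simpa only [SmallMod.app_comp] using h2
  exact PreComplete.isContinuous_of_natural hF θ hθ hnat hc'

end Continuity

section RestrictionContinuity

variable {D : Type u₁} [CStarCat.{v} D] {C : Type u} [CStarCat.{v} C] {P : PreComplete C}
  {i : CFunctor D C}

theorem IsHereditaryEmbedding.isContinuous_resFunctor (hi : IsHereditaryEmbedding i)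
    (hk : ∀ (a b : D) (k : Hom a b), P.IsAbsolutelyCompact (i.map k)) :
    P.IsContinuous (hilbPreComplete D) hi.resFunctor := by
  refine isContinuous_of_dense_colimitElements (isUnital_resFunctor hi) fun N d z => ?_
  refine mem_of_forall_act_mem isClosed_closure fun e => ?_
  -- if `z` comes from the element `n` of `N`, then `z e` is the image of `i e` under `ev n`
  obtain ⟨n, hn⟩ := exists_ev_eq P hk (hi.resHom_mem z)
  refine subset_closure (Submodule.subset_span
    ⟨i.obj d, n, hi.resEl (i.map e) ⟨e† ⊚ e, by simp⟩, hi.resHom_injective ?_⟩)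
  refine Eq.trans ?_ (hi.resHom_app_resMap _ _).symm
  rw [hn]
  rfl

end RestrictionContinuity

/-! ### Representable modules in a category equivalent to Hilbert modules -/

section Representables

variable {D : Type u₁} [CStarCat.{v} D] {C : Type u} [CStarCat.{v} C] {P : PreComplete C}
  {F : CFunctor C (SmallMod D)}

lemma CFunctor.IsEquivalence.isId {C' : Type u₂} [CStarCat.{v} C'] {F : CFunctor C C'}
    (hF : F.IsEquivalence) {X : C} {e : Hom X X} (he : IsId (F.map e)) : IsId e :=
  ⟨fun Y f => (hF.bijective X Y).1 (by rw [F.map_comp, he.1]),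
    fun Y f => (hF.bijective Y X).1 (by rw [F.map_comp, he.2])⟩

lemma CFunctor.IsEquivalence.isUnitary {C' : Type u₂} [CStarCat.{v} C'] {F : CFunctor C C'}
    (hF : F.IsEquivalence) {X Y : C} {t : Hom X Y} (ht : IsUnitary (F.map t)) : IsUnitary t := by
  refine ⟨hF.isId ?_, hF.isId ?_⟩
  · rw [F.map_comp, F.map_adj]; exact ht.1
  · rw [F.map_comp, F.map_adj]; exact ht.2

/-- The functor `i` is a lift of the Yoneda embedding along `F`, up to the unitary
isomorphisms `t`. -/
structure IsYonedaLift (F : CFunctor C (SmallMod D)) (i : CFunctor D C)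
    (t : ∀ d, Hom (F.obj (i.obj d)) (yo d)) : Prop where
  unitary : ∀ d, IsUnitary (t d)
  map_map : ∀ {a b : D} (k : Hom a b), F.map (i.map k) = (t b)† ⊚ yoMap k ⊚ t a

lemma CFunctor.IsEquivalence.exists_isYonedaLift (hF : F.IsEquivalence) :
    ∃ (i : CFunctor D C) (t : ∀ d, Hom (F.obj (i.obj d)) (yo d)), IsYonedaLift F i t := by
  choose X t ht using fun d : D => hF.essSurj (yo d)
  choose m hm using fun (a b : D) (k : Hom a b) =>
    (hF.bijective (X a) (X b)).2 ((t b)† ⊚ yoMap k ⊚ t a)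
  let i : CFunctor D C :=
    { obj := X
      map := fun k => m _ _ k
      map_add := fun {a b} f g => (hF.bijective _ _).1 (by
        have e1 : yoMap (f + g) = yoMap f + yoMap g := (yoneda D).map_add f g
        rw [F.map_add, hm, hm, hm, e1, add_comp, comp_add])
      map_smul := fun c f => (hF.bijective _ _).1 (by
        have e1 : yoMap (c • f) = c • yoMap f := (yoneda D).map_smul c f
        rw [F.map_smul, hm, hm, e1, smul_comp, comp_smul])
      map_comp := fun {a b c} g f => (hF.bijective _ _).1 (by
        rw [F.map_comp, hm, hm, hm, yoMap_comp, comp_assoc, comp_assoc, comp_assoc,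
          (ht b).comp_adj_cancel])
      map_adj := fun f => (hF.bijective _ _).1 (by
        rw [F.map_adj, hm, hm, yoMap_adj, adj_comp, adj_comp, adj_adj, comp_assoc]) }
  exact ⟨i, t, ht, fun k => hm _ _ k⟩

variable {i : CFunctor D C} {t : ∀ d, Hom (F.obj (i.obj d)) (yo d)}

/-- The image of the colimit of the extension of a module `M` is generated by the elements
of `M`. -/
lemma dense_ev_incl (hc : P.IsContinuous (hilbPreComplete D) F) {M : SmallMod D}
    (E : Extension i M) (d : D) :
    Dense (Submodule.span ℂ (Set.range fun j : (a : D) × M.el a × (F.obj (i.obj a)).el d =>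
      SmallMod.app (F.map (P.ev (E.incl j.1 j.2.1))) j.2.2) :
      Set ((F.obj (P.L.obj E.mod)).el d)) := by
  intro z
  set W := Submodule.span ℂ (Set.range fun j : (a : D) × M.el a × (F.obj (i.obj a)).el d =>
      SmallMod.app (F.map (P.ev (E.incl j.1 j.2.1))) j.2.2)
  refine apply_mem_of_mem_closedSpan (ContinuousLinearMap.id ℂ _) W.isClosed_topologicalClosure ?_
    (hc.dense_colimitElements E.mod d z)
  rintro _ ⟨A, n, k, rfl⟩
  refine apply_mem_of_mem_closedSpan ((evalL k (F.obj (P.L.obj E.mod))).comp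
    ((F.mapL A (P.L.obj E.mod)).comp (P.evL E.mod A).toContinuousLinearMap))
    W.isClosed_topologicalClosure ?_ (E.dense A n)
  rintro _ ⟨a, m, g, rfl⟩
  refine subset_closure (Submodule.subset_span ⟨⟨a, m, SmallMod.app (F.map g) k⟩, ?_⟩)
  change _ = SmallMod.app (F.map (P.ev (E.mod.act (E.incl a m) g))) k
  rw [P.ev_act, F.map_comp, SmallMod.app_comp]

lemma inner_app_resHom (hi : IsHereditaryEmbedding i) {Y : C}
    (E : Extension i (hi.res Y)) {d d' a a' : D} (f : (hi.res Y).el a) (f' : (hi.res Y).el a')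
    (k : (F.obj (i.obj a)).el d) (k' : (F.obj (i.obj a')).el d') :
    (F.obj Y).inner (SmallMod.app (F.map (hi.resHom f')) k')
        (SmallMod.app (F.map (hi.resHom f)) k) =
      (F.obj (P.L.obj E.mod)).inner (SmallMod.app (F.map (P.ev (E.incl a' f'))) k')
        (SmallMod.app (F.map (P.ev (E.incl a f))) k) := by
  rw [SmallMod.app_inner, SmallMod.app_inner, ← SmallMod.app_comp, ← SmallMod.app_comp,
    ← F.map_adj, ← F.map_comp, ← F.map_adj, ← F.map_comp, P.ev_adj_comp, E.inner_incl,
    hi.map_inner_res]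

attribute [local irreducible] IsHereditaryEmbedding.res IsHereditaryEmbedding.resMap extension
  Extension.map in
lemma IsHereditaryEmbedding.isGenerating_of_natural (hi : IsHereditaryEmbedding i)
    (μ : ∀ Y : C, Hom Y (P.L.obj (extension i (hi.res Y)).mod)) (hμ : ∀ Y, IsUnitary (μ Y))
    (hnat : ∀ {Y Y' : C} (g : Hom Y Y'), μ Y' ⊚ g = P.L.map
      ((extension i (hi.res Y)).map (extension i (hi.res Y')) (hi.resMap g)) ⊚ μ Y)
    (hμf : ∀ (Y : C) (a : D) (f : (hi.res Y).el a),
      μ Y ⊚ hi.resHom f = P.ev ((extension i (hi.res Y)).incl a f)) : hi.IsGenerating P :=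
  ⟨μ, ⟨hμ, fun g => hnat g⟩, hμf⟩

namespace IsYonedaLift

lemma isHereditaryEmbedding (h : IsYonedaLift F i t) (hF : F.IsEquivalence) :
    IsHereditaryEmbedding i where
  injective a b k k' hk := by
    refine yoMap_injective a b ?_
    have h1 := congrArg (fun S => t b ⊚ F.map S ⊚ (t a)†) hk
    simp only [h.map_map, comp_assoc, (h.unitary b).comp_adj_cancel] at h1
    rwa [(h.unitary a).2.1, (h.unitary a).2.1] at h1
  hereditary {a b c e} f g k := by
    obtain ⟨l, hl⟩ := (isHereditaryEmbedding_yoneda D).hereditary f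
      (t c ⊚ F.map g ⊚ (t b)†) k
    refine ⟨l, (hF.bijective _ _).1 ?_⟩
    change yoMap l = yoMap k ⊚ (t c ⊚ F.map g ⊚ (t b)†) ⊚ yoMap f at hl
    rw [F.map_comp, F.map_comp, h.map_map, h.map_map, h.map_map, hl]
    simp only [comp_assoc]

/-- Elements of `F Y` over `d`, composed with `t d`, are the images of the elements of the
restriction of `Y`. -/
lemma exists_resHom (h : IsYonedaLift F i t) (hF : F.IsEquivalence)
    (hi : IsHereditaryEmbedding i) {Y : C} {d : D} (m : (F.obj Y).el d) :
    ∃ f : (hi.res Y).el d, F.map (hi.resHom f) = ofElem m ⊚ t d := by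
  obtain ⟨f, hf⟩ := (hF.bijective (i.obj d) Y).2 (ofElem m ⊚ t d)
  refine ⟨hi.resEl f ⟨(F.obj Y).inner m m, (hF.bijective _ _).1 ?_⟩, hf⟩
  rw [F.map_comp, F.map_adj, hf, h.map_map, ← ofElem_adj_comp, adj_comp]
  simp only [comp_assoc]

/-- The restriction of `Y` generates `F Y`. -/
lemma dense_resHom (h : IsYonedaLift F i t) (hF : F.IsEquivalence)
    (hi : IsHereditaryEmbedding i) (Y : C) (d : D) :
    Dense (Submodule.span ℂ (Set.range fun j : (a : D) × (hi.res Y).el a × (F.obj (i.obj a)).el d =>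
      SmallMod.app (F.map (hi.resHom j.2.1)) j.2.2) : Set ((F.obj Y).el d)) := by
  intro m
  refine mem_of_forall_act_mem isClosed_closure fun e => ?_
  obtain ⟨f, hf⟩ := h.exists_resHom hF hi m
  refine subset_closure (Submodule.subset_span ⟨⟨d, f, SmallMod.app (t d)† (yoEl e)⟩, ?_⟩)
  change SmallMod.app (F.map (hi.resHom f)) (SmallMod.app (t d)† (yoEl e)) = _
  rw [hf, SmallMod.app_comp, app_app_adj (h.unitary d), app_ofElem]

/-- The unitary `μ Y` is the preimage under `F` of the operator that identifies the generators
`F f k` of `F Y` with those of the colimit, for `f` in the restriction of `Y`. -/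
theorem isGenerating (h : IsYonedaLift F i t) (hF : F.IsEquivalence)
    (hc : P.IsContinuous (hilbPreComplete D) F) (hi : IsHereditaryEmbedding i) :
    hi.IsGenerating P := by
  have hex := fun Y : C => exists_unitary_of_dense
    (J := fun d => (a : D) × (hi.res Y).el a × (F.obj (i.obj a)).el d)
    (x := fun d j => SmallMod.app (F.map (hi.resHom j.2.1)) j.2.2)
    (y := fun d j => SmallMod.app (F.map (P.ev ((extension i (hi.res Y)).incl j.1 j.2.1))) j.2.2)
    (h.dense_resHom hF hi Y) (dense_ev_incl hc _)
    (fun d d' j j' => inner_app_resHom hi _ _ _ _ _)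
  choose U hU hUx using hex
  choose μ hμ using fun Y : C => (hF.bijective Y (P.L.obj (extension i (hi.res Y)).mod)).2 (U Y)
  have hμf : ∀ (Y : C) (a : D) (f : (hi.res Y).el a),
      μ Y ⊚ hi.resHom f = P.ev ((extension i (hi.res Y)).incl a f) := fun Y a f => by
    refine (hF.bijective _ _).1 (SmallMod.hom_ext fun d k => ?_)
    rw [F.map_comp, hμ, SmallMod.app_comp]
    exact hUx Y d ⟨a, f, k⟩
  have hnat : ∀ {Y Y' : C} (g : Hom Y Y'), μ Y' ⊚ g = P.L.map
      ((extension i (hi.res Y)).map (extension i (hi.res Y')) (hi.resMap g)) ⊚ μ Y := by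
    intro Y Y' g
    refine (hF.bijective _ _).1 (SmallMod.hom_ext_of_dense (h.dense_resHom hF hi Y) fun d j => ?_)
    have h1 : (μ Y' ⊚ g) ⊚ hi.resHom j.2.1 = (P.L.map
        ((extension i (hi.res Y)).map (extension i (hi.res Y')) (hi.resMap g)) ⊚ μ Y) ⊚
          hi.resHom j.2.1 := by
      rw [comp_assoc, comp_assoc, hμf, P.map_ev, Extension.app_map, ← hμf, hi.resHom_app_resMap]
    have h2 := congrArg (fun S => SmallMod.app (F.map S) j.2.2) h1
    simpa only [F.map_comp, SmallMod.app_comp] using h2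
  exact hi.isGenerating_of_natural μ (fun Y => hF.isUnitary (by rw [hμ]; exact hU Y)) hnat hμf

end IsYonedaLift

/-- The image of `B` for a weakly dense hereditary subalgebra `B` of the endomorphisms of `Z`
generates `F Z`. -/
lemma HereditarySubalgebra.IsWeaklyDense.dense_app (hc : P.IsContinuous (hilbPreComplete D) F)
    {Z : C} {B : HereditarySubalgebra Z} (hB : B.IsWeaklyDense P) (d : D) :
    Dense (Submodule.span ℂ {z : (F.obj Z).el d | ∃ b ∈ B.carrier, ∃ m : (F.obj Z).el d,
      z = SmallMod.app (F.map b) m} : Set ((F.obj Z).el d)) := by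
  obtain ⟨t, ht, htg⟩ := hB
  intro z
  set W := Submodule.span ℂ {z : (F.obj Z).el d | ∃ b ∈ B.carrier, ∃ m : (F.obj Z).el d,
      z = SmallMod.app (F.map b) m}
  have h1 := hc.dense_colimitElements B.mod d (SmallMod.app (F.map t)† z)
  rw [← app_app_adj (ht.map hc.1) z]
  refine apply_mem_of_mem_closedSpan (SmallMod.appL (F.map t) d) W.isClosed_topologicalClosure ?_ h1
  rintro _ ⟨A, g, k, rfl⟩
  have h2 : SmallMod.app (F.map t) (SmallMod.app (F.map (P.ev g)) k) =
      SmallMod.app (F.map (show B.space A from g).1) k := by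
    rw [← SmallMod.app_comp, ← F.map_comp]
    exact congrArg (fun S => SmallMod.app (F.map S) k) (htg A g)
  refine (congrArg (· ∈ W.topologicalClosure) h2).mpr ?_
  refine apply_mem_of_mem_closedSpan ((evalL k (F.obj Z)).comp (F.mapL A Z))
    W.isClosed_topologicalClosure ?_ (show B.space A from g).2
  rintro _ ⟨b, hb, h, rfl⟩
  refine subset_closure (Submodule.subset_span ⟨b, hb, SmallMod.app (F.map h) k, ?_⟩)
  change SmallMod.app (F.map (b ⊚ h)) k = _
  rw [F.map_comp, SmallMod.app_comp]

/-- The image of a weakly dense hereditary subalgebra contains all operators of rank one. -/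
lemma HereditarySubalgebra.IsWeaklyDense.exists_map_eq (hF : F.IsEquivalence)
    (hc : P.IsContinuous (hilbPreComplete D) F) {Z : C} {B : HereditarySubalgebra Z}
    (hB : B.IsWeaklyDense P) {d : D} (m m' : (F.obj Z).el d) :
    ofElem m ⊚ (ofElem m')† ∈ B.toSubmodule.map (F.mapL Z Z).toLinearMap := by
  set W := B.toSubmodule.map (F.mapL Z Z).toLinearMap
  have hW : IsClosed (W : Set (Hom (F.obj Z) (F.obj Z))) := by
    have hiso : Isometry (F.mapL Z Z) :=
      AddMonoidHomClass.isometry_of_norm _ fun f => F.norm_map (fun X Y => (hF.bijective X Y).1) f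
    exact hiso.isClosedEmbedding.isClosedMap _ B.isClosed
  have hadj : ∀ {S : Hom (F.obj Z) (F.obj Z)}, S ∈ W → S† ∈ W := by
    rintro _ ⟨b, hb, rfl⟩
    exact ⟨b†, B.adj_mem hb, F.map_adj b⟩
  let Λ : (F.obj Z).el d → (F.obj Z).el d →L[ℂ] Hom (F.obj Z) (F.obj Z) := fun m' =>
    ((compL _ _ _).flip (ofElem m')†).comp (ofElemL _ d).toContinuousLinearMap
  have hΛ : ∀ m m', Λ m' m = ofElem m ⊚ (ofElem m')† := fun _ _ => rfl
  rw [← hΛ]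
  refine apply_mem_of_mem_closedSpan (Λ m') hW ?_ (hB.dense_app hc d m)
  rintro _ ⟨b, hb, z, rfl⟩
  -- the adjoint exchanges the two arguments, so that linearity applies to the second one as well
  rw [hΛ, ← adj_adj (ofElem _ ⊚ _), adj_comp, adj_adj, ← hΛ]
  refine hadj (apply_mem_of_mem_closedSpan (Λ _) hW ?_ (hB.dense_app hc d m'))
  rintro _ ⟨b', hb', z', rfl⟩
  obtain ⟨f, hf⟩ := (hF.bijective Z Z).2 (ofElem z' ⊚ (ofElem z)†)
  refine ⟨b' ⊚ f ⊚ b†, B.hereditary f hb' (B.adj_mem hb), ?_⟩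
  change F.map _ = _
  rw [hΛ, F.map_comp, F.map_comp, hf, F.map_adj, ← comp_ofElem, ← comp_ofElem, adj_comp]
  simp only [comp_assoc]

/-- By an approximate unit, the morphisms `i k` may be replaced by `i (k ⊚ e)`, which factor in
Hilbert modules into two operators from and to a representable module. -/
theorem IsYonedaLift.isAbsolutelyCompact (h : IsYonedaLift F i t) (hF : F.IsEquivalence)
    (hc : P.IsContinuous (hilbPreComplete D) F) {a b : D} (k : Hom a b) :
    P.IsAbsolutelyCompact (i.map k) := by
  intro Z h₁ h₂ B hB
  have hW : IsClosed {k : Hom a b | h₂† ⊚ i.map k ⊚ h₁ ∈ B.carrier} :=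
    B.isClosed.preimage (f := fun k => h₂† ⊚ i.map k ⊚ h₁) (by fun_prop)
  refine mem_of_forall_act_mem (M := yo b) (m := yoEl k) hW fun e => ?_
  -- the morphism `h₂† ⊚ i (k ⊚ e) ⊚ h₁` is sent to an operator of rank one
  have h1 := hB.exists_map_eq hF hc
    (SmallMod.app ((F.map h₂)† ⊚ (t b)†) (yoEl k)) (SmallMod.app ((F.map h₁)† ⊚ (t a)†) (yoEl e†))
  obtain ⟨x, hx, hxe⟩ := h1
  have h2 : h₂† ⊚ i.map (k ⊚ e) ⊚ h₁ = x := by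
    refine (hF.bijective _ _).1 (Eq.trans ?_ hxe.symm)
    rw [F.map_comp, F.map_comp, F.map_adj, h.map_map, yoMap_comp, ← comp_ofElem, ← comp_ofElem,
      ofElem_yoEl, ofElem_yoEl, yoMap_adj]
    simp only [adj_comp, adj_adj, comp_assoc]
  change h₂† ⊚ i.map (k ⊚ e) ⊚ h₁ ∈ B.carrier
  rw [h2]
  exact hx

end Representables

end CStarCat

theorem mainTheorem3 {D : Type w} [CStarCat.{v} D] {C : Type u} [CStarCat.{v} C]
    (P : CStarCat.PreComplete C) :
    ((∃ F : CStarCat.CFunctor C (CStarCat.SmallMod D),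
        F.IsEquivalence ∧ P.IsContinuous (CStarCat.hilbPreComplete D) F) ↔
      ∃ (i : CStarCat.CFunctor D C) (hi : CStarCat.IsHereditaryEmbedding i),
        hi.IsGenerating P ∧
        ∀ (a b : D) (k : CStarCat.Hom a b), P.IsAbsolutelyCompact (i.map k)) ∧
    ∀ (i : CStarCat.CFunctor D C) (hi : CStarCat.IsHereditaryEmbedding i),
      hi.IsGenerating P →
      (∀ (a b : D) (k : CStarCat.Hom a b), P.IsAbsolutelyCompact (i.map k)) →
        hi.resFunctor.IsEquivalence ∧
          P.IsContinuous (CStarCat.hilbPreComplete D) hi.resFunctor := by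
  have h : ∀ (i : CStarCat.CFunctor D C) (hi : CStarCat.IsHereditaryEmbedding i),
      hi.IsGenerating P →
      (∀ (a b : D) (k : CStarCat.Hom a b), P.IsAbsolutelyCompact (i.map k)) →
        hi.resFunctor.IsEquivalence ∧
          P.IsContinuous (CStarCat.hilbPreComplete D) hi.resFunctor :=
    fun i hi hg hk => ⟨hg.isEquivalence hk, hi.isContinuous_resFunctor hk⟩
  refine ⟨⟨?_, ?_⟩, h⟩
  · rintro ⟨F, hF, hc⟩
    obtain ⟨i, t, hit⟩ := hF.exists_isYonedaLift
    have hi := hit.isHereditaryEmbedding hF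
    exact ⟨i, hi, hit.isGenerating hF hc hi, fun a b k => hit.isAbsolutelyCompact hF hc k⟩
  · rintro ⟨i, hi, hg, hk⟩
    exact ⟨hi.resFunctor, h i hi hg hk⟩
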